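/- Let $\ell\ge 2$, let $u_0,u_1,\dots,u_m,v_0,v_1,\dots,v_n$ be positive integers with $\gcd(u_0,v_0)=1$ and $m+n\ge 5$, and let $f\in\mathbb C[x_1,\dots,x_m]$, $g\in\mathbb C[y_1,\dots,y_n]$ be weighted homogeneous of degrees $\ell u_0$ and $\ell v_0$ for the weights $u=(u_1,\dots,u_m)$ and $v=(v_1,\dots,v_n)$. Consider the weighted projective hypersurfaces $$X_1=\{x_0^\ell+f(x)=0\}\subset\mathbb P(u_0,u),\qquad X_2=\{y_0^\ell+g(y)=0\}\subset\mathbb P(v_0,v),$$ $$X=\{f(x)-g(y)=0\}\subset\mathbb P(v_0u_1,\dots,v_0u_m,u_0v_1,\dots,u_0v_n).$$ A weighted projective hypersurface $\{F=0\}\subset\mathbb P(w)$ is called *non-degenerate* if the affine cone $\{F=0\}$ is smooth outside the origin; it is called *well-formed* if $w$ is normalized (leaving out any one weight, the remaining ones have greatest common divisor $1$) and the hypersurface contains no stratum $\{x_i=x_j=0\}$, $i\ne j$, for which the remaining weights have a common factor greater than $1$. A *Calabi–Yau variety* is a proper normal (integral) complex variety $Y$ with canonical singularities, trivial canonical sheaf,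 and $H^i(Y,\mathcal O_Y)=0$ for $0<i<\dim Y$. Suppose that $X_1$ and $X_2$ are well-formed, non-degenerate Calabi–Yau varieties. Then $X$ is non-degenerate, and $X$ is a Calabi–Yau variety if and only if $\ell=2$. -/

import Mathlib

open CategoryTheory AlgebraicGeometry MvPolynomial

noncomputable section

namespace WeightedCY

section Graded

variable {σ : Type} (w : σ → ℕ) (F : MvPolynomial σ ℂ)

/-- The coordinate ring `ℂ[x] / (F)` of the affine cone `{F = 0}`. -/
abbrev CoordRing : Type := MvPolynomial σ ℂ ⧸ Ideal.span {F}

/-- The degree `k` part of `ℂ[x] / (F)`: classes of `w`-weighted homogeneous polynomials of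
degree `k`. -/
def coordGrading (k : ℕ) : Submodule ℂ (CoordRing F) :=
  (weightedHomogeneousSubmodule ℂ w k).map (Ideal.Quotient.mkₐ ℂ (Ideal.span {F})).toLinearMap

theorem mk_mem_coordGrading {k : ℕ} {p : MvPolynomial σ ℂ} (hp : IsWeightedHomogeneous w p k) :
    Ideal.Quotient.mkₐ ℂ (Ideal.span {F}) p ∈ coordGrading w F k :=
  Submodule.mem_map.2 ⟨p, (mem_weightedHomogeneousSubmodule ℂ w k p).2 hp, rfl⟩

instance coordGrading_gradedMonoid : SetLike.GradedMonoid (coordGrading w F) where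
  one_mem := by
    have h := mk_mem_coordGrading w F (isWeightedHomogeneous_one ℂ w)
    rwa [map_one] at h
  mul_mem := by
    rintro i j _ _ ⟨p, hp, rfl⟩ ⟨q, hq, rfl⟩
    have h := mk_mem_coordGrading w F (IsWeightedHomogeneous.mul hp hq)
    rw [map_mul] at h
    exact h

/-- The map `ℂ[x] → ⨁ k, (ℂ[x] / (F))_k` sending each variable to its class. -/
def decomposeAux : MvPolynomial σ ℂ →ₐ[ℂ] DirectSum ℕ fun k => coordGrading w F k :=
  aeval fun i => DirectSum.of (fun k => coordGrading w F k) (w i)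
    ⟨Ideal.Quotient.mkₐ ℂ (Ideal.span {F}) (X i),
      mk_mem_coordGrading w F (isWeightedHomogeneous_X ℂ w i)⟩

theorem decomposeAux_monomial (a : σ →₀ ℕ) (c : ℂ) :
    decomposeAux w F (monomial a c) =
      DirectSum.of (fun k => coordGrading w F k) (Finsupp.weight w a)
        ⟨Ideal.Quotient.mkₐ ℂ (Ideal.span {F}) (monomial a c),
          mk_mem_coordGrading w F (isWeightedHomogeneous_monomial w a c rfl)⟩ := by
  induction a using Finsupp.induction_linear generalizing c with
  | zero =>
    have h1 : decomposeAux w F (monomial 0 c) = algebraMap ℂ _ c := AlgHom.commutes _ c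
    rw [h1, DirectSum.algebraMap_apply]
    exact DirectSum.of_eq_of_gradedMonoid_eq (Sigma.subtype_ext (map_zero _).symm rfl)
  | add a b ha hb =>
    have h1 : (monomial (a + b) c : MvPolynomial σ ℂ) = monomial a c * monomial b 1 := by
      rw [monomial_mul, mul_one]
    refine (congrArg (decomposeAux w F) h1).trans ?_
    rw [map_mul, ha, hb, DirectSum.of_mul_of]
    refine DirectSum.of_eq_of_gradedMonoid_eq (Sigma.subtype_ext ?_ ?_)
    · exact (map_add _ _ _).symm
    · exact (map_mul (Ideal.Quotient.mkₐ ℂ (Ideal.span {F})) _ _).symm.trans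
        (congrArg (Ideal.Quotient.mkₐ ℂ (Ideal.span {F})) h1.symm)
  | single i n =>
    have h1 : (monomial (Finsupp.single i n) c : MvPolynomial σ ℂ) =
        algebraMap ℂ _ c * X i ^ n := by
      rw [MvPolynomial.algebraMap_eq, C_mul_X_pow_eq_monomial]
    have h2 : decomposeAux w F (X i) = DirectSum.of (fun k => coordGrading w F k) (w i)
        ⟨Ideal.Quotient.mkₐ ℂ (Ideal.span {F}) (X i),
          mk_mem_coordGrading w F (isWeightedHomogeneous_X ℂ w i)⟩ := aeval_X _ i
    refine (congrArg (decomposeAux w F) h1).trans ?_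
    rw [map_mul, map_pow, h2, AlgHom.commutes, DirectSum.algebraMap_apply, DirectSum.ofPow,
      DirectSum.of_mul_of]
    refine DirectSum.of_eq_of_gradedMonoid_eq (Sigma.subtype_ext ?_ ?_)
    · change 0 + n • w i = Finsupp.weight w (Finsupp.single i n)
      rw [Finsupp.weight_single, zero_add]
    · refine Eq.trans ?_ (congrArg (Ideal.Quotient.mkₐ ℂ (Ideal.span {F})) h1.symm)
      rw [map_mul, map_pow, AlgHom.commutes]
      rfl

theorem decomposeAux_of_homogeneous {k : ℕ} {p : MvPolynomial σ ℂ}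
    (hp : IsWeightedHomogeneous w p k) :
    decomposeAux w F p = DirectSum.of (fun k => coordGrading w F k) k
        ⟨Ideal.Quotient.mkₐ ℂ (Ideal.span {F}) p, mk_mem_coordGrading w F hp⟩ := by
  have key : ∀ a : p.support, decomposeAux w F (monomial a.1 (coeff a.1 p)) =
      DirectSum.lof ℂ ℕ (fun k => coordGrading w F k) k
        (⟨Ideal.Quotient.mkₐ ℂ (Ideal.span {F}) (monomial a.1 (coeff a.1 p)),
          mk_mem_coordGrading w F (isWeightedHomogeneous_monomial w a.1 _
            (hp (mem_support_iff.1 a.2)))⟩ : coordGrading w F k) := by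
    intro a
    rw [decomposeAux_monomial]
    exact DirectSum.of_eq_of_gradedMonoid_eq
      (Sigma.subtype_ext (hp (mem_support_iff.1 a.2)) rfl)
  conv_lhs => rw [p.as_sum, map_sum, ← Finset.sum_attach]
  rw [Finset.sum_congr rfl fun a _ => key a, ← map_sum]
  refine congrArg (DirectSum.lof ℂ ℕ (fun k => coordGrading w F k) k) (Subtype.ext ?_)
  rw [AddSubmonoidClass.coe_finsetSum]
  change ∑ a ∈ p.support.attach, Ideal.Quotient.mkₐ ℂ (Ideal.span {F})
    (monomial a.1 (coeff a.1 p)) = Ideal.Quotient.mkₐ ℂ (Ideal.span {F}) p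
  rw [Finset.sum_attach p.support fun a => Ideal.Quotient.mkₐ ℂ (Ideal.span {F})
    (monomial a (coeff a p)), ← map_sum, ← p.as_sum]

theorem decomposeAux_eq_zero {d : ℕ} (hF : IsWeightedHomogeneous w F d)
    (a : MvPolynomial σ ℂ) (ha : a ∈ Ideal.span {F}) : decomposeAux w F a = 0 := by
  obtain ⟨b, rfl⟩ := Ideal.mem_span_singleton'.1 ha
  have h0 : decomposeAux w F F = 0 := by
    rw [decomposeAux_of_homogeneous w F hF]
    have : (⟨Ideal.Quotient.mkₐ ℂ (Ideal.span {F}) F, mk_mem_coordGrading w F hF⟩ :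
        coordGrading w F d) = 0 :=
      Subtype.ext (Ideal.Quotient.eq_zero_iff_mem.2 (Ideal.mem_span_singleton_self F))
    rw [this, map_zero]
  rw [map_mul, h0, mul_zero]

/-- If `F` is weighted homogeneous, then `ℂ[x] / (F)` is a graded algebra. -/
@[reducible]
def coordGradedAlgebra {d : ℕ} (hF : IsWeightedHomogeneous w F d) :
    GradedAlgebra (coordGrading w F) :=
  GradedAlgebra.ofAlgHom (coordGrading w F)
    (Ideal.Quotient.liftₐ (Ideal.span {F}) (decomposeAux w F) (decomposeAux_eq_zero w F hF))
    (by
      apply Ideal.Quotient.algHom_ext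
      apply MvPolynomial.algHom_ext
      intro i
      change DirectSum.coeAlgHom (coordGrading w F) (decomposeAux w F (X i)) = _
      rw [decomposeAux, aeval_X]
      exact DirectSum.coeAlgHom_of _ _ _)
    (by
      rintro k ⟨_, p, hp, rfl⟩
      exact decomposeAux_of_homogeneous w F hp)

/-- The weighted projective hypersurface `{F = 0} ⊂ ℙ(w)`, that is `Proj (ℂ[x] / (F))`. -/
def hypersurface {d : ℕ} (hF : IsWeightedHomogeneous w F d) : Scheme.{0} :=
  letI := coordGradedAlgebra w F hF
  Proj (coordGrading w F)

/-- The structure morphism of `{F = 0} ⊂ ℙ(w)` as a complex scheme. -/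
def hypersurfaceToSpec {d : ℕ} (hF : IsWeightedHomogeneous w F d) :
    hypersurface w F hF ⟶ Spec (CommRingCat.of ℂ) :=
  letI := coordGradedAlgebra w F hF
  Proj.toSpecZero (coordGrading w F) ≫
    Spec.map (CommRingCat.ofHom (algebraMap ℂ (coordGrading w F 0)))

end Graded

section Conditions

/-- `F` is non-degenerate: the affine cone `{F = 0} ⊂ ℂ^σ` is smooth outside the origin. -/
def IsNondegenerate {σ : Type} (F : MvPolynomial σ ℂ) : Prop :=
  ∀ x : σ → ℂ, x ≠ 0 → eval x F = 0 → ∃ i, eval x (pderiv i F) ≠ 0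

variable {σ : Type} [Fintype σ] [DecidableEq σ] (w : σ → ℕ) (F : MvPolynomial σ ℂ)

/-- The weights are normalized: any `|σ| - 1` of them have no common factor. -/
def IsNormalized : Prop :=
  ∀ i, (Finset.univ.erase i).gcd w = 1

/-- `{F = 0} ⊂ ℙ(w)` is well-formed: `w` is normalized and the hypersurface contains no
codimension two stratum `{x_i = x_j = 0}` of `ℙ(w)` along which `ℙ(w)` is singular, i.e. for which
the remaining weights have a nontrivial common factor. -/
def IsWellFormed : Prop :=
  IsNormalized w ∧
    ∀ i j, i ≠ j → 1 < ((Finset.univ.erase i).erase j).gcd w →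
      ∃ x : σ → ℂ, x i = 0 ∧ x j = 0 ∧ eval x F ≠ 0

end Conditions

section FunctionFields

variable (K : Type) [Field K] [Algebra ℂ K]

/-- For a subring `A` of `K`, the image of `⋀^r Ω_A` in the space `⋀^r Ω_K` of rational
`r`-forms: all `A`-linear combinations of the forms `da₁ ∧ ⋯ ∧ da_r` with `a_i ∈ A`. -/
def regularForms (r : ℕ) (A : Subring K) : Submodule A (⋀[K]^r (Ω[K⁄ℂ])) :=
  Submodule.span A
    {η | ∃ a : Fin r → A, η = exteriorPower.ιMulti K r fun i => KaehlerDifferential.D ℂ K (a i)}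

/-- A divisorial valuation ring of `K / ℂ`: a discrete valuation ring with fraction field `K`
that is a localization of a finitely generated `ℂ`-algebra. Equivalently, the local ring of a
normal model of `K` at a prime divisor. -/
structure IsDivisorial {K : Type} [Field K] [Algebra ℂ K] (V : Subalgebra ℂ K) : Prop where
  dvr : IsDiscreteValuationRing V
  fractionField : IsFractionRing V K
  essFiniteType : Algebra.EssFiniteType ℂ V

end FunctionFields

section Varieties

variable {X : Scheme.{0}}

/-- The function field of an integral complex scheme as a `ℂ`-algebra. -/
@[reducible]
def functionFieldAlgebra (s : X ⟶ Spec (CommRingCat.of ℂ)) [IsIntegral X] :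
    Algebra ℂ X.functionField :=
  ((X.presheaf.germ ⊤ (genericPoint X) trivial).hom.comp
    (s.appTop.hom.comp (Scheme.ΓSpecIso (CommRingCat.of ℂ)).inv.hom)).toAlgebra

/-- The dimension of an integral complex scheme of finite type, computed as the transcendence
degree of its function field. -/
def varietyDim (s : X ⟶ Spec (CommRingCat.of ℂ)) [IsIntegral X] : ℕ :=
  letI := functionFieldAlgebra s
  Cardinal.toNat (Algebra.trdeg ℂ X.functionField)

/-- The local ring of `X` at `x`, as a subring of the function field. -/
def localSubring [IsIntegral X] (x : X) : Subring X.functionField :=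
  (algebraMap (X.presheaf.stalk x) X.functionField).range

/-- `X` (normal and proper over `ℂ`) has trivial canonical sheaf and canonical singularities.
There is a rational form `ω` of top degree whose divisor on `X` is zero (`ω` generates the
differential forms at every point of codimension one, so that `ω_X = 𝒪_X ω`), and `ω` is regular
along every divisorial valuation of the function field, i.e. along every prime divisor of every
normal variety birational and proper over `X` (all discrepancies are nonnegative). -/
def HasTrivialCanonicalSheafAndCanonicalSingularities
    (s : X ⟶ Spec (CommRingCat.of ℂ)) [IsIntegral X] : Prop :=
  letI := functionFieldAlgebra s
  ∃ ω : ⋀[X.functionField]^(varietyDim s) (Ω[X.functionField⁄ℂ]), ω ≠ 0 ∧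
    (∀ x : X, ringKrullDim (X.presheaf.stalk x) = 1 →
      Submodule.span (localSubring x) {ω} =
        regularForms X.functionField (varietyDim s) (localSubring x)) ∧
    ∀ V : Subalgebra ℂ X.functionField, IsDivisorial V →
      ω ∈ regularForms X.functionField (varietyDim s) V.toSubring

/-- Čech cochains of degree `p` of the structure sheaf for the family `U`. -/
abbrev CechCochain {k : ℕ} (U : Fin k → X.Opens) (p : ℕ) : Type :=
  ∀ t : Fin (p + 1) → Fin k, Γ(X, ⨅ j, U (t j))

/-- The Čech differential `(dc)(t) = ∑ j, (-1)^j c(t_0, …, t̂_j, …, t_{p+1})`. -/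
def cechDifferential {k : ℕ} (U : Fin k → X.Opens) (p : ℕ) (c : CechCochain U p) :
    CechCochain U (p + 1) := fun t =>
  ∑ j : Fin (p + 2), (-1) ^ (j : ℕ) *
    (X.presheaf.map (homOfLE (le_iInf fun i => iInf_le (fun i => U (t i)) (j.succAbove i) :
      (⨅ i, U (t i)) ≤ ⨅ i, U (t (j.succAbove i)))).op).hom (c fun i => t (j.succAbove i))

/-- `H^i(X, 𝒪_X) = 0` for `0 < i < r`, computed by the Čech complex of a finite affine open
cover (on a separated scheme this does not depend on the cover). -/
def IntermediateCohomologyVanishes (X : Scheme.{0}) (r : ℕ) : Prop :=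
  ∃ (k : ℕ) (U : Fin k → X.Opens), (∀ i, IsAffineOpen (U i)) ∧ ⨆ i, U i = ⊤ ∧
    ∀ p : ℕ, p + 1 < r → ∀ c : CechCochain U (p + 1), cechDifferential U (p + 1) c = 0 →
      ∃ b : CechCochain U p, cechDifferential U p b = c

/-- A Calabi–Yau variety: a proper normal complex variety with canonical singularities,
trivial canonical sheaf, and `H^i(X, 𝒪_X) = 0` for `0 < i < dim X`. -/
structure IsCalabiYau (s : X ⟶ Spec (CommRingCat.of ℂ)) : Prop where
  integral : IsIntegral X
  proper : IsProper s
  normal : ∀ x : X, IsIntegrallyClosed (X.presheaf.stalk x)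
  canonical : HasTrivialCanonicalSheafAndCanonicalSingularities s
  cohomology : IntermediateCohomologyVanishes X (varietyDim s)

end Varieties

section Twist

variable {m n : ℕ}

/-- The polynomial `x_0^ℓ + f(x_1, …, x_m)`. -/
def cyclicPoly (ℓ : ℕ) (f : MvPolynomial (Fin m) ℂ) : MvPolynomial (Fin (m + 1)) ℂ :=
  X 0 ^ ℓ + rename Fin.succ f

/-- The weights `(u_0, u_1, …, u_m)`. -/
def cyclicWeights (u₀ : ℕ) (u : Fin m → ℕ) : Fin (m + 1) → ℕ :=
  Fin.cons u₀ u

/-- The polynomial `f(x_1, …, x_m) - g(y_1, …, y_n)`. -/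
def twistPoly (f : MvPolynomial (Fin m) ℂ) (g : MvPolynomial (Fin n) ℂ) :
    MvPolynomial (Fin m ⊕ Fin n) ℂ :=
  rename Sum.inl f - rename Sum.inr g

/-- The weights `(v_0 u_1, …, v_0 u_m, u_0 v_1, …, u_0 v_n)`. -/
def twistWeights (u₀ v₀ : ℕ) (u : Fin m → ℕ) (v : Fin n → ℕ) : Fin m ⊕ Fin n → ℕ :=
  Sum.elim (fun i => v₀ * u i) (fun j => u₀ * v j)

theorem rename_isWeightedHomogeneous {σ τ : Type} (e : σ → τ) {w : σ → ℕ} {w' : τ → ℕ} (c : ℕ)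
    (hw : ∀ i, w' (e i) = c * w i) {p : MvPolynomial σ ℂ} {d : ℕ}
    (hp : IsWeightedHomogeneous w p d) : IsWeightedHomogeneous w' (rename e p) (c * d) := by
  have key : ∀ a : σ →₀ ℕ, Finsupp.weight w' (a.mapDomain e) = c * Finsupp.weight w a := by
    intro a
    induction a using Finsupp.induction_linear with
    | zero => simp
    | add a b ha hb => rw [Finsupp.mapDomain_add, map_add, map_add, ha, hb, mul_add]
    | single i n =>
      rw [Finsupp.mapDomain_single, Finsupp.weight_single, Finsupp.weight_single, hw]
      simp only [smul_eq_mul]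
      ring
  intro b hb
  obtain ⟨a, rfl, ha⟩ := coeff_rename_ne_zero e p b hb
  rw [key, hp ha]

theorem cyclicPoly_isWeightedHomogeneous {ℓ u₀ : ℕ} {u : Fin m → ℕ} {f : MvPolynomial (Fin m) ℂ}
    (hf : IsWeightedHomogeneous u f (ℓ * u₀)) :
    IsWeightedHomogeneous (cyclicWeights u₀ u) (cyclicPoly ℓ f) (ℓ * u₀) := by
  refine IsWeightedHomogeneous.add ?_ ?_
  · exact (isWeightedHomogeneous_X ℂ (cyclicWeights u₀ u) 0).pow ℓ
  · have h := rename_isWeightedHomogeneous Fin.succ (w' := cyclicWeights u₀ u) 1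
      (fun i => by simp [cyclicWeights]) hf
    rwa [one_mul] at h

theorem twistPoly_isWeightedHomogeneous {ℓ u₀ v₀ : ℕ} {u : Fin m → ℕ} {v : Fin n → ℕ}
    {f : MvPolynomial (Fin m) ℂ} {g : MvPolynomial (Fin n) ℂ}
    (hf : IsWeightedHomogeneous u f (ℓ * u₀)) (hg : IsWeightedHomogeneous v g (ℓ * v₀)) :
    IsWeightedHomogeneous (twistWeights u₀ v₀ u v) (twistPoly f g) (u₀ * v₀ * ℓ) := by
  have h1 := rename_isWeightedHomogeneous Sum.inl (w' := twistWeights u₀ v₀ u v) v₀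
    (fun i => rfl) hf
  have h2 := rename_isWeightedHomogeneous Sum.inr (w' := twistWeights u₀ v₀ u v) u₀
    (fun i => rfl) hg
  rw [show v₀ * (ℓ * u₀) = u₀ * v₀ * ℓ by ring] at h1
  rw [show u₀ * (ℓ * v₀) = u₀ * v₀ * ℓ by ring] at h2
  exact (weightedHomogeneousSubmodule ℂ (twistWeights u₀ v₀ u v) (u₀ * v₀ * ℓ)).sub_mem h1 h2

end Twist

end WeightedCY

end

/-! The theorem reduces to one criterion: a well-formed quasi-smooth hypersurface of degree $d$ in
$\mathbb P(w)$, in at least three variables, is Calabi–Yau if and only if $d=\sum_k w_k$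
(`isCalabiYau_hypersurfaceToSpec_iff`). Applied to $X_1$ and $X_2$ it gives $\ell u_0=u_0+\sum u_i$
and $\ell v_0=v_0+\sum v_j$. The weights of $X$ then add up to $v_0\sum u_i+u_0\sum
v_j=2(\ell-1)u_0v_0$, while its degree is $\ell u_0v_0$; these agree exactly when $\ell=2$. The
criterion applies to $X$ because non-degeneracy of $x_0^\ell+f$ and $y_0^\ell+g$ makes the origin
the only critical point of $f$ and of $g$, and because $\gcd(u_0,v_0)=1$ and $m+n\ge5$ make $X$
well-formed (`isWellFormedCone_twistPoly`).

The canonical sheaf is handled through the Poincaré residue form $\omega$, written as a determinant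
in coordinates of the cone. Rescaling the coordinates by $x_k\mapsto\tau^{w_k}x_k$ multiplies
$\omega$ by $\tau^{\sum w-d}$ (`IsResidueForm.rescale`). At a point of codimension one,
well-formedness provides a function of degree one that is invertible there, and in the resulting
coordinates $\omega$ generates the differential forms.

If some form $h\omega$ generates in codimension one and $E=d-\sum w\ne0$, then $h$ yields a function
$\eta$ of degree $E$ on the cone without zeros or poles in codimension one. The degree-zero
quotients of $x_k^{|E|}$ by powers of $\eta$ are regular in codimension one, hence constant by
normality and properness. So the cone satisfies a binomial equation in every pair of variables,
impossible with three variables (`IsConeModel.degree_eq_sum`).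

If $d=\sum w$, the form $\omega$ has no zeros or poles in codimension one, and it remains to see
that it is regular along each discrete valuation ring $V$ of the function field. The weighted orders
of the coordinates and of the partial derivatives show that $\prod_{l\ne j}x_l/\partial_jF$ lies in
$V$ for a suitable $j$. If it is not a unit, it cancels the simple pole of the logarithmic forms in
the expansion of $\omega$; if it is a unit, the coordinates can be rescaled into $V$ with
$\partial_jF$ a unit (`IsCoord.residueForm_mem_regularForms`). Normality comes from the Jacobian
criterion, and the cohomology vanishes by a contracting homotopy on Laurent monomials. -/

open CategoryTheory AlgebraicGeometry MvPolynomial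

noncomputable section

namespace WeightedCY


/-! ### Coordinate ideals, their heights, and common zeros of two polynomials. -/

section CoordinateIdeals

variable {σ : Type}

-- Killing the variables in `s` is the identity modulo the ideal they generate, so whatever is
-- killed lies in that ideal. As the target is a domain, these ideals are prime.
open Classical in
theorem ker_killVariables (s : Set σ) :
    RingHom.ker (aeval fun k => if k ∈ s then (0 : MvPolynomial σ ℂ) else X k :
      MvPolynomial σ ℂ →ₐ[ℂ] MvPolynomial σ ℂ) = Ideal.span (X '' s) := by
  set φ : MvPolynomial σ ℂ →ₐ[ℂ] MvPolynomial σ ℂ :=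
    aeval fun k => if k ∈ s then (0 : MvPolynomial σ ℂ) else X k with hφ
  apply le_antisymm
  · intro p hp
    have h : (Ideal.Quotient.mkₐ ℂ (Ideal.span (X '' s))).comp φ =
        Ideal.Quotient.mkₐ ℂ (Ideal.span (X '' s : Set (MvPolynomial σ ℂ))) := by
      apply MvPolynomial.algHom_ext
      intro k
      simp only [hφ, AlgHom.comp_apply, aeval_X]
      split_ifs with hk
      · rw [map_zero, eq_comm]
        exact Ideal.Quotient.eq_zero_iff_mem.2 (Ideal.subset_span ⟨k, hk, rfl⟩)
      · rfl
    have h2 := DFunLike.congr_fun h p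
    rw [AlgHom.comp_apply, (RingHom.mem_ker).1 hp, map_zero, eq_comm] at h2
    exact Ideal.Quotient.eq_zero_iff_mem.1 h2
  · rw [Ideal.span_le]
    rintro _ ⟨k, hk, rfl⟩
    simp [hφ, hk]

theorem isPrime_span_X_image (s : Set σ) :
    (Ideal.span (X '' s : Set (MvPolynomial σ ℂ))).IsPrime := by
  rw [← ker_killVariables]
  exact RingHom.ker_isPrime _

theorem X_mem_span_X_image {s : Set σ} {k : σ} :
    (X k : MvPolynomial σ ℂ) ∈ Ideal.span (X '' s) ↔ k ∈ s := by
  classical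
  rw [mem_ideal_span_X_image]
  simp [support_X, Finsupp.single_apply]

/-- A prime ideal strictly containing `(x_i, x_j)` has height at least three. -/
theorem three_le_height {i j : σ} (hij : i ≠ j) (P : Ideal (MvPolynomial σ ℂ)) [P.IsPrime]
    (h : Ideal.span {X i, X j} < P) : 3 ≤ P.height := by
  have e1 : (X '' {i} : Set (MvPolynomial σ ℂ)) = {X i} := by simp
  have e2 : (X '' {i, j} : Set (MvPolynomial σ ℂ)) = {X i, X j} := by
    rw [Set.image_insert_eq, Set.image_singleton]
  have p1 := isPrime_span_X_image ({i} : Set σ)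
  have p2 := isPrime_span_X_image ({i, j} : Set σ)
  have h1 : (⊥ : Ideal (MvPolynomial σ ℂ)) < Ideal.span (X '' {i}) := by
    rw [bot_lt_iff_ne_bot, e1, Ne, Ideal.span_singleton_eq_bot]
    exact X_ne_zero i
  have h2 : Ideal.span (X '' {i} : Set (MvPolynomial σ ℂ)) < Ideal.span (X '' {i, j}) := by
    refine lt_of_le_of_ne (Ideal.span_mono (Set.image_mono (by simp))) fun h => ?_
    have : (X j : MvPolynomial σ ℂ) ∈ Ideal.span (X '' {i}) :=
      h ▸ X_mem_span_X_image.2 (by simp)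
    exact hij (by simpa using (X_mem_span_X_image.1 this).symm)
  have h3 : Ideal.span (X '' {i, j} : Set (MvPolynomial σ ℂ)) < P := by rwa [e2]
  have a1 := Ideal.height_add_one_le_of_lt_of_isPrime h1
  have a2 := Ideal.height_add_one_le_of_lt_of_isPrime h2
  have a3 := Ideal.height_add_one_le_of_lt_of_isPrime h3
  calc (3 : ℕ∞) = 0 + 1 + 1 + 1 := by norm_num
    _ ≤ (⊥ : Ideal (MvPolynomial σ ℂ)).height + 1 + 1 + 1 := by gcongr; exact zero_le
    _ ≤ P.height := by
      refine le_trans ?_ a3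
      gcongr
      refine le_trans ?_ a2
      gcongr

/-- Two polynomials without constant term in at least three variables have a nontrivial common
zero. -/
theorem exists_common_zero [Finite σ] {i j k : σ} (hij : i ≠ j) (hik : i ≠ k) (hjk : j ≠ k)
    {p q : MvPolynomial σ ℂ} (hp : eval 0 p = 0) (hq : eval 0 q = 0) :
    ∃ x : σ → ℂ, x ≠ 0 ∧ eval x p = 0 ∧ eval x q = 0 := by
  by_contra! hcon
  set m : Ideal (MvPolynomial σ ℂ) := vanishingIdeal ℂ {(0 : σ → ℂ)} with hm
  have hzl : zeroLocus ℂ (Ideal.span {p, q}) = {(0 : σ → ℂ)} := by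
    rw [zeroLocus_span]
    ext x
    simp only [Set.mem_insert_iff, Set.mem_singleton_iff, forall_eq_or_imp, forall_eq,
      Set.mem_ofPred_eq, MvPolynomial.aeval_eq_eval]
    constructor
    · rintro ⟨h1, h2⟩
      by_contra hx
      exact hcon x hx h1 h2
    · rintro rfl
      exact ⟨hp, hq⟩
  have hrad : (Ideal.span {p, q}).radical = m := by
    rw [← vanishingIdeal_zeroLocus_eq_radical (K := ℂ), hzl]
  have hmax : m.IsMaximal := (isMaximal_iff_eq_vanishingIdeal_singleton (K := ℂ)).2 ⟨0, rfl⟩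
  have hmem : ∀ l : σ, (X l : MvPolynomial σ ℂ) ∈ m := by
    intro l
    rw [hm, mem_vanishingIdeal_singleton_iff]
    simp
  have hmin : m ∈ (Ideal.span {p, q}).minimalPrimes := by
    refine ⟨⟨hmax.isPrime, hrad ▸ Ideal.le_radical⟩, ?_⟩
    rintro J ⟨hJ, hle⟩ -
    rw [← hrad]
    exact hJ.radical_le_iff.2 hle
  -- If the origin were the only common zero, its maximal ideal would be minimal over two elements,
  -- so of height at most two by Krull, while three variables force height at least three.
  have h2 := Ideal.height_le_card_of_mem_minimalPrimes_span (Set.toFinite _) hmin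
  have h3 : 3 ≤ m.height := by
    refine three_le_height hij m (lt_of_le_of_ne ?_ ?_)
    · rw [Ideal.span_le]
      rintro _ (rfl | rfl) <;> exact hmem _
    · intro h
      have := hmem k
      rw [← h, ← Set.image_pair, X_mem_span_X_image] at this
      rcases this with h | h
      · exact hik h.symm
      · exact hjk h.symm
  have h4 : (({p, q} : Set (MvPolynomial σ ℂ)).ncard : ℕ∞) ≤ 2 := by
    exact_mod_cast Set.ncard_insert_le p {q} |>.trans (by simp)
  exact absurd (h3.trans (h2.trans h4)) (by norm_num)

end CoordinateIdeals

/-! ### Weighted homogeneous polynomials: factors, primality, and the Jacobian ideal. -/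

section Homogeneous

variable {σ : Type} {w : σ → ℕ} {F : MvPolynomial σ ℂ} {d : ℕ}

attribute [local instance] MvPolynomial.weightedGradedAlgebra

/-- An irreducible factor of a weighted homogeneous polynomial has no constant term. -/
theorem eval_zero_of_prime_dvd (hw : ∀ i, 0 < w i) (hF : IsWeightedHomogeneous w F d)
    (hF0 : F ≠ 0) {q : MvPolynomial σ ℂ} (hq : Prime q) (hqF : q ∣ F) : eval 0 q = 0 := by
  set I : Ideal (MvPolynomial σ ℂ) := Ideal.span {q} with hI
  have hIp : I.IsPrime := (Ideal.span_singleton_prime hq.ne_zero).2 hq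
  set J := (I.homogeneousCore (weightedHomogeneousSubmodule ℂ w)).toIdeal with hJ
  have hJp : J.IsPrime := hIp.homogeneousCore
  have hFJ : F ∈ J := Ideal.mem_homogeneousCore_of_homogeneous_of_mem
    ⟨d, (mem_weightedHomogeneousSubmodule ℂ w d F).2 hF⟩ (Ideal.mem_span_singleton.2 hqF)
  have hJI : J ≤ I := Ideal.toIdeal_homogeneousCore_le _ I
  -- The homogeneous core of $(q)$ is a nonzero prime, so it contains a prime element; being
  -- divisible by $q$, this element is associated to $q$. Hence $q$ itself lies in the core.
  obtain ⟨p, hpJ, hp⟩ := hJp.exists_mem_prime_of_ne_bot (fun h => hF0 (by simpa [h] using hFJ))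
  have hqp : q ∣ p := Ideal.mem_span_singleton.1 (hJI hpJ)
  have hqJ : q ∈ J := by
    obtain ⟨u, hu⟩ := (hq.associated_of_dvd hp hqp).symm
    rw [← hu]
    exact J.mul_mem_right _ hpJ
  -- All weights being positive, the component of degree zero is the constant term; a nonzero
  -- constant cannot lie in a prime ideal.
  have hc := weightedHomogeneousComponent_mem_of_mem ℂ w
    (Ideal.homogeneousCore (weightedHomogeneousSubmodule ℂ w) I).isHomogeneous hqJ 0
  rw [weightedHomogeneousComponent_zero q fun i => (hw i).ne'] at hc
  have h0 : coeff 0 q = 0 := by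
    by_contra hne
    exact hJp.ne_top (Ideal.eq_top_of_isUnit_mem _ hc
      ((isUnit_iff_ne_zero.2 hne).map C))
  rwa [← constantCoeff_eq, ← eval_zero] at h0

/-- A non-degenerate weighted homogeneous polynomial in at least three variables is prime. -/
theorem prime_of_isNondegenerate [Finite σ] (hw : ∀ i, 0 < w i)
    (hF : IsWeightedHomogeneous w F d) (hF0 : F ≠ 0) (hu : ¬ IsUnit F) (hnd : IsNondegenerate F)
    {i j k : σ} (hij : i ≠ j) (hik : i ≠ k) (hjk : j ≠ k) : Prime F := by
  obtain ⟨q, hq, B, rfl⟩ := WfDvdMonoid.exists_irreducible_factor hu hF0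
  by_cases hB : IsUnit B
  · exact ((associated_mul_unit_left q B hB).prime_iff).2 hq.prime
  exfalso
  obtain ⟨q', hq', B', rfl⟩ := WfDvdMonoid.exists_irreducible_factor hB (right_ne_zero_of_mul hF0)
  -- At a common zero of two factors every partial derivative of the product vanishes, by Leibniz.
  obtain ⟨x, hx, h1, h2⟩ := exists_common_zero hij hik hjk
    (eval_zero_of_prime_dvd hw hF hF0 hq.prime (Dvd.intro _ rfl))
    (eval_zero_of_prime_dvd hw hF hF0 hq'.prime ⟨q * B', by ring⟩)
  obtain ⟨l, hl⟩ := hnd x hx (by simp [h1])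
  apply hl
  simp [Derivation.leibniz, h1, h2]

/-- Euler: on the locus where all partial derivatives vanish, `F` vanishes. -/
theorem eval_eq_zero_of_pderiv [Fintype σ] (hF : IsWeightedHomogeneous w F d) (hd : 0 < d)
    (x : σ → ℂ) (hx : ∀ i, eval x (pderiv i F) = 0) : eval x F = 0 := by
  have h := congrArg (eval x) hF.sum_weight_X_mul_pderiv
  simp only [map_sum, map_mul, hx, mul_zero, Finset.sum_const_zero,
    nsmul_eq_mul] at h
  rcases mul_eq_zero.1 h.symm with h | h
  · exact absurd (by simpa using h) hd.ne'
  · exact h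

/-- The partial derivatives of a non-degenerate polynomial generate an ideal which is primary to
the irrelevant ideal. -/
theorem exists_pow_mem_span_pderiv [Fintype σ] (hF : IsWeightedHomogeneous w F d) (hd : 0 < d)
    (hnd : IsNondegenerate F) (k : σ) :
    ∃ M : ℕ, (X k : MvPolynomial σ ℂ) ^ M ∈ Ideal.span (Set.range fun i => pderiv i F) := by
  change X k ∈ (Ideal.span (Set.range fun i => pderiv i F)).radical
  rw [← vanishingIdeal_zeroLocus_eq_radical (K := ℂ), mem_vanishingIdeal_iff]
  intro x hx
  rw [zeroLocus_span] at hx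
  have hx' : ∀ i, eval x (pderiv i F) = 0 := fun i => by
    simpa [MvPolynomial.aeval_eq_eval] using hx _ ⟨i, rfl⟩
  by_cases h0 : x = 0
  · simp [h0]
  · obtain ⟨i, hi⟩ := hnd x h0 (eval_eq_zero_of_pderiv hF hd x hx')
    exact absurd (hx' i) hi

/-- A monomial that survives $\partial_i$ contains $x_i$, so its weight is at least $w_i$. This
makes the truncated subtraction `d - w i` a true degree of the derivative. -/
theorem isWeightedHomogeneous_pderiv_ne_zero (hF : IsWeightedHomogeneous w F d) {i : σ}
    (h : pderiv i F ≠ 0) : w i ≤ d := by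
  classical
  by_contra hlt
  apply h
  rw [F.as_sum, map_sum]
  refine Finset.sum_eq_zero fun a ha => ?_
  rw [pderiv_monomial]
  have h0 : a i = 0 := by
    by_contra hne
    have h1 := hF (mem_support_iff.1 ha)
    rw [Finsupp.weight_apply, Finsupp.sum] at h1
    have h2 : a i • w i ≤ ∑ l ∈ a.support, a l • w l :=
      Finset.single_le_sum (f := fun l => a l • w l) (fun _ _ => Nat.zero_le _)
        (Finsupp.mem_support_iff.2 hne)
    have h3 : 1 * w i ≤ a i * w i := Nat.mul_le_mul_right _ (Nat.one_le_iff_ne_zero.2 hne)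
    simp only [smul_eq_mul] at h1 h2
    omega
  simp [h0]

/-- Multiplication by a homogeneous `G` shifts degrees, so only the component of `A` in degree $n-e$
contributes. It turns identities $\sum A_jG_j=\cdots$ into identities with homogeneous coefficients;
`A' = 0` covers $n<e$. -/
theorem weightedHomogeneousComponent_mul_of_isWeightedHomogeneous {A G : MvPolynomial σ ℂ} {e : ℕ}
    (hG : IsWeightedHomogeneous w G e) (n : ℕ) :
    ∃ A', weightedHomogeneousComponent w n (A * G) = A' * G ∧
      (A' = 0 ∨ ∃ m, m + e = n ∧ IsWeightedHomogeneous w A' m) := by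
  classical
  have key : weightedHomogeneousComponent w n (A * G) =
      ∑ m ∈ (weightedHomogeneousComponent_finsupp (w := w) A).toFinset,
        weightedHomogeneousComponent w n (weightedHomogeneousComponent w m A * G) := by
    conv_lhs => rw [← sum_weightedHomogeneousComponent w A,
      finsum_eq_sum _ (weightedHomogeneousComponent_finsupp A), Finset.sum_mul, map_sum]
  have hh : ∀ m, IsWeightedHomogeneous w (weightedHomogeneousComponent w m A * G) (m + e) :=
    fun m => (weightedHomogeneousComponent_isWeightedHomogeneous m A).mul hG
  by_cases hn : e ≤ n
  · refine ⟨weightedHomogeneousComponent w (n - e) A, ?_, .inr ⟨n - e, by omega,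
      weightedHomogeneousComponent_isWeightedHomogeneous _ A⟩⟩
    have hne : ∀ m, m ≠ n - e →
        weightedHomogeneousComponent w n (weightedHomogeneousComponent w m A * G) = 0 := by
      intro m hm
      exact (hh m).weightedHomogeneousComponent_ne n (by omega)
    have hsame : weightedHomogeneousComponent w n
        (weightedHomogeneousComponent w (n - e) A * G) =
        weightedHomogeneousComponent w (n - e) A * G := by
      have := (hh (n - e)).weightedHomogeneousComponent_same
      rwa [show n - e + e = n by omega] at this
    rw [key, Finset.sum_eq_single (n - e) (fun m _ hm => hne m hm), hsame]
    intro hm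
    have h0 : weightedHomogeneousComponent w (n - e) A = 0 := by
      by_contra h
      exact hm ((Set.Finite.mem_toFinset _).2 h)
    rw [h0, zero_mul, map_zero]
  · refine ⟨0, ?_, .inl rfl⟩
    rw [zero_mul, key]
    exact Finset.sum_eq_zero fun m _ => (hh m).weightedHomogeneousComponent_ne n (by omega)

end Homogeneous


/-! ### Stalks, function field and sections of `Proj` of a domain inside the fraction field. -/

section ProjDomain

open ProjectiveSpectrum HomogeneousLocalization

variable {A : Type} [CommRing A] [Algebra ℂ A] (𝒜 : ℕ → Submodule ℂ A) [GradedAlgebra 𝒜]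

instance isPrime_asHomogeneousIdeal (x : Proj 𝒜) : x.asHomogeneousIdeal.toIdeal.IsPrime :=
  ProjectiveSpectrum.isPrime x

/-- The degree zero part of the localization of a domain at a prime maps to the fraction field. -/
def atPrimeToFrac [IsDomain A] (p : Ideal A) [p.IsPrime] :
    HomogeneousLocalization.AtPrime 𝒜 p →+* FractionRing A :=
  (IsLocalization.map (FractionRing A) (RingHom.id A)
    (show p.primeCompl ≤ (nonZeroDivisors A).comap (RingHom.id A) from
      fun _ ha => mem_nonZeroDivisors_of_ne_zero fun h => ha (h ▸ p.zero_mem)) :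
    Localization p.primeCompl →+* FractionRing A).comp
    (algebraMap (HomogeneousLocalization.AtPrime 𝒜 p) (Localization p.primeCompl))

theorem awayToSection_bijective {m : ℕ} (hm : 0 < m) {f : A} (hf : f ∈ 𝒜 m) :
    Function.Bijective (AlgebraicGeometry.Proj.awayToSection 𝒜 f).hom := by
  rw [← Proj.basicOpenIsoAway_hom 𝒜 f hf hm]
  exact ConcreteCategory.bijective_of_isIso (Proj.basicOpenIsoAway 𝒜 f hf hm).hom

variable [IsDomain A]

theorem atPrimeToFrac_mk (p : Ideal A) [p.IsPrime] (z : NumDenSameDeg 𝒜 p.primeCompl) :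
    atPrimeToFrac 𝒜 p (.mk z) = algebraMap A (FractionRing A) z.num /
      algebraMap A (FractionRing A) z.den := by
  rw [atPrimeToFrac, RingHom.comp_apply, HomogeneousLocalization.algebraMap_apply, val_mk,
    Localization.mk_eq_mk', IsLocalization.map_mk', IsFractionRing.mk'_eq_div]
  rfl

theorem atPrimeToFrac_injective (p : Ideal A) [p.IsPrime] :
    Function.Injective (atPrimeToFrac 𝒜 p) := by
  rw [injective_iff_map_eq_zero]
  intro z hz
  obtain ⟨z, rfl⟩ := mk_surjective z
  rw [atPrimeToFrac_mk, div_eq_zero_iff] at hz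
  have hn : (z.num : A) = 0 := by
    rcases hz with h | h
    · exact (FaithfulSMul.algebraMap_eq_zero_iff A (FractionRing A)).1 h
    · exact absurd ((FaithfulSMul.algebraMap_eq_zero_iff A (FractionRing A)).1 h)
        fun h => z.den_mem (h ▸ p.zero_mem)
  apply HomogeneousLocalization.val_injective
  rw [val_mk, hn, Localization.mk_zero, val_zero]

/-- The stalk of `Proj` of a domain inside the fraction field of the domain. -/
def stalkToFrac (x : Proj 𝒜) : (Proj 𝒜).presheaf.stalk x →+* FractionRing A :=
  (atPrimeToFrac 𝒜 x.asHomogeneousIdeal.toIdeal).comp (Proj.stalkIso' 𝒜 x).toRingHom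

theorem stalkToFrac_injective (x : Proj 𝒜) : Function.Injective (stalkToFrac 𝒜 x) :=
  (atPrimeToFrac_injective 𝒜 _).comp (Proj.stalkIso' 𝒜 x).injective

theorem stalkToFrac_germ {U : (Proj 𝒜).Opens} (x : Proj 𝒜) (hx : x ∈ U) (s : Γ(Proj 𝒜, U)) :
    stalkToFrac 𝒜 x ((Proj 𝒜).presheaf.germ U x hx s) =
      atPrimeToFrac 𝒜 x.asHomogeneousIdeal.toIdeal (s.1 ⟨x, hx⟩) :=
  congrArg (atPrimeToFrac 𝒜 x.asHomogeneousIdeal.toIdeal) (Proj.stalkIso'_germ 𝒜 U x hx s)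

/-- The rational function defined by a germ does not change under specialization. -/
theorem stalkToFrac_stalkSpecializes {x y : Proj 𝒜} (h : y ⤳ x)
    (z : (Proj 𝒜).presheaf.stalk x) :
    stalkToFrac 𝒜 y ((Proj 𝒜).presheaf.stalkSpecializes h z) = stalkToFrac 𝒜 x z := by
  obtain ⟨U, hxU, s, rfl⟩ := (Proj 𝒜).presheaf.exists_germ_eq z
  obtain ⟨V, hxV, i, n, a, b, hb, hs⟩ := s.2 ⟨x, hxU⟩
  have hyV : y ∈ V := h.mem_open V.2 hxV
  have h1 := (Proj 𝒜).presheaf.germ_stalkSpecializes hxU h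
  have h2 := ConcreteCategory.congr_hom h1 s
  rw [ConcreteCategory.comp_apply] at h2
  rw [h2, stalkToFrac_germ, stalkToFrac_germ]
  have e1 : s.1 ⟨x, hxU⟩ = .mk ⟨n, a, b, hb ⟨x, hxV⟩⟩ := hs ⟨x, hxV⟩
  have e2 : s.1 ⟨y, i.le hyV⟩ = .mk ⟨n, a, b, hb ⟨y, hyV⟩⟩ := hs ⟨y, hyV⟩
  rw [e1]
  refine (congrArg _ e2).trans ?_
  exact (atPrimeToFrac_mk 𝒜 y.asHomogeneousIdeal.toIdeal ⟨n, a, b, hb ⟨y, hyV⟩⟩).trans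
    (atPrimeToFrac_mk 𝒜 x.asHomogeneousIdeal.toIdeal ⟨n, a, b, hb ⟨x, hxV⟩⟩).symm

theorem stalkToFrac_range (x : Proj 𝒜) (z : FractionRing A) :
    z ∈ (stalkToFrac 𝒜 x).range ↔ ∃ (n : ℕ) (a b : A), a ∈ 𝒜 n ∧ b ∈ 𝒜 n ∧
      b ∉ x.asHomogeneousIdeal ∧ z = algebraMap A _ a / algebraMap A _ b := by
  constructor
  · rintro ⟨y, rfl⟩
    obtain ⟨t, ht⟩ := mk_surjective (Proj.stalkIso' 𝒜 x y)
    refine ⟨t.deg, t.num, t.den, t.num.2, t.den.2, t.den_mem, ?_⟩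
    change atPrimeToFrac 𝒜 _ (Proj.stalkIso' 𝒜 x y) = _
    rw [← ht, atPrimeToFrac_mk]
  · rintro ⟨n, a, b, ha, hb, hbx, rfl⟩
    refine ⟨(Proj.stalkIso' 𝒜 x).symm (.mk ⟨n, ⟨a, ha⟩, ⟨b, hb⟩, hbx⟩), ?_⟩
    refine (congrArg (atPrimeToFrac 𝒜 _) (RingEquiv.apply_symm_apply _ _)).trans ?_
    rw [atPrimeToFrac_mk]

/-- The point of `Proj` given by the zero ideal of a domain. -/
def projGenericPoint (h : ∃ n > 0, ∃ a ∈ 𝒜 n, a ≠ 0) : Proj 𝒜 where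
  asHomogeneousIdeal := ⊥
  isPrime := Ideal.isPrime_bot
  not_irrelevant_le := by
    obtain ⟨n, hn, a, ha, ha0⟩ := h
    intro hle
    have : a ∈ (⊥ : HomogeneousIdeal 𝒜) := hle (by
      rw [HomogeneousIdeal.mem_irrelevant_iff, GradedRing.proj_apply,
        DirectSum.decompose_of_mem_ne 𝒜 ha hn.ne'])
    rw [← HomogeneousIdeal.mem_iff, HomogeneousIdeal.toIdeal_bot, Ideal.mem_bot] at this
    exact ha0 this

/-- The zero ideal is a point with dense closure, and the stalks are reduced because they embed in a
field. -/
theorem isIntegral_proj (h : ∃ n > 0, ∃ a ∈ 𝒜 n, a ≠ 0) : IsIntegral (Proj 𝒜) := by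
  have hirr : IrreducibleSpace (Proj 𝒜) := by
    have : (closure {projGenericPoint 𝒜 h} : Set (Proj 𝒜)) = Set.univ := by
      refine Set.eq_univ_of_forall fun x => ?_
      refine (ProjectiveSpectrum.le_iff_mem_closure 𝒜 (projGenericPoint 𝒜 h) x).1 ?_
      refine (ProjectiveSpectrum.as_ideal_le_as_ideal _ _ _).1 ?_
      exact bot_le (α := HomogeneousIdeal 𝒜)
    have hI : IsIrreducible (Set.univ : Set (Proj 𝒜)) := this ▸ isIrreducible_singleton.closure
    exact (irreducibleSpace_def _).2 hI
  have hred : ∀ x : Proj 𝒜, _root_.IsReduced ((Proj 𝒜).presheaf.stalk x) := fun x =>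
    isReduced_of_injective (stalkToFrac 𝒜 x) (stalkToFrac_injective 𝒜 x)
  have : IsReduced (Proj 𝒜) := isReduced_of_isReduced_stalk _
  exact isIntegral_of_irreducibleSpace_of_isReduced _

theorem stalkToFrac_germ_awayToSection {f : A} (x : Proj 𝒜)
    (hx : x ∈ AlgebraicGeometry.Proj.basicOpen 𝒜 f)
    (z : NumDenSameDeg 𝒜 (Submonoid.powers f)) :
    stalkToFrac 𝒜 x ((Proj 𝒜).presheaf.germ (AlgebraicGeometry.Proj.basicOpen 𝒜 f) x hx
      ((AlgebraicGeometry.Proj.awayToSection 𝒜 f).hom (HomogeneousLocalization.mk z))) =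
      algebraMap A (FractionRing A) z.num / algebraMap A (FractionRing A) z.den := by
  have hd : (z.den : A) ∈ x.asHomogeneousIdeal.toIdeal.primeCompl := by
    obtain ⟨n, hn⟩ := z.den_mem
    simp only at hn
    rw [← hn]
    exact fun h => hx (Ideal.IsPrime.mem_of_pow_mem inferInstance n h)
  rw [stalkToFrac_germ]
  exact atPrimeToFrac_mk 𝒜 x.asHomogeneousIdeal.toIdeal ⟨z.deg, z.num, z.den, hd⟩

variable [IsIntegral (Proj 𝒜)]

/-- The function field of `Proj` inside the fraction field. -/
def functionFieldToFrac : (Proj 𝒜).functionField →+* FractionRing A :=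
  stalkToFrac 𝒜 (genericPoint (Proj 𝒜))

theorem functionFieldToFrac_algebraMap (x : Proj 𝒜) (z : (Proj 𝒜).presheaf.stalk x) :
    functionFieldToFrac 𝒜 (algebraMap _ (Proj 𝒜).functionField z) = stalkToFrac 𝒜 x z :=
  stalkToFrac_stalkSpecializes 𝒜 _ z

theorem mem_localSubring_iff (x : Proj 𝒜) (z : (Proj 𝒜).functionField) :
    z ∈ localSubring x ↔ ∃ (n : ℕ) (a b : A), a ∈ 𝒜 n ∧ b ∈ 𝒜 n ∧
      b ∉ x.asHomogeneousIdeal ∧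
      functionFieldToFrac 𝒜 z = algebraMap A _ a / algebraMap A _ b := by
  rw [← stalkToFrac_range]
  constructor
  · rintro ⟨y, rfl⟩
    exact ⟨y, (functionFieldToFrac_algebraMap 𝒜 x y).symm⟩
  · rintro ⟨y, hy⟩
    refine ⟨y, (functionFieldToFrac 𝒜).injective ?_⟩
    rw [functionFieldToFrac_algebraMap, hy]

theorem functionFieldToFrac_range (h : ∃ n > 0, ∃ a ∈ 𝒜 n, a ≠ 0) (z : FractionRing A) :
    z ∈ (functionFieldToFrac 𝒜).range ↔ ∃ (n : ℕ) (a b : A), a ∈ 𝒜 n ∧ b ∈ 𝒜 n ∧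
      b ≠ 0 ∧ z = algebraMap A _ a / algebraMap A _ b := by
  constructor
  · intro hz
    obtain ⟨n, a, b, ha, hb, hbx, h⟩ := (stalkToFrac_range 𝒜 _ z).1 hz
    exact ⟨n, a, b, ha, hb, fun h0 => hbx (h0 ▸ Submodule.zero_mem _), h⟩
  · rintro ⟨n, a, b, ha, hb, hb0, rfl⟩
    obtain ⟨y, hy⟩ := (stalkToFrac_range 𝒜 (projGenericPoint 𝒜 h) _).2
      ⟨n, a, b, ha, hb, fun h => hb0 ((Ideal.mem_bot (R := A)).1 h), rfl⟩
    exact ⟨algebraMap _ _ y, by rw [functionFieldToFrac_algebraMap, hy]⟩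

/-- Sections over a nonempty basic open set, as elements of the fraction field. -/
theorem sections_basicOpen_iff {m : ℕ} (hm : 0 < m) {f : A} (hf : f ∈ 𝒜 m) {U : (Proj 𝒜).Opens}
    (hU : U = Proj.basicOpen 𝒜 f) (hη : genericPoint (Proj 𝒜) ∈ U) (z : FractionRing A) :
    (∃ s : Γ(Proj 𝒜, U), functionFieldToFrac 𝒜 ((Proj 𝒜).presheaf.germ U _ hη s) = z) ↔
      ∃ (n : ℕ) (a : A), a ∈ 𝒜 (n * m) ∧ z = algebraMap A _ a / algebraMap A _ (f ^ n) := by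
  subst hU
  constructor
  · rintro ⟨s, rfl⟩
    obtain ⟨y, rfl⟩ := (awayToSection_bijective 𝒜 hm hf).2 s
    obtain ⟨z, rfl⟩ := mk_surjective y
    have hz := stalkToFrac_germ_awayToSection 𝒜 (genericPoint (Proj 𝒜)) hη z
    obtain ⟨n, hn⟩ := z.den_mem
    simp only at hn
    have hf0 : f ≠ 0 := fun h => hη (h ▸ Submodule.zero_mem _)
    have hin : z.deg = n * m := by
      have h1 : f ^ n ∈ 𝒜 (n • m) := SetLike.pow_mem_graded n hf
      have h2 : f ^ n ∈ 𝒜 z.deg := hn ▸ z.den.2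
      simpa using DirectSum.degree_eq_of_mem_mem 𝒜 h2 h1 (pow_ne_zero n hf0)
    refine ⟨n, z.num, hin ▸ z.num.2, ?_⟩
    rw [hn]
    exact hz
  · rintro ⟨n, a, ha, rfl⟩
    have hz := stalkToFrac_germ_awayToSection 𝒜 (genericPoint (Proj 𝒜)) hη
      ⟨n * m, ⟨a, ha⟩, ⟨f ^ n, by simpa using SetLike.pow_mem_graded n hf⟩, ⟨n, rfl⟩⟩
    exact ⟨_, hz⟩

end ProjDomain


/-! ### Determinants that describe the top exterior power of a quotient. -/

section LinearAlgebra

variable {K : Type} [Field K] {σ : Type} [Fintype σ] [DecidableEq σ] {r : ℕ}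

/-- The determinant with rows `ρ₁`, `ρ₂` and the rows of `A`. -/
def bigDet (e : Fin 2 ⊕ Fin r ≃ σ) (ρ₁ ρ₂ : σ → K) (A : Fin r → σ → K) : K :=
  Matrix.det (Matrix.of fun i j => (Sum.elim ![ρ₁, ρ₂] A : Fin 2 ⊕ Fin r → σ → K) i (e j))

theorem exists_equiv_apply_inl (e : Fin 2 ⊕ Fin r ≃ σ) {j k : σ} (hjk : j ≠ k) :
    ∃ e' : Fin 2 ⊕ Fin r ≃ σ, e' (Sum.inl 0) = j ∧ e' (Sum.inl 1) = k := by
  set p := Equiv.swap (Sum.inl 0) (e.symm j) with hp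
  set q := Equiv.swap (Sum.inl 1) (p.symm (e.symm k)) with hq
  have hp0 : p (Sum.inl 0) = e.symm j := by simp [hp]
  have hne : p.symm (e.symm k) ≠ Sum.inl 0 := by
    intro h
    rw [Equiv.symm_apply_eq, hp0] at h
    exact hjk (e.symm.injective h).symm
  refine ⟨(q.trans p).trans e, ?_, ?_⟩
  · have : q (Sum.inl 0) = Sum.inl 0 :=
      Equiv.swap_apply_of_ne_of_ne (by simp) hne.symm
    simp [this, hp0]
  · have : q (Sum.inl 1) = p.symm (e.symm k) := by simp [hq]
    simp [this]

/-- The maximal minors of a `2 × σ` matrix as determinants. -/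
theorem exists_bigDet_eq_minor (e : Fin 2 ⊕ Fin r ≃ σ) {j k : σ} (hjk : j ≠ k) :
    ∃ (S : Fin r → σ) (ε : ℤˣ), ({j} ∪ {k} ∪ Set.range S = Set.univ) ∧
      Function.Injective S ∧ (∀ i, S i ≠ j) ∧ (∀ i, S i ≠ k) ∧ ∀ ρ₁ ρ₂ : σ → K,
      bigDet e ρ₁ ρ₂ (fun i => Pi.single (S i) 1) =
        ((ε : ℤ) : K) * (ρ₁ j * ρ₂ k - ρ₁ k * ρ₂ j) := by
  obtain ⟨e', h0, h1⟩ := exists_equiv_apply_inl e hjk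
  refine ⟨fun i => e' (Sum.inr i), Equiv.Perm.sign (e.trans e'.symm), ?_, ?_, ?_, ?_,
    fun ρ₁ ρ₂ => ?_⟩
  · refine Set.eq_univ_of_forall fun l => ?_
    obtain ⟨t, rfl⟩ := e'.surjective l
    rcases t with t | t
    · fin_cases t
      · exact .inl (.inl h0)
      · exact .inl (.inr h1)
    · exact .inr ⟨t, rfl⟩
  · exact e'.injective.comp Sum.inr_injective
  · exact fun i h => by simpa using e'.injective (h.trans h0.symm)
  · exact fun i h => by simpa using e'.injective (h.trans h1.symm)
  set N : Matrix (Fin 2 ⊕ Fin r) (Fin 2 ⊕ Fin r) K :=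
    Matrix.of fun i j => (Sum.elim ![ρ₁, ρ₂] (fun i => Pi.single (e' (Sum.inr i)) 1) :
      Fin 2 ⊕ Fin r → σ → K) i (e' j) with hN
  have hperm : bigDet e ρ₁ ρ₂ (fun i => Pi.single (e' (Sum.inr i)) 1) =
      (N.submatrix id (e.trans e'.symm)).det := by
    rw [bigDet]
    congr 1
    ext i l
    simp [hN]
  have hblock : N = Matrix.fromBlocks (!![ρ₁ j, ρ₁ k; ρ₂ j, ρ₂ k])
      (Matrix.of fun i l => (![ρ₁, ρ₂] i) (e' (Sum.inr l))) 0 1 := by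
    ext (i | i) (l | l)
    · fin_cases i <;> fin_cases l <;> simp [hN, h0, h1]
    · simp [hN]
    · simp [hN]
    · simp [hN, Pi.single_apply, Matrix.one_apply, eq_comm]
  rw [hperm, Matrix.det_permute', hblock, Matrix.det_fromBlocks_zero₂₁, Matrix.det_one, mul_one,
    Matrix.det_fin_two_of]

theorem bigDet_mem (e : Fin 2 ⊕ Fin r ≃ σ) {ρ₁ ρ₂ : σ → K} {A : Fin r → σ → K} (S : Subring K)
    (h1 : ∀ k, ρ₁ k ∈ S) (h2 : ∀ k, ρ₂ k ∈ S) (hA : ∀ i k, A i k ∈ S) :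
    bigDet e ρ₁ ρ₂ A ∈ S := by
  rw [bigDet, Matrix.det_apply]
  refine Subring.sum_mem _ fun τ _ => ?_
  rw [Units.smul_def]
  refine Subring.zsmul_mem _ (Subring.prod_mem _ fun i _ => ?_) _
  simp only [Matrix.of_apply]
  rcases τ i with l | l
  · fin_cases l
    · exact h1 _
    · exact h2 _
  · exact hA _ _

/-- Row operations act on `bigDet` by their determinant. -/
theorem bigDet_vecMul (e : Fin 2 ⊕ Fin r ≃ σ) (ρ₁ ρ₂ : σ → K) (A : Fin r → σ → K)
    (T : Matrix σ σ K) :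
    bigDet e (Matrix.vecMul ρ₁ T) (Matrix.vecMul ρ₂ T) (fun i => Matrix.vecMul (A i) T) =
      bigDet e ρ₁ ρ₂ A * T.det := by
  rw [bigDet, bigDet, ← Matrix.det_submatrix_equiv_self e T, ← Matrix.det_mul]
  congr 1
  ext i l
  have : (Sum.elim ![Matrix.vecMul ρ₁ T, Matrix.vecMul ρ₂ T] (fun i => Matrix.vecMul (A i) T) :
      Fin 2 ⊕ Fin r → σ → K) i =
      Matrix.vecMul ((Sum.elim ![ρ₁, ρ₂] A : Fin 2 ⊕ Fin r → σ → K) i) T := by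
    rcases i with i | i
    · fin_cases i <;> rfl
    · rfl
  rw [Matrix.of_apply, this, Matrix.mul_apply, Matrix.vecMul, dotProduct]
  exact (Equiv.sum_comp e (fun l' =>
    (Sum.elim ![ρ₁, ρ₂] A : Fin 2 ⊕ Fin r → σ → K) i l' * T l' (e l))).symm

theorem bigDet_smul_left (e : Fin 2 ⊕ Fin r ≃ σ) (a : K) (ρ₁ ρ₂ : σ → K) (A : Fin r → σ → K) :
    bigDet e (a • ρ₁) ρ₂ A = a * bigDet e ρ₁ ρ₂ A := by
  set M : Matrix (Fin 2 ⊕ Fin r) (Fin 2 ⊕ Fin r) K :=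
    Matrix.of fun i j => (Sum.elim ![ρ₁, ρ₂] A : Fin 2 ⊕ Fin r → σ → K) i (e j) with hM
  have h1 : (Matrix.of fun i j => (Sum.elim ![a • ρ₁, ρ₂] A : Fin 2 ⊕ Fin r → σ → K) i (e j)) =
      M.updateRow (Sum.inl 0) (a • M (Sum.inl 0)) := by
    ext i j
    rcases i with i | i
    · fin_cases i <;> simp [hM, Matrix.updateRow_apply]
    · simp [hM, Matrix.updateRow_apply]
  rw [bigDet, h1, Matrix.det_updateRow_smul, Matrix.updateRow_eq_self, bigDet]

/-- Both sides are alternating, so it suffices to compare them on permutations of the basis, where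
both change by the sign. -/
theorem alternatingMap_eq_det_smul {V W : Type} [AddCommGroup V] [Module K V] [AddCommGroup W]
    [Module K W] (B : Module.Basis (Fin r) K V) (f : V [⋀^Fin r]→ₗ[K] W) (v : Fin r → V) :
    f v = B.det v • f B := by
  have h : f = (LinearMap.toSpanSingleton K W (f B)).compAlternatingMap B.det := by
    refine Module.Basis.ext_alternating B fun i hi => ?_
    let τ : Equiv.Perm (Fin r) := Equiv.ofBijective i (Finite.injective_iff_bijective.1 hi)
    change f (B ∘ τ) = (LinearMap.toSpanSingleton K W (f B)).compAlternatingMap B.det (B ∘ τ)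
    rw [AlternatingMap.map_perm, AlternatingMap.map_perm]
    simp [Module.Basis.det_self]
  rw [h]
  simp [Module.Basis.det_self]

/-- A surjection with two-dimensional kernel identifies the top exterior power of the target with
a determinant. -/
theorem exists_form_eq_bigDet {V : Type} [AddCommGroup V] [Module K V]
    (φ : (σ → K) →ₗ[K] V) (hφ : Function.Surjective φ) [FiniteDimensional K V]
    (hr : Module.finrank K V = r) (e : Fin 2 ⊕ Fin r ≃ σ) {ρ₁ : σ → K} (h1 : φ ρ₁ = 0)
    (l : (σ → K) →ₗ[K] K) (hl : l ρ₁ = 0) (hne : ρ₁ ≠ 0) (h2 : ∃ ρ₂, φ ρ₂ = 0 ∧ l ρ₂ = 1) :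
    ∃ ω : ⋀[K]^r V, ω ≠ 0 ∧ ∀ ρ₂, φ ρ₂ = 0 → l ρ₂ = 1 → ∀ A : Fin r → σ → K,
      exteriorPower.ιMulti K r (fun i => φ (A i)) = bigDet e ρ₁ ρ₂ A • ω := by
  obtain ⟨ρ, hρ, hlρ⟩ := h2
  set B := Module.finBasisOfFinrankEq K V hr
  choose s hs using fun i => hφ (B i)
  have hker : ∀ v, φ v = 0 → ∃ a b : K, v = a • ρ₁ + b • ρ := by
    have hli : LinearIndependent K ![ρ₁, ρ] := by
      rw [LinearIndependent.pair_iff]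
      intro a b hab
      have hb : b = 0 := by
        have := congrArg l hab
        simpa [hl, hlρ] using this
      subst hb
      simp only [zero_smul, add_zero, smul_eq_zero, hne, or_false] at hab
      exact ⟨hab, rfl⟩
    -- The equivalence `e` says that there are $r+2$ variables, and the image has dimension $r$.
    have hrank : Module.finrank K (LinearMap.ker φ) = 2 := by
      have h := LinearMap.finrank_range_add_finrank_ker φ
      rw [LinearMap.range_eq_top.2 hφ, finrank_top, hr, Module.finrank_fintype_fun_eq_card,
        ← Fintype.card_congr e] at h
      simp at h
      omega
    have hle : Submodule.span K (Set.range ![ρ₁, ρ]) ≤ LinearMap.ker φ := by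
      rw [Submodule.span_le]
      rintro _ ⟨i, rfl⟩
      fin_cases i
      · exact h1
      · exact hρ
    have heq : Submodule.span K (Set.range ![ρ₁, ρ]) = LinearMap.ker φ := by
      apply Submodule.eq_of_le_of_finrank_eq hle
      rw [finrank_span_eq_card hli, hrank]
      simp
    intro v hv
    have hv' : v ∈ Submodule.span K (Set.range ![ρ₁, ρ]) := heq ▸ hv
    rw [Matrix.range_cons, Matrix.range_cons, Matrix.range_empty, Set.union_empty,
      Set.singleton_union, Submodule.mem_span_pair] at hv'
    obtain ⟨a, b, hab⟩ := hv'
    exact ⟨a, b, hab.symm⟩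
  have hexp : ∀ v, ∃ a b : K, v = a • ρ₁ + b • ρ + ∑ i, B.repr (φ v) i • s i := by
    intro v
    obtain ⟨a, b, hab⟩ := hker (v - ∑ i, B.repr (φ v) i • s i) (by
      rw [map_sub, map_sum]
      simp only [map_smul, hs]
      rw [B.sum_repr, sub_self])
    exact ⟨a, b, by rw [← hab, sub_add_cancel]⟩
  set P : Matrix (Fin 2 ⊕ Fin r) (Fin 2 ⊕ Fin r) K :=
    Matrix.of fun i j => (Sum.elim ![ρ₁, ρ] s : Fin 2 ⊕ Fin r → σ → K) i (e j) with hP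
  have hδ : P.det ≠ 0 := by
    have : IsUnit P := by
      rw [← Matrix.vecMul_surjective_iff_isUnit]
      intro v
      obtain ⟨a, b, hab⟩ := hexp (v ∘ e.symm)
      refine ⟨Sum.elim ![a, b] fun i => B.repr (φ (v ∘ e.symm)) i, ?_⟩
      ext j
      have := congrFun hab (e j)
      simp only [Function.comp_apply, Equiv.symm_apply_apply] at this
      rw [this]
      simp [Matrix.vecMul, dotProduct, Fintype.sum_sum_type, hP, Fin.sum_univ_two]
    exact ((Matrix.isUnit_iff_isUnit_det _).1 this).ne_zero
  -- The factor normalizes the identity on the frame $(\rho_1,\rho,s)$, where `s` lifts the basis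
  -- `B`.
  refine ⟨P.det⁻¹ • exteriorPower.ιMulti K r B, ?_, fun ρ₂ hρ₂ hlρ₂ A => ?_⟩
  · apply smul_ne_zero (inv_ne_zero hδ)
    intro h0
    have := congrArg (exteriorPower.alternatingMapLinearEquiv B.det) h0
    rw [exteriorPower.alternatingMapLinearEquiv_apply_ιMulti, Module.Basis.det_self,
      map_zero] at this
    exact one_ne_zero this
  -- The condition `l ρ₂ = 1` leaves only a multiple of $\rho_1$ as ambiguity in $\rho_2$, which the
  -- determinant does not see.
  obtain ⟨a, b, hab⟩ := hker (ρ₂ - ρ) (by rw [map_sub, hρ₂, hρ, sub_zero])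
  have hb : b = 0 := by
    have := congrArg l hab
    simpa [hl, hlρ, hlρ₂] using this.symm
  subst hb
  rw [zero_smul, add_zero, sub_eq_iff_eq_add] at hab
  choose α β hA using fun i => hexp (A i)
  -- The rows $(\rho_1,\rho_2,A)$ expressed in the frame $(\rho_1,\rho,s)$. The matrix is block
  -- triangular, and its second diagonal block holds the coordinates of $\varphi(A_i)$ in `B`.
  set N : Matrix (Fin 2 ⊕ Fin r) (Fin 2 ⊕ Fin r) K :=
    Matrix.fromBlocks !![1, 0; a, 1] 0 (Matrix.of fun i => ![α i, β i])
      (Matrix.of fun i l => B.repr (φ (A i)) l) with hN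
  have hdet : bigDet e ρ₁ ρ₂ A = (N * P).det := by
    rw [bigDet]
    congr 1
    ext (i | i) j
    · rw [Matrix.mul_apply, Fintype.sum_sum_type]
      fin_cases i <;> simp [hN, hP, hab, Fin.sum_univ_two]
    · rw [Matrix.mul_apply, Fintype.sum_sum_type]
      have := congrFun (hA i) (e j)
      simp only [Matrix.of_apply, Sum.elim_inr]
      rw [this]
      simp [hN, hP, Fin.sum_univ_two]
  have hBdet : B.det (fun i => φ (A i)) =
      (Matrix.of fun i l => B.repr (φ (A i)) l : Matrix (Fin r) (Fin r) K).det := by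
    rw [Module.Basis.det_apply, ← Matrix.det_transpose]
    rfl
  rw [alternatingMap_eq_det_smul B, hdet, Matrix.det_mul, hN, Matrix.det_fromBlocks_zero₁₂,
    Matrix.det_fin_two_of, hBdet, smul_smul]
  congr 1
  field_simp
  ring

end LinearAlgebra


/-! ### The residue form of a hypersurface: existence, rescaling, and regularity. -/

section Residue

variable {K : Type} [Field K] [Algebra ℂ K] {σ : Type} [Fintype σ] [DecidableEq σ] {r : ℕ}

/-- The linear map `K^σ → Ω_K` sending the basis vector `e_k` to `d c_k`. -/
def diffMap (c : σ → K) : (σ → K) →ₗ[K] Ω[K⁄ℂ] :=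
  Fintype.linearCombination K fun k => KaehlerDifferential.D ℂ K (c k)

/-- The linear form `v ↦ ∑ w_k c_k v_k`. -/
def eulerForm (w : σ → ℕ) (c : σ → K) : (σ → K) →ₗ[K] K :=
  Fintype.linearCombination K fun k => (w k : K) * c k

/-- The gradient of `P` at `c`. -/
def gradAt (P : MvPolynomial σ ℂ) (c : σ → K) : σ → K := fun k => aeval c (pderiv k P)

theorem diffMap_apply (c v : σ → K) :
    diffMap c v = ∑ k, v k • KaehlerDifferential.D ℂ K (c k) := rfl

theorem eulerForm_apply (w : σ → ℕ) (c v : σ → K) :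
    eulerForm w c v = ∑ k, v k * ((w k : K) * c k) := rfl

theorem diffMap_single (c : σ → K) (k : σ) :
    diffMap c (Pi.single k 1) = KaehlerDifferential.D ℂ K (c k) := by
  rw [diffMap, Fintype.linearCombination_apply_single, one_smul]

theorem diffMap_gradAt (c : σ → K) (P : MvPolynomial σ ℂ) :
    diffMap c (gradAt P c) = KaehlerDifferential.D ℂ K (aeval c P) := by
  simp only [diffMap_apply, gradAt]
  induction P using MvPolynomial.induction_on with
  | C a => simp
  | add p q hp hq => simp only [map_add, add_smul, Finset.sum_add_distrib, hp, hq]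
  | mul_X p i hp =>
    have : ∀ k, aeval c (pderiv k (p * X i)) • KaehlerDifferential.D ℂ K (c k) =
        c i • (aeval c (pderiv k p) • KaehlerDifferential.D ℂ K (c k)) +
        (if k = i then aeval c p • KaehlerDifferential.D ℂ K (c i) else 0) := by
      intro k
      rw [Derivation.leibniz, pderiv_X]
      by_cases h : k = i
      · subst h
        simp [add_smul, mul_smul, add_comm]
      · simp [h, mul_smul, Pi.single_apply, Ne.symm h]
    rw [Finset.sum_congr rfl fun k _ => this k, Finset.sum_add_distrib, ← Finset.smul_sum, hp]
    simp [add_comm]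

theorem eulerForm_gradAt {w : σ → ℕ} {F : MvPolynomial σ ℂ} {d : ℕ}
    (hF : IsWeightedHomogeneous w F d) (c : σ → K) :
    eulerForm w c (gradAt F c) = (d : K) * aeval c F := by
  have h := congrArg (aeval c) hF.sum_weight_X_mul_pderiv
  rw [map_sum, map_nsmul, nsmul_eq_mul] at h
  rw [← h, eulerForm_apply]
  refine Finset.sum_congr rfl fun k _ => ?_
  rw [map_nsmul, map_mul, aeval_X, gradAt, nsmul_eq_mul]
  ring

/-- `ω` is the Poincaré residue form of the hypersurface `F = 0` in the homogeneous coordinates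
`c`, when `K` is the function field. -/
def IsResidueForm (w : σ → ℕ) (F : MvPolynomial σ ℂ) (e : Fin 2 ⊕ Fin r ≃ σ) (c : σ → K)
    (ω : ⋀[K]^r (Ω[K⁄ℂ])) : Prop :=
  ∀ ρ, diffMap c ρ = 0 → eulerForm w c ρ = 1 → ∀ A : Fin r → σ → K,
    exteriorPower.ιMulti K r (fun i => diffMap c (A i)) = bigDet e (gradAt F c) ρ A • ω

variable {w : σ → ℕ} {F : MvPolynomial σ ℂ} {e : Fin 2 ⊕ Fin r ≃ σ} {c : σ → K}
  {ω : ⋀[K]^r (Ω[K⁄ℂ])} {d : ℕ}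

theorem exists_isResidueForm (hF : IsWeightedHomogeneous w F d) (hc : aeval c F = 0)
    (hφ : Function.Surjective (diffMap c)) [FiniteDimensional K (Ω[K⁄ℂ])]
    (hr : Module.finrank K (Ω[K⁄ℂ]) = r) (hne : gradAt F c ≠ 0)
    (h2 : ∃ ρ, diffMap c ρ = 0 ∧ eulerForm w c ρ = 1) (e : Fin 2 ⊕ Fin r ≃ σ) :
    ∃ ω : ⋀[K]^r (Ω[K⁄ℂ]), ω ≠ 0 ∧ IsResidueForm w F e c ω :=
  exists_form_eq_bigDet (diffMap c) hφ hr e (by rw [diffMap_gradAt, hc, map_zero])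
    (eulerForm w c) (by rw [eulerForm_gradAt hF, hc, mul_zero]) hne h2

theorem aeval_pow_mul {P : MvPolynomial σ ℂ} {n : ℕ} (hP : IsWeightedHomogeneous w P n) (τ : K) :
    aeval (fun k => τ ^ w k * c k) P = τ ^ n * aeval c P := by
  rw [aeval_def, aeval_def, eval₂_eq', eval₂_eq', Finset.mul_sum]
  refine Finset.sum_congr rfl fun a ha => ?_
  have hw : Finsupp.weight w a = n := hP (mem_support_iff.1 ha)
  rw [Finsupp.weight_apply, Finsupp.sum_fintype _ _ (by simp)] at hw
  rw [← hw, ← Finset.prod_pow_eq_pow_sum]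
  simp only [mul_pow, Finset.prod_mul_distrib, smul_eq_mul, ← pow_mul, mul_comm (w _)]
  ring

/-- The factor $\tau^{w_k}$ on the left avoids the exponent $d-w_k$, so the identity also covers a
vanishing derivative. -/
theorem pow_mul_gradAt (hF : IsWeightedHomogeneous w F d) (τ : K) (k : σ) :
    τ ^ w k * gradAt F (fun k => τ ^ w k * c k) k = τ ^ d * gradAt F c k := by
  by_cases h0 : pderiv k F = 0
  · simp [gradAt, h0]
  have hle := isWeightedHomogeneous_pderiv_ne_zero hF h0
  have hp : IsWeightedHomogeneous w (pderiv k F) (d - w k) := hF.pderiv (by omega)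
  rw [gradAt, aeval_pow_mul hp, ← mul_assoc, ← pow_add,
    Nat.add_sub_cancel' hle, gradAt]

/-- Since $d(\tau^{w}c)=\tau^{w}(dc+w\,c\,d\tau/\tau)$, the new differentials come from the old ones
by a matrix `T`: a diagonal matrix times a rank one perturbation of the identity. Its determinant is
$\tau^{\sum w}$, and it sends the new gradient to $\tau^d$ times the old one, whence the factor
$\tau^{\sum w-d}$. -/
theorem IsResidueForm.rescale (hω : IsResidueForm w F e c ω) (hF : IsWeightedHomogeneous w F d)
    (hc : aeval c F = 0) (hφ : Function.Surjective (diffMap c))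
    (h2 : ∃ ρ, diffMap c ρ = 0 ∧ eulerForm w c ρ = 1) {τ : K} (hτ : τ ≠ 0)
    {ω' : ⋀[K]^r (Ω[K⁄ℂ])} (hω' : τ ^ d • ω' = τ ^ (∑ k, w k) • ω) :
    IsResidueForm w F e (fun k => τ ^ w k * c k) ω' := by
  obtain ⟨ρ₀, hρ₀, hlρ₀⟩ := h2
  -- A lift of $d\tau/\tau$, corrected by a multiple of $\rho_0$ so that its Euler form is zero.
  -- That makes the rank one perturbation have determinant one.
  obtain ⟨ξ, hξ, hlξ⟩ : ∃ ξ, diffMap c ξ = τ⁻¹ • KaehlerDifferential.D ℂ K τ ∧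
      eulerForm w c ξ = 0 := by
    obtain ⟨ξ, hξ⟩ := hφ (τ⁻¹ • KaehlerDifferential.D ℂ K τ)
    refine ⟨ξ - eulerForm w c ξ • ρ₀, ?_, ?_⟩
    · rw [map_sub, map_smul, hρ₀, smul_zero, sub_zero, hξ]
    · rw [map_sub, map_smul, hlρ₀, smul_eq_mul, mul_one, sub_self]
  set T : Matrix σ σ K := Matrix.diagonal (fun k => τ ^ w k) *
    (1 + Matrix.replicateCol Unit (fun k => (w k : K) * c k) * Matrix.replicateRow Unit ξ) with hT
  have hTdet : T.det = τ ^ (∑ k, w k) := by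
    rw [hT, Matrix.det_mul, Matrix.det_diagonal, Matrix.det_one_add_replicateCol_mul_replicateRow,
      Finset.prod_pow_eq_pow_sum]
    have : ξ ⬝ᵥ (fun k => (w k : K) * c k) = 0 := hlξ
    rw [this, add_zero, mul_one]
  have hTv : ∀ v, Matrix.vecMul v T = (fun k => v k * τ ^ w k) +
      (∑ k, v k * τ ^ w k * ((w k : K) * c k)) • ξ := by
    intro v
    rw [hT, ← Matrix.vecMul_vecMul, Matrix.vecMul_add, Matrix.vecMul_one]
    have h1 : Matrix.vecMul v (Matrix.diagonal fun k => τ ^ w k) = fun k => v k * τ ^ w k := by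
      ext k
      rw [Matrix.vecMul_diagonal]
    rw [h1]
    congr 1
    ext k
    rw [← Matrix.vecMul_vecMul]
    simp [Matrix.vecMul, dotProduct]
  have hTφ : ∀ v, diffMap c (Matrix.vecMul v T) = diffMap (fun k => τ ^ w k * c k) v := by
    intro v
    rw [hTv, map_add, map_smul, hξ, diffMap_apply, diffMap_apply, Finset.sum_smul,
      ← Finset.sum_add_distrib]
    refine Finset.sum_congr rfl fun k _ => ?_
    rw [Derivation.leibniz, Derivation.leibniz_pow, smul_add, smul_smul, smul_smul]
    congr 1
    rw [← Nat.cast_smul_eq_nsmul K, smul_smul, smul_smul, smul_smul]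
    congr 1
    rcases Nat.eq_zero_or_pos (w k) with h | h
    · simp [h]
    · obtain ⟨s, hs⟩ := Nat.exists_eq_add_of_lt h
      rw [hs]
      simp only [zero_add, Nat.add_sub_cancel, pow_succ]
      field_simp
  have hTl : ∀ v, eulerForm w c (Matrix.vecMul v T) =
      eulerForm w (fun k => τ ^ w k * c k) v := by
    intro v
    rw [hTv, map_add, map_smul, hlξ, smul_zero, add_zero, eulerForm_apply, eulerForm_apply]
    exact Finset.sum_congr rfl fun k _ => by ring
  have hTρ : Matrix.vecMul (gradAt F fun k => τ ^ w k * c k) T = τ ^ d • gradAt F c := by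
    have h1 : ∀ k, gradAt F (fun k => τ ^ w k * c k) k * τ ^ w k = τ ^ d * gradAt F c k := by
      intro k
      rw [mul_comm, pow_mul_gradAt hF]
    rw [hTv]
    simp only [h1]
    have h2 : ∑ k, τ ^ d * gradAt F c k * ((w k : K) * c k) = 0 := by
      have h3 := eulerForm_gradAt hF c
      rw [hc, mul_zero, eulerForm_apply] at h3
      rw [← mul_zero (τ ^ d), ← h3, Finset.mul_sum]
      exact Finset.sum_congr rfl fun k _ => by ring
    rw [h2, zero_smul, add_zero]
    rfl
  intro ρ hρ hlρ A
  have h1 := hω (Matrix.vecMul ρ T) (by rw [hTφ, hρ]) (by rw [hTl, hlρ])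
    fun i => Matrix.vecMul (A i) T
  simp only [hTφ] at h1
  rw [h1]
  have h2 := bigDet_vecMul e (gradAt F fun k => τ ^ w k * c k) ρ A T
  rw [hTρ, bigDet_smul_left, hTdet] at h2
  have hτd : τ ^ d ≠ 0 := pow_ne_zero _ hτ
  apply smul_right_injective _ hτd
  change τ ^ d • _ = τ ^ d • _
  rw [smul_smul, h2, smul_comm (τ ^ d), hω', smul_smul]

/-- Pairing the $2\times2$ minors of $(\nabla F,\rho)$ with the Euler vector leaves $\partial_jF$,
because the Euler form is $0$ on $\nabla F$ and $1$ on $\rho$. -/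
theorem eulerForm_minor (hF : IsWeightedHomogeneous w F d) (hc : aeval c F = 0) {ρ : σ → K}
    (hρ : eulerForm w c ρ = 1) (j : σ) :
    ∑ k, ((w k : K) * c k) * (gradAt F c j * ρ k - gradAt F c k * ρ j) = gradAt F c j := by
  have h1 := eulerForm_gradAt hF c
  rw [hc, mul_zero, eulerForm_apply] at h1
  rw [eulerForm_apply] at hρ
  calc _ = gradAt F c j * ∑ k, ρ k * ((w k : K) * c k) -
        ρ j * ∑ k, gradAt F c k * ((w k : K) * c k) := by
        rw [Finset.mul_sum, Finset.mul_sum, ← Finset.sum_sub_distrib]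
        exact Finset.sum_congr rfl fun k _ => by ring
    _ = _ := by rw [h1, hρ, mul_one, mul_zero, sub_zero]

/-- `∂_j F · ω` as a combination of the forms `∧_{l ≠ j, k} d c_l`. -/
theorem IsResidueForm.expansion (hω : IsResidueForm w F e c ω) (hF : IsWeightedHomogeneous w F d)
    (hc : aeval c F = 0) (h2 : ∃ ρ, diffMap c ρ = 0 ∧ eulerForm w c ρ = 1) (j : σ) :
    ∃ (S : σ → Fin r → σ) (ε : σ → ℤˣ), (∀ k, k ≠ j → ({j} ∪ {k} ∪ Set.range (S k) = Set.univ) ∧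
        Function.Injective (S k) ∧ (∀ i, S k i ≠ j) ∧ ∀ i, S k i ≠ k) ∧
      gradAt F c j • ω = ∑ k ∈ Finset.univ.erase j, ((w k : K) * c k * ((ε k : ℤ) : K)) •
        exteriorPower.ιMulti K r fun i => KaehlerDifferential.D ℂ K (c (S k i)) := by
  obtain ⟨ρ, hρ, hlρ⟩ := h2
  have key : ∀ k, ∃ (S : Fin r → σ) (ε : ℤˣ), k ≠ j → ({j} ∪ {k} ∪ Set.range S = Set.univ) ∧
      Function.Injective S ∧ (∀ i, S i ≠ j) ∧ (∀ i, S i ≠ k) ∧ 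
      ((gradAt F c j * ρ k - gradAt F c k * ρ j) • ω = ((ε : ℤ) : K) •
        exteriorPower.ιMulti K r fun i => KaehlerDifferential.D ℂ K (c (S i))) := by
    intro k
    by_cases hkj : k = j
    · exact ⟨fun _ => j, 1, fun h => (h hkj).elim⟩
    obtain ⟨S, ε, hS1, hS2, hS3, hS4, hS5⟩ := exists_bigDet_eq_minor (K := K) e (Ne.symm hkj)
    refine ⟨S, ε, fun _ => ⟨hS1, hS2, hS3, hS4, ?_⟩⟩
    have h3 := hω ρ hρ hlρ fun i => Pi.single (S i) 1
    simp only [diffMap_single] at h3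
    rw [h3, hS5, smul_smul, ← mul_assoc]
    have : ((ε : ℤ) : K) * ((ε : ℤ) : K) = 1 := by
      rcases Int.units_eq_one_or ε with h | h <;> simp [h]
    rw [this, one_mul]
  choose S ε h using key
  refine ⟨S, ε, fun k hk => ⟨(h k hk).1, (h k hk).2.1, (h k hk).2.2.1, (h k hk).2.2.2.1⟩, ?_⟩
  conv_lhs => rw [← eulerForm_minor hF hc hlρ j, Finset.sum_smul,
    ← Finset.add_sum_erase _ _ (Finset.mem_univ j)]
  rw [mul_comm (gradAt F c j), sub_self, mul_zero, zero_smul, zero_add]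
  refine Finset.sum_congr rfl fun k hk => ?_
  rw [mul_smul, (h k (Finset.ne_of_mem_erase hk)).2.2.2.2, smul_smul]

theorem aeval_mem_subring {A : Subring K} (hA : ∀ z : ℂ, algebraMap ℂ K z ∈ A)
    (hcA : ∀ k, c k ∈ A) (P : MvPolynomial σ ℂ) : aeval c P ∈ A := by
  induction P using MvPolynomial.induction_on with
  | C a => rw [aeval_C]; exact hA a
  | add p q hp hq => rw [map_add]; exact A.add_mem hp hq
  | mul_X p i hp => rw [map_mul, aeval_X]; exact A.mul_mem hp (hcA i)

theorem smul_mem_regularForms {A : Subring K} {a : K} (ha : a ∈ A) {η : ⋀[K]^r (Ω[K⁄ℂ])}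
    (hη : η ∈ regularForms K r A) : a • η ∈ regularForms K r A :=
  (regularForms K r A).smul_mem (⟨a, ha⟩ : A) hη

/-- Dividing the expansion of $\partial_jF\cdot\omega$ by the unit $\partial_jF$ leaves wedges of
differentials of coordinates in `A`. -/
theorem IsResidueForm.mem_regularForms (hω : IsResidueForm w F e c ω)
    (hF : IsWeightedHomogeneous w F d) (hc : aeval c F = 0)
    (h2 : ∃ ρ, diffMap c ρ = 0 ∧ eulerForm w c ρ = 1) {A : Subring K}
    (hcA : ∀ k, c k ∈ A) {j : σ} (hj0 : gradAt F c j ≠ 0) (hj : (gradAt F c j)⁻¹ ∈ A) :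
    ω ∈ regularForms K r A := by
  obtain ⟨S, ε, -, h⟩ := hω.expansion hF hc h2 j
  have h3 : ω = (gradAt F c j)⁻¹ • gradAt F c j • ω := by
    rw [smul_smul, inv_mul_cancel₀ hj0, one_smul]
  rw [h3, h]
  refine smul_mem_regularForms hj (Submodule.sum_mem _ fun k _ => smul_mem_regularForms ?_
    (Submodule.subset_span ⟨fun i => ⟨c (S k i), hcA _⟩, rfl⟩))
  exact A.mul_mem (A.mul_mem (natCast_mem _ _) (hcA k)) (intCast_mem _ _)

/-- The quotient rule lifts $da_i$ to a vector with entries in `A`; the defining determinant of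
$da_1\wedge\dots\wedge da_r$ over $\omega$ then has all its entries in `A`. -/
theorem IsResidueForm.span_eq_regularForms (hω : IsResidueForm w F e c ω)
    (hF : IsWeightedHomogeneous w F d) (hc : aeval c F = 0) {A : Subring K}
    (hA : ∀ z : ℂ, algebraMap ℂ K z ∈ A)
    (h2 : ∃ ρ, diffMap c ρ = 0 ∧ eulerForm w c ρ = 1 ∧ ∀ k, ρ k ∈ A)
    (hcA : ∀ k, c k ∈ A) {j : σ} (hj0 : gradAt F c j ≠ 0) (hj : (gradAt F c j)⁻¹ ∈ A)
    (hfrac : ∀ a ∈ A, ∃ P Q : MvPolynomial σ ℂ, aeval c Q ≠ 0 ∧ (aeval c Q)⁻¹ ∈ A ∧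
      a = aeval c P / aeval c Q) :
    Submodule.span A {ω} = regularForms K r A := by
  obtain ⟨ρ, hρ, hlρ, hρA⟩ := h2
  refine le_antisymm ?_ ?_
  · rw [Submodule.span_le, Set.singleton_subset_iff]
    exact hω.mem_regularForms hF hc ⟨ρ, hρ, hlρ⟩ hcA hj0 hj
  refine Submodule.span_le.2 ?_
  rintro _ ⟨a, rfl⟩
  have key : ∀ i, ∃ v : σ → K, (∀ k, v k ∈ A) ∧
      diffMap c v = KaehlerDifferential.D ℂ K (a i : K) := by
    intro i
    obtain ⟨P, Q, hQ0, hQ, ha⟩ := hfrac (a i) (a i).2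
    have hP : aeval c P = a i * aeval c Q := by rw [ha, div_mul_cancel₀ _ hQ0]
    refine ⟨(aeval c Q)⁻¹ • (gradAt P c - (a i : K) • gradAt Q c), fun k => ?_, ?_⟩
    · exact A.mul_mem hQ (A.sub_mem (aeval_mem_subring hA hcA _)
        (A.mul_mem (a i).2 (aeval_mem_subring hA hcA _)))
    · rw [map_smul, map_sub, map_smul, diffMap_gradAt, diffMap_gradAt, hP, Derivation.leibniz,
        add_sub_cancel_left, smul_smul, inv_mul_cancel₀ hQ0, one_smul]
  choose v hv hvD using key
  rw [← (funext hvD : (fun i => diffMap c (v i)) = _), hω ρ hρ hlρ]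
  exact Submodule.mem_span_singleton.2
    ⟨⟨_, bigDet_mem e A (fun k => aeval_mem_subring hA hcA _) hρA hv⟩, rfl⟩

end Residue


/-! ### Normality of the cone by the Jacobian criterion. -/

section Normal

open TensorProduct in
/-- A domain which is smooth and algebraic over an integrally closed domain is integrally
closed. -/
theorem isIntegrallyClosed_of_smooth_of_isAlgebraic (R S : Type) [CommRing R] [CommRing S]
    [Algebra R S] [IsDomain R] [IsDomain S] [IsIntegrallyClosed R] [Algebra.Smooth R S]
    [FaithfulSMul R S] [Algebra.IsAlgebraic R S] : IsIntegrallyClosed S := by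
  let T := S ⊗[R] FractionRing R
  have hM : Algebra.algebraMapSubmonoid S (nonZeroDivisors R) ≤ nonZeroDivisors S := by
    rintro _ ⟨r, hr, rfl⟩
    refine mem_nonZeroDivisors_of_ne_zero fun h => nonZeroDivisors.ne_zero hr ?_
    exact (FaithfulSMul.algebraMap_eq_zero_iff R S).1 h
  have hloc : IsLocalization (Algebra.algebraMapSubmonoid S (nonZeroDivisors R)) T :=
    IsLocalization.tensor (FractionRing R) (nonZeroDivisors R)
  have hfrac : IsFractionRing S T := by
    -- By algebraicity each nonzero element of `S` divides a nonzero element of `R`, so inverting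
    -- those of `R` inverts everything.
    refine IsLocalization.of_le _ _ hM fun s hs => ?_
    obtain ⟨r, hr, t, ht⟩ := (Algebra.IsAlgebraic.isAlgebraic (R := R) s).exists_nonzero_dvd hs
    have h1 : IsUnit (algebraMap S T (algebraMap R S r)) :=
      IsLocalization.map_units T (⟨algebraMap R S r, r, mem_nonZeroDivisors_of_ne_zero hr, rfl⟩ :
        Algebra.algebraMapSubmonoid S (nonZeroDivisors R))
    rw [ht, map_mul] at h1
    exact isUnit_of_mul_isUnit_left h1
  rw [isIntegrallyClosed_iff T]
  intro x hx
  -- Integral closure commutes with smooth base change, and the integral closure of `R` in its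
  -- fraction field is `R`.
  obtain ⟨y, hy⟩ := (TensorProduct.toIntegralClosure_bijective_of_smooth (R := R) (S := S)
    (B := FractionRing R)).2 ⟨x, hx⟩
  have key : ∀ y : S ⊗[R] integralClosure R (FractionRing R),
      ∃ s, algebraMap S T s = (TensorProduct.toIntegralClosure R S (FractionRing R) y : T) := by
    intro y
    induction y with
    | zero => exact ⟨0, by simp⟩
    | add a b ha hb =>
      obtain ⟨s, hs⟩ := ha
      obtain ⟨t, ht⟩ := hb
      exact ⟨s + t, by rw [map_add, hs, ht, map_add]; rfl⟩
    | tmul s a =>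
      obtain ⟨r, hr⟩ := (isIntegrallyClosed_iff (FractionRing R)).1 ‹_› a.2
      refine ⟨r • s, ?_⟩
      change (r • s) ⊗ₜ[R] (1 : FractionRing R) = s ⊗ₜ[R] (a : FractionRing R)
      rw [← hr, TensorProduct.smul_tmul, Algebra.algebraMap_eq_smul_one]
  obtain ⟨s, hs⟩ := key y
  exact ⟨s, by rw [hs, hy]⟩

variable {σ : Type} [Finite σ] [DecidableEq σ] (F : MvPolynomial σ ℂ) (j : σ)

/-- Polynomials in the variables other than `x_j`. -/
abbrev OtherVars : Type := MvPolynomial {k : σ // k ≠ j} ℂ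

/-- The class of `∂_j F` in the coordinate ring. -/
abbrev pderivClass : CoordRing F := Ideal.Quotient.mk (Ideal.span {F}) (pderiv j F)

/-- The algebra structure of the coordinate ring over the polynomials in the other variables. -/
@[reducible]
def otherVarsAlgebra : Algebra (OtherVars j) (CoordRing F) :=
  ((Ideal.Quotient.mkₐ ℂ (Ideal.span {F})).comp (rename Subtype.val)).toRingHom.toAlgebra

attribute [local instance] otherVarsAlgebra

instance : IsScalarTower ℂ (OtherVars j) (CoordRing F) :=
  IsScalarTower.of_algebraMap_eq fun z => by
    change _ = (Ideal.Quotient.mkₐ ℂ (Ideal.span {F})).comp (rename Subtype.val)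
      (algebraMap ℂ (OtherVars j) z)
    rw [AlgHom.commutes]

/-- Evaluation of polynomials at `x_j = c` in an algebra over the polynomials in the other
variables. -/
def evalOther {C : Type} [CommRing C] [Algebra (OtherVars j) C] (c : C) :
    MvPolynomial σ ℂ →+* C :=
  eval₂Hom ((algebraMap (OtherVars j) C).comp MvPolynomial.C)
    fun k => if h : k ≠ j then algebraMap (OtherVars j) C (X ⟨k, h⟩) else c

theorem evalOther_X_self {C : Type} [CommRing C] [Algebra (OtherVars j) C] (c : C) :
    evalOther j c (X j) = c := by simp [evalOther]

theorem evalOther_rename {C : Type} [CommRing C] [Algebra (OtherVars j) C] (c : C)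
    (p : OtherVars j) : evalOther j c (rename Subtype.val p) = algebraMap (OtherVars j) C p := by
  induction p using MvPolynomial.induction_on with
  | C a => simp [evalOther]
  | add p q hp hq => rw [map_add, map_add, map_add, hp, hq]
  | mul_X p i hp =>
    rw [map_mul, map_mul, map_mul, hp, rename_X]
    simp [evalOther, i.2]

theorem ringHom_ext_other {C : Type} [CommRing C] {f g : MvPolynomial σ ℂ →+* C}
    (h1 : ∀ p : OtherVars j, f (rename Subtype.val p) = g (rename Subtype.val p))
    (h2 : f (X j) = g (X j)) : f = g := by
  refine MvPolynomial.ringHom_ext (fun z => ?_) fun k => ?_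
  · simpa using h1 (MvPolynomial.C z)
  · by_cases hk : k = j
    · rw [hk, h2]
    · simpa using h1 (X ⟨k, hk⟩)

/-- Taylor expansion to first order. -/
theorem evalOther_add {C : Type} [CommRing C] [Algebra (OtherVars j) C] (c ε : C) (hε : ε * ε = 0)
    (P : MvPolynomial σ ℂ) :
    evalOther j (c + ε) P = evalOther j c P + ε * evalOther j c (pderiv j P) := by
  induction P using MvPolynomial.induction_on with
  | C a => simp [evalOther]
  | add p q hp hq => simp only [map_add, hp, hq]; ring
  | mul_X p i hp =>
    rw [Derivation.leibniz, pderiv_X, map_mul, map_mul, hp]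
    by_cases hi : i = j
    · subst hi
      rw [evalOther_X_self, evalOther_X_self]
      simp only [Pi.single_eq_same, smul_eq_mul, mul_one, map_add, map_mul, evalOther_X_self]
      linear_combination evalOther i c (pderiv i p) * hε
    · have h1 : ∀ c' : C, evalOther j c' (X i) = algebraMap (OtherVars j) C (X ⟨i, hi⟩) := by
        intro c'
        simp [evalOther, hi]
      rw [h1, h1, Pi.single_eq_of_ne (fun h => hi h), smul_eq_mul, mul_zero, zero_add, smul_eq_mul,
        map_mul, h1]
      ring

/-- One Newton step: a lift $c_0$ of $x_j$ is corrected to $c_0-F(c_0)/\partial_jF(c_0)$. The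
derivative is a unit modulo the nilpotent ideal, hence a unit, and the Taylor expansion stops at
first order because $I^2=0$. -/
theorem formallySmooth_jacobianAway (S : Type) [CommRing S] [Algebra (CoordRing F) S]
    [Algebra (OtherVars j) S] [IsScalarTower (OtherVars j) (CoordRing F) S]
    [IsLocalization.Away (pderivClass F j) S] :
    Algebra.FormallySmooth (OtherVars j) S := by
  let q : MvPolynomial σ ℂ →+* S := (algebraMap (CoordRing F) S).comp (Ideal.Quotient.mk _)
  have hq : ∀ p : OtherVars j, q (rename Subtype.val p) = algebraMap (OtherVars j) S p := fun p =>
    (IsScalarTower.algebraMap_apply (OtherVars j) (CoordRing F) S p).symm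
  refine Algebra.FormallySmooth.of_comp_surjective fun C _ _ I hI g => ?_
  obtain ⟨c₀, hc₀⟩ := Ideal.Quotient.mk_surjective (g (q (X j)))
  have hmk : ∀ c : C, Ideal.Quotient.mk I c = g (q (X j)) → ∀ P,
      Ideal.Quotient.mk I (evalOther j c P) = g (q P) := by
    intro c hc P
    have : (Ideal.Quotient.mk I).comp (evalOther j c) =
        (g : S →+* C ⧸ I).comp q := by
      refine ringHom_ext_other j (fun p => ?_) ?_
      · rw [RingHom.comp_apply, evalOther_rename]
        change _ = g (q _)
        rw [hq]
        exact (AlgHom.commutes g p).symm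
      · rw [RingHom.comp_apply, evalOther_X_self, hc]
        rfl
    exact congrArg (fun f => f P) this
  have hF0 : q F = 0 := by
    change algebraMap (CoordRing F) S (Ideal.Quotient.mk _ F) = 0
    rw [Ideal.Quotient.eq_zero_iff_mem.2 (Ideal.mem_span_singleton_self F), map_zero]
  have hnil : IsNilpotent I := ⟨2, hI⟩
  have hunit : ∀ c : C, Ideal.Quotient.mk I c = g (q (X j)) →
      IsUnit (evalOther j c (pderiv j F)) := by
    intro c hc
    rw [← IsNilpotent.isUnit_quotient_mk_iff hnil, hmk c hc]
    exact (IsLocalization.Away.algebraMap_isUnit (pderivClass F j)).map g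
  obtain ⟨u, hu⟩ := (hunit c₀ hc₀).exists_right_inv
  have hFI : evalOther j c₀ F ∈ I := by
    rw [← Ideal.Quotient.eq_zero_iff_mem, hmk c₀ hc₀, hF0, map_zero]
  set ε := -(evalOther j c₀ F * u) with hε
  have hεI : ε ∈ I := I.neg_mem (I.mul_mem_right _ hFI)
  have hε2 : ε * ε = 0 := by
    have : ε * ε ∈ I ^ 2 := by rw [pow_two]; exact Ideal.mul_mem_mul hεI hεI
    rwa [hI] at this
  set c := c₀ + ε with hc
  have hcg : Ideal.Quotient.mk I c = g (q (X j)) := by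
    rw [hc, map_add, Ideal.Quotient.eq_zero_iff_mem.2 hεI, add_zero, hc₀]
  have hcF : evalOther j c F = 0 := by
    rw [hc, evalOther_add j c₀ ε hε2, hε]
    linear_combination -evalOther j c₀ F * hu
  let G₁ : CoordRing F →+* C := Ideal.Quotient.lift (Ideal.span {F}) (evalOther j c) (by
    intro a ha
    obtain ⟨b, rfl⟩ := Ideal.mem_span_singleton'.1 ha
    rw [map_mul, hcF, mul_zero])
  have hG₁ : IsUnit (G₁ (pderivClass F j)) := hunit c hcg
  let G₂ : S →+* C := IsLocalization.Away.lift (pderivClass F j) hG₁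
  have hG₂ : ∀ P, G₂ (q P) = evalOther j c P := fun P =>
    IsLocalization.Away.lift_eq (pderivClass F j) hG₁ (Ideal.Quotient.mk _ P)
  let G : S →ₐ[OtherVars j] C :=
    { G₂ with
      commutes' := fun p => by
        rw [← hq p]
        exact (hG₂ (rename Subtype.val p)).trans (evalOther_rename j c p) }
  refine ⟨G, ?_⟩
  apply AlgHom.coe_ringHom_injective
  refine IsLocalization.ringHom_ext (Submonoid.powers (pderivClass F j)) ?_
  refine Ideal.Quotient.ringHom_ext (RingHom.ext fun P => ?_)
  change Ideal.Quotient.mk I (G₂ (q P)) = g (q P)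
  rw [hG₂, hmk c hcg]

theorem smooth_jacobianAway (S : Type) [CommRing S] [Algebra (CoordRing F) S]
    [Algebra (OtherVars j) S] [IsScalarTower (OtherVars j) (CoordRing F) S]
    [IsLocalization.Away (pderivClass F j) S]
    [Algebra ℂ S] [IsScalarTower ℂ (CoordRing F) S]
    [IsScalarTower ℂ (OtherVars j) S] : Algebra.Smooth (OtherVars j) S where
  formallySmooth := formallySmooth_jacobianAway F j S
  finitePresentation := by
    have h1 : Algebra.FinitePresentation ℂ (CoordRing F) :=
      Algebra.FinitePresentation.quotient ⟨{F}, by simp⟩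
    have h2 : Algebra.FinitePresentation (CoordRing F) S :=
      IsLocalization.Away.finitePresentation (pderivClass F j)
    have h3 : Algebra.FinitePresentation ℂ S :=
      Algebra.FinitePresentation.trans ℂ (CoordRing F) _
    exact Algebra.FinitePresentation.of_restrict_scalars_finitePresentation ℂ _ _

variable {F j}

/-- A nonzero polynomial without $x_j$ has degree $0$ in $x_j$; if it were a multiple of `F`, so
would `F`, against $\partial_jF\ne0$. -/
theorem rename_notMem_span (hj : pderiv j F ≠ 0) {p : OtherVars j} (hp : p ≠ 0) :
    rename Subtype.val p ∉ Ideal.span {F} := by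
  intro h
  obtain ⟨G, hG⟩ := Ideal.mem_span_singleton'.1 h
  have hp' : rename Subtype.val p ≠ (0 : MvPolynomial σ ℂ) := fun h0 =>
    hp (rename_injective _ Subtype.val_injective (h0.trans (map_zero _).symm))
  have hG0 : G ≠ 0 := fun h0 => hp' (by rw [← hG, h0, zero_mul])
  have hF0 : F ≠ 0 := fun h0 => hp' (by rw [← hG, h0, mul_zero])
  have hdeg := congrArg (degreeOf j) hG
  rw [degreeOf_mul_eq hG0 hF0] at hdeg
  have h1 : degreeOf j (rename Subtype.val p : MvPolynomial σ ℂ) = 0 := by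
    rw [degreeOf_eq_sup, ← Nat.bot_eq_zero, Finset.sup_eq_bot_iff]
    intro m hm
    rw [mem_support_iff] at hm
    obtain ⟨a, rfl, -⟩ := coeff_rename_ne_zero _ _ _ hm
    exact Finsupp.mapDomain_of_notMem_range _ _ (by rintro ⟨k, hk⟩; exact k.2 hk)
  rw [h1] at hdeg
  have h2 : degreeOf j F = 0 := by omega
  have hdeg0 : ∀ m ∈ F.support, m j = 0 := by
    rwa [degreeOf_eq_sup, ← Nat.bot_eq_zero, Finset.sup_eq_bot_iff] at h2
  refine hj (pderiv_eq_zero_of_notMem_vars fun hmem => ?_)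
  rw [mem_vars_iff_mem_support] at hmem
  obtain ⟨m, hm, hmj⟩ := hmem
  exact Finsupp.mem_support_iff.1 hmj (hdeg0 m hm)

/-- `F`, read as a polynomial in $x_j$, is an equation for the class of $x_j$. It is nonzero since
`toPoly` has the left inverse `back`. -/
theorem isAlgebraic_coordRing (hF : Prime F) : Algebra.IsAlgebraic (OtherVars j) (CoordRing F) := by
  have hdom : IsDomain (CoordRing F) :=
    (Ideal.Quotient.isDomain_iff_prime _).2 ((Ideal.span_singleton_prime hF.ne_zero).2 hF)
  let toPoly : MvPolynomial σ ℂ →+* Polynomial (OtherVars j) := evalOther j Polynomial.X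
  let back : Polynomial (OtherVars j) →+* MvPolynomial σ ℂ :=
    Polynomial.eval₂RingHom (rename (R := ℂ) (Subtype.val : {k // k ≠ j} → σ)).toRingHom (X j)
  have hback : back.comp toPoly = RingHom.id _ := by
    refine ringHom_ext_other j (fun p => ?_) ?_
    · simp only [RingHom.comp_apply, toPoly, evalOther_rename, back]
      simp
    · simp only [RingHom.comp_apply, toPoly, evalOther_X_self, back]
      simp
  have hX : IsAlgebraic (OtherVars j) (Ideal.Quotient.mk (Ideal.span {F}) (X j)) := by
    refine ⟨toPoly F, fun h0 => hF.ne_zero ?_, ?_⟩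
    · have := congrArg (fun f => f F) hback
      simp only [RingHom.comp_apply, h0, map_zero, RingHom.id_apply] at this
      exact this.symm
    · have : ((Polynomial.aeval (Ideal.Quotient.mk (Ideal.span {F}) (X j)) :
          Polynomial (OtherVars j) →ₐ[OtherVars j] CoordRing F) :
          Polynomial (OtherVars j) →+* CoordRing F).comp toPoly =
          Ideal.Quotient.mk (Ideal.span {F}) := by
        refine ringHom_ext_other j (fun p => ?_) ?_
        · simp only [RingHom.comp_apply, toPoly, evalOther_rename]
          exact Polynomial.aeval_C _ _
        · simp only [RingHom.comp_apply, toPoly, evalOther_X_self]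
          exact Polynomial.aeval_X _
      have h2 := congrArg (fun f => f F) this
      exact h2.trans (Ideal.Quotient.eq_zero_iff_mem.2 (Ideal.mem_span_singleton_self F))
  refine ⟨fun a => ?_⟩
  obtain ⟨P, rfl⟩ := Ideal.Quotient.mk_surjective a
  induction P using MvPolynomial.induction_on with
  | C z =>
    have : Ideal.Quotient.mk (Ideal.span {F}) (C z) =
        algebraMap (OtherVars j) (CoordRing F) (C z) := by
      change _ = Ideal.Quotient.mk (Ideal.span {F}) (rename Subtype.val (C z))
      rw [rename_C]
    rw [this]
    exact isAlgebraic_algebraMap _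
  | add p q hp hq => rw [map_add]; exact hp.add hq
  | mul_X p i hp =>
    rw [map_mul]
    refine hp.mul ?_
    by_cases hi : i = j
    · rwa [hi]
    · have : Ideal.Quotient.mk (Ideal.span {F}) (X i) =
          algebraMap (OtherVars j) (CoordRing F) (X ⟨i, hi⟩) := by
        change _ = Ideal.Quotient.mk (Ideal.span {F}) (rename Subtype.val (X ⟨i, hi⟩))
        rw [rename_X]
      rw [this]
      exact isAlgebraic_algebraMap _

theorem faithfulSMul_coordRing (hj : pderiv j F ≠ 0) :
    FaithfulSMul (OtherVars j) (CoordRing F) := by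
  rw [faithfulSMul_iff_algebraMap_injective, injective_iff_map_eq_zero]
  intro p hp
  by_contra h0
  exact rename_notMem_span hj h0 (Ideal.Quotient.eq_zero_iff_mem.1 hp)

/-- The coordinate ring of a prime hypersurface is normal where a partial derivative does not
vanish. -/
theorem isIntegrallyClosed_jacobianAway (hF : Prime F) (hj : pderiv j F ∉ Ideal.span {F})
    (S : Type) [CommRing S] [Algebra (CoordRing F) S] [IsLocalization.Away (pderivClass F j) S] :
    IsIntegrallyClosed S := by
  letI : Algebra (OtherVars j) S :=
    ((algebraMap (CoordRing F) S).comp (algebraMap (OtherVars j) (CoordRing F))).toAlgebra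
  letI : Algebra ℂ S := ((algebraMap (CoordRing F) S).comp (algebraMap ℂ (CoordRing F))).toAlgebra
  have : IsScalarTower (OtherVars j) (CoordRing F) S := IsScalarTower.of_algebraMap_eq fun _ => rfl
  have : IsScalarTower ℂ (CoordRing F) S := ⟨fun z a s => by
    rw [Algebra.smul_def, Algebra.smul_def, Algebra.smul_def]
    have : z • a = algebraMap ℂ (CoordRing F) z * a := Algebra.smul_def z a
    rw [this, map_mul, mul_assoc]
    rfl⟩
  have : IsScalarTower ℂ (OtherVars j) S := IsScalarTower.of_algebraMap_eq fun z => by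
    rw [IsScalarTower.algebraMap_apply (OtherVars j) (CoordRing F) S,
      ← IsScalarTower.algebraMap_apply ℂ (OtherVars j) (CoordRing F)]
    rfl
  have hdom : IsDomain (CoordRing F) :=
    (Ideal.Quotient.isDomain_iff_prime _).2 ((Ideal.span_singleton_prime hF.ne_zero).2 hF)
  have h0 : pderivClass F j ≠ 0 := fun h => hj (Ideal.Quotient.eq_zero_iff_mem.1 h)
  have hj0 : pderiv j F ≠ 0 := fun h => hj (h ▸ Ideal.zero_mem _)
  have hpow : Submonoid.powers (pderivClass F j) ≤ nonZeroDivisors (CoordRing F) :=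
    powers_le_nonZeroDivisors_of_noZeroDivisors h0
  have hdom' : IsDomain S := IsLocalization.isDomain_of_le_nonZeroDivisors _ hpow
  -- The base is the polynomial ring in the other variables, which is integrally closed; smoothness
  -- and algebraicity carry this over to `S`.
  have := smooth_jacobianAway F j S
  have := isAlgebraic_coordRing (j := j) hF
  have := faithfulSMul_coordRing hj0
  have : Algebra.IsAlgebraic (CoordRing F) S :=
    IsLocalization.isAlgebraic _ (Submonoid.powers (pderivClass F j))
  have : Algebra.IsAlgebraic (OtherVars j) S :=
    Algebra.IsAlgebraic.trans _ (CoordRing F) _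
  have : FaithfulSMul (OtherVars j) S := by
    rw [faithfulSMul_iff_algebraMap_injective,
      IsScalarTower.algebraMap_eq (OtherVars j) (CoordRing F) S]
    exact (IsLocalization.injective S hpow).comp
      (FaithfulSMul.algebraMap_injective (OtherVars j) (CoordRing F))
  exact isIntegrallyClosed_of_smooth_of_isAlgebraic (OtherVars j) _

end Normal


/-! ### Functions regular in codimension one on normal and on proper varieties. -/

section Hartogs

/-- An element of the fraction field of a normal noetherian domain is in the domain if it is so
locally at primes of height one. -/
theorem mem_range_of_forall_height_one (B K : Type) [CommRing B] [IsDomain B] [IsNoetherianRing B]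
    [IsIntegrallyClosed B] [Field K] [Algebra B K] [IsFractionRing B K] (z : K)
    (h : ∀ q : Ideal B, q.IsPrime → q.height = 1 →
      ∃ a b : B, b ∉ q ∧ z = algebraMap B K a / algebraMap B K b) :
    z ∈ (algebraMap B K).range := by
  by_contra hz
  let I : K → Ideal B := fun u =>
    { carrier := {s | algebraMap B K s * u ∈ (algebraMap B K).range}
      add_mem' := fun {a b} ha hb => by
        have := Subring.add_mem _ (show algebraMap B K a * u ∈ (algebraMap B K).range from ha)
          (show algebraMap B K b * u ∈ (algebraMap B K).range from hb)
        rwa [← add_mul, ← map_add] at this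
      zero_mem' := by simp
      smul_mem' := fun c a ha => by
        have := Subring.mul_mem _ (⟨c, rfl⟩ : algebraMap B K c ∈ (algebraMap B K).range)
          (show algebraMap B K a * u ∈ (algebraMap B K).range from ha)
        rwa [← mul_assoc, ← map_mul] at this }
  have hI : ∀ u s, s ∈ I u ↔ algebraMap B K s * u ∈ (algebraMap B K).range := fun _ _ => Iff.rfl
  -- A maximal denominator ideal among those of the multiples of `z` outside `B`. Maximality makes
  -- it prime, and the rest shows that its height is one.
  obtain ⟨p, ⟨y, hy, rfl⟩, hmax⟩ := set_has_maximal_iff_noetherian.2 ‹IsNoetherianRing B›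
    {J | ∃ y : B, algebraMap B K y * z ∉ (algebraMap B K).range ∧ J = I (algebraMap B K y * z)}
    ⟨_, 1, by rwa [map_one, one_mul], rfl⟩
  set u := algebraMap B K y * z with hu
  have hprime : (I u).IsPrime := by
    refine ⟨fun h1 => ?_, fun {a b} hab => ?_⟩
    · have : (1 : B) ∈ I u := h1 ▸ Submodule.mem_top
      rw [hI, map_one, one_mul] at this
      exact hy this
    · by_contra! hcon
      obtain ⟨ha, hb⟩ := hcon
      have hle : I u ≤ I (algebraMap B K (b * y) * z) := fun s hs => by
        rw [hI] at hs ⊢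
        have := Subring.mul_mem _ (⟨b, rfl⟩ : algebraMap B K b ∈ (algebraMap B K).range) hs
        rw [map_mul]
        convert this using 1
        rw [hu]; ring
      have hbu : algebraMap B K (b * y) * z ∉ (algebraMap B K).range := by
        rw [hI, hu, ← mul_assoc, ← map_mul] at hb
        exact hb
      have hlt := hmax _ ⟨b * y, hbu, rfl⟩
      rw [lt_iff_le_not_ge, not_and, not_not] at hlt
      refine ha (hlt hle ?_)
      rw [hI]
      rw [hI, hu] at hab
      convert hab using 1
      simp only [map_mul]; ring
  have hzI : ∀ s, algebraMap B K s * z ∈ (algebraMap B K).range → s ∈ I u := fun s hs => by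
    rw [hI]
    have := Subring.mul_mem _ (⟨y, rfl⟩ : algebraMap B K y ∈ (algebraMap B K).range) hs
    convert this using 1
    rw [hu]; ring
  have hne : I u ≠ ⊥ := by
    obtain ⟨a, b, hb, rfl⟩ := IsFractionRing.div_surjective (A := B) z
    refine (Submodule.ne_bot_iff _).2 ⟨b, hzI b ⟨a, ?_⟩, nonZeroDivisors.ne_zero hb⟩
    have : algebraMap B K b ≠ 0 := IsFractionRing.to_map_ne_zero_of_mem_nonZeroDivisors hb
    field_simp
  -- Otherwise multiplication by $u$ preserves the finitely generated ideal `I u`, so $u$ is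
  -- integral and belongs to the normal domain `B`.
  have hcase : ∃ s ∈ I u, ∃ v ∉ I u, algebraMap B K v = algebraMap B K s * u := by
    by_contra! hcon
    have hint : IsIntegral B u := by
      refine isIntegral_of_smul_mem_submodule (M := K)
        (Submodule.map (Algebra.linearMap B K) (I u)) ?_ ?_ u ?_
      · rw [Submodule.ne_bot_iff] at hne ⊢
        obtain ⟨s, hs, hs0⟩ := hne
        exact ⟨_, ⟨s, hs, rfl⟩, (FaithfulSMul.algebraMap_eq_zero_iff B K).not.2 hs0⟩
      · exact Submodule.FG.map _ ((isNoetherianRing_iff_ideal_fg B).1 ‹_› _)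
      · rintro _ ⟨s, hs, rfl⟩
        obtain ⟨v, hv⟩ := (hI u s).1 hs
        refine ⟨v, ?_, ?_⟩
        · by_contra hvp
          exact hcon s hs v hvp hv
        · rw [Algebra.linearMap_apply, Algebra.linearMap_apply, hv, smul_eq_mul, mul_comm]
    obtain ⟨b, hb⟩ := (isIntegrallyClosed_iff K).1 ‹_› hint
    exact hy ⟨b, hb⟩
  obtain ⟨s, hs, v, hv, hvs⟩ := hcase
  -- For $t\in I(u)$ one has $tv=s\,(tu)$ with $tu\in B$, so a prime between $(s)$ and $I(u)$
  -- contains $tv$ but not $v$. Krull's theorem then bounds the height by one.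
  have hmin : I u ∈ (Ideal.span {s}).minimalPrimes := by
    refine ⟨⟨hprime, (Ideal.span_singleton_le_iff_mem _).2 hs⟩, fun q hq hqp t ht => ?_⟩
    obtain ⟨t', ht'⟩ := (hI u t).1 ht
    have h1 : t * v = s * t' := by
      apply IsFractionRing.injective B K
      rw [map_mul, map_mul, hvs, ht']; ring
    have h2 : t * v ∈ q := by
      rw [h1]
      exact q.mul_mem_right _ (hq.2 (Ideal.mem_span_singleton_self s))
    exact (hq.1.mem_or_mem h2).resolve_right fun h => hv (hqp h)
  have hht : (I u).height = 1 := by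
    refine le_antisymm (Ideal.height_le_one_of_isPrincipal_of_mem_minimalPrimes _ _ hmin) ?_
    rw [Order.one_le_iff_ne_zero, Ne, Ideal.height_eq_zero_iff_eq_bot]
    exact hne
  obtain ⟨a, b, hb, hz'⟩ := h _ hprime hht
  refine hb (hzI b ⟨a, ?_⟩)
  have : algebraMap B K b ≠ 0 := by
    rw [Ne, FaithfulSMul.algebraMap_eq_zero_iff]
    exact fun h0 => hb (h0 ▸ Ideal.zero_mem _)
  rw [hz']
  field_simp

variable {X : Scheme.{0}} [IsIntegral X]

/-- On an affine neighbourhood the sections form a normal noetherian domain whose height one primes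
are points of codimension one of `X`, so the algebraic statement applies. -/
theorem mem_localSubring_of_forall_codim_one [IsLocallyNoetherian X]
    (hn : ∀ x : X, IsIntegrallyClosed (X.presheaf.stalk x)) {z : X.functionField}
    (hz : ∀ x : X, ringKrullDim (X.presheaf.stalk x) = 1 → z ∈ localSubring x) (x : X) :
    ∃ (U : X.Opens) (hη : genericPoint X ∈ U), x ∈ U ∧
      ∃ s : Γ(X, U), X.presheaf.germ U _ hη s = z := by
  obtain ⟨_, ⟨U, hU, rfl⟩, hxU, -⟩ :=
    X.isBasis_affineOpens.exists_subset_of_mem_open (Set.mem_univ x) isOpen_univ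
  have hne : Nonempty U := ⟨⟨x, hxU⟩⟩
  have hη : genericPoint X ∈ U := ((genericPoint_spec X).mem_open_set_iff U.isOpen).2
    (by simpa using hne)
  refine ⟨U, hη, hxU, ?_⟩
  have hnoeth : IsNoetherianRing Γ(X, U) := IsLocallyNoetherian.component_noetherian ⟨U, hU⟩
  have hfrac := functionField_isFractionRing_of_isAffineOpen X U hU
  have hloc : ∀ q : PrimeSpectrum Γ(X, U), ∃ y : U,
      letI := TopCat.Presheaf.algebra_section_stalk X.presheaf y
      IsLocalization.AtPrime (X.presheaf.stalk y.1) q.asIdeal := fun q => by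
    have hq : hU.fromSpec q ∈ U := by
      have h1 : hU.fromSpec q ∈ Set.range hU.fromSpec := Set.mem_range_self q
      rwa [hU.range_fromSpec] at h1
    exact ⟨⟨hU.fromSpec q, hq⟩, hU.isLocalization_stalk' q hq⟩
  have hfracOf : ∀ (q : PrimeSpectrum Γ(X, U)) (y : U),
      letI := TopCat.Presheaf.algebra_section_stalk X.presheaf y
      IsLocalization.AtPrime (X.presheaf.stalk y.1) q.asIdeal → ∀ t ∈ localSubring y.1,
      ∃ a b : Γ(X, U), b ∉ q.asIdeal ∧ t = algebraMap _ X.functionField a /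
        algebraMap _ X.functionField b := by
    rintro q y hy _ ⟨t, rfl⟩
    let := TopCat.Presheaf.algebra_section_stalk X.presheaf y
    have := functionField_isScalarTower X U y
    obtain ⟨⟨a, b⟩, hab⟩ := IsLocalization.surj q.asIdeal.primeCompl t
    refine ⟨a, b, b.2, ?_⟩
    have h0 : algebraMap Γ(X, U) X.functionField b ≠ 0 := by
      rw [Ne, FaithfulSMul.algebraMap_eq_zero_iff]
      exact fun h0 => b.2 (h0 ▸ Ideal.zero_mem _)
    rw [eq_div_iff h0, IsScalarTower.algebraMap_apply Γ(X, U) (X.presheaf.stalk y.1) _ a,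
      IsScalarTower.algebraMap_apply Γ(X, U) (X.presheaf.stalk y.1) _ b, ← map_mul, ← hab]
  have hnormal : IsIntegrallyClosed Γ(X, U) := by
    refine IsIntegrallyClosed.of_localization_maximal fun p _ hp => ?_
    obtain ⟨y, hy⟩ := hloc ⟨p, hp.isPrime⟩
    let := TopCat.Presheaf.algebra_section_stalk X.presheaf y
    have := hn y.1
    have : IsLocalization.AtPrime (X.presheaf.stalk y.1) p := hy
    exact IsIntegrallyClosed.of_equiv
      (IsLocalization.algEquiv p.primeCompl (X.presheaf.stalk y.1)
        (Localization.AtPrime p)).toRingEquiv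
  obtain ⟨s, hs⟩ := mem_range_of_forall_height_one Γ(X, U) X.functionField z fun q hq hht => by
    obtain ⟨y, hy⟩ := hloc ⟨q, hq⟩
    refine hfracOf ⟨q, hq⟩ y hy z (hz y.1 ?_)
    let := TopCat.Presheaf.algebra_section_stalk X.presheaf y
    have : IsLocalization.AtPrime (X.presheaf.stalk y.1) q := hy
    rw [IsLocalization.AtPrime.ringKrullDim_eq_height q, hht]
    rfl
  exact ⟨s, hs⟩

/-- A rational function which is locally regular on a universally closed complex variety is
constant. -/
theorem exists_algebraMap_eq_of_isProper (s : X ⟶ Spec (CommRingCat.of ℂ)) [UniversallyClosed s]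
    {z : X.functionField} (hz : ∀ x : X, ∃ (U : X.Opens) (hη : genericPoint X ∈ U), x ∈ U ∧
      ∃ t : Γ(X, U), X.presheaf.germ U _ hη t = z) :
    letI := functionFieldAlgebra s
    ∃ a : ℂ, algebraMap ℂ X.functionField a = z := by
  choose U hη hx t ht using hz
  have hcover : (⊤ : X.Opens) ≤ iSup U := fun x _ => TopologicalSpace.Opens.mem_iSup.2 ⟨x, hx x⟩
  obtain ⟨g, hg, -⟩ := X.sheaf.existsUnique_gluing' U ⊤ (fun x => homOfLE le_top) hcover t
    (by
      intro x y
      have hxy : genericPoint X ∈ U x ⊓ U y := ⟨hη x, hη y⟩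
      apply germ_injective_of_isIntegral X (U := U x ⊓ U y) (genericPoint X) hxy
      have h1 := X.presheaf.germ_res_apply (TopologicalSpace.Opens.infLELeft (U x) (U y))
        (genericPoint X) hxy (t x)
      have h2 := X.presheaf.germ_res_apply (TopologicalSpace.Opens.infLERight (U x) (U y))
        (genericPoint X) hxy (t y)
      exact h1.trans (((ht x).trans (ht y).symm).trans h2.symm))
  letI := functionFieldAlgebra s
  let germ : Γ(X, ⊤) →+* X.functionField := (X.presheaf.germ ⊤ (genericPoint X) trivial).hom
  have hgz : germ (show Γ(X, ⊤) from g) = z := by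
    have x := genericPoint X
    rw [← ht x, ← hg x]
    exact (X.presheaf.germ_res_apply (homOfLE (le_top : U x ≤ ⊤)) (genericPoint X) (hη x) g).symm
  have hint : IsIntegral ℂ z := by
    -- Global sections are integral over $\mathbb C$ by universal closedness, hence constant because
    -- $\mathbb C$ is algebraically closed.
    have h1 := isIntegral_appTop_of_universallyClosed s (show Γ(X, ⊤) from g)
    obtain ⟨P, hP, hPg⟩ := h1
    let φ : Γ(Spec (CommRingCat.of ℂ), ⊤) →+* ℂ := (Scheme.ΓSpecIso (CommRingCat.of ℂ)).hom.hom
    refine ⟨P.map φ, hP.map φ, ?_⟩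
    rw [Polynomial.eval₂_map, ← hgz]
    have : (algebraMap ℂ X.functionField).comp φ = germ.comp s.appTop.hom := by
      ext a
      change germ (s.appTop.hom ((Scheme.ΓSpecIso (CommRingCat.of ℂ)).inv.hom
        ((Scheme.ΓSpecIso (CommRingCat.of ℂ)).hom.hom a))) = germ (s.appTop.hom a)
      rw [Iso.hom_inv_id_apply]
    rw [this, ← Polynomial.hom_eval₂, hPg, map_zero]
  exact minpoly.mem_range_of_degree_eq_one ℂ z
    (IsAlgClosed.degree_eq_one_of_irreducible ℂ (minpoly.irreducible hint))

end Hartogs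


/-! ### Constants, local rings and normality of `Proj` in terms of fractions. -/

section ProjFractions

open ProjectiveSpectrum HomogeneousLocalization

variable {A : Type} [CommRing A] [Algebra ℂ A] (𝒜 : ℕ → Submodule ℂ A) [GradedAlgebra 𝒜]

/-- Needed to identify the $\mathbb C$-algebra structure coming from the structure morphism with the
constants of the fraction field. -/
theorem toSpecZero_appTop :
    (Scheme.ΓSpecIso (CommRingCat.of (𝒜 0))).inv ≫ (Proj.toSpecZero 𝒜).appTop =
      CommRingCat.ofHom (fromZeroRingHom 𝒜 _) ≫ AlgebraicGeometry.Proj.awayToSection 𝒜 1 ≫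
        (Proj 𝒜).presheaf.map (eqToHom (Proj.basicOpen_one 𝒜).symm).op := by
  rw [Proj.toSpecZero, Scheme.Hom.comp_appTop, Scheme.Hom.comp_appTop, Scheme.Hom.comp_appTop,
    ← Category.assoc, ← Category.assoc, ← Category.assoc, ← Scheme.ΓSpecIso_inv_naturality,
    Category.assoc, Category.assoc, Category.assoc]
  congr 1
  have := Proj.basicOpenToSpec_app_top 𝒜 1
  change (Proj.basicOpenToSpec 𝒜 1).appTop = _ at this
  rw [this, Category.assoc, Iso.inv_hom_id_assoc, Category.assoc]
  congr 1
  set φ := (Proj 𝒜).topIso.inv ≫ ((Proj 𝒜).isoOfEq (Proj.basicOpen_one 𝒜)).inv with hφ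
  have hφι : φ ≫ (Proj.basicOpen 𝒜 1).ι = 𝟙 _ := by simp [hφ]
  have h1 := congrArg Scheme.Hom.appTop hφι
  rw [Scheme.Hom.comp_appTop, Scheme.Opens.ι_appTop, Scheme.Hom.id_appTop, hφ,
    Scheme.Hom.comp_appTop] at h1
  rw [← Category.comp_id ((Proj 𝒜).presheaf.map (eqToHom (Proj.basicOpen_one 𝒜).symm).op), ← h1]
  have h2 : (Proj 𝒜).presheaf.map (eqToHom (Proj.basicOpen_one 𝒜).symm).op ≫
      (Proj 𝒜).presheaf.map (homOfLE (le_top : (Proj.basicOpen 𝒜 1).ι ''ᵁ ⊤ ≤ ⊤)).op =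
      (Proj.basicOpen 𝒜 1).topIso.inv := by
    rw [← Functor.map_comp]
    rfl
  rw [← h2]
  exact Category.assoc _ _ _

variable [IsDomain A]

theorem stalkToFrac_germ_constant (x : Proj 𝒜) (z : ℂ) :
    stalkToFrac 𝒜 x ((Proj 𝒜).presheaf.germ ⊤ x trivial ((Proj.toSpecZero 𝒜 ≫
      Spec.map (CommRingCat.ofHom (algebraMap ℂ (𝒜 0)))).appTop.hom
      ((Scheme.ΓSpecIso (CommRingCat.of ℂ)).inv.hom z))) = algebraMap ℂ (FractionRing A) z := by
  have h1 := ConcreteCategory.congr_hom (toSpecZero_appTop 𝒜) (algebraMap ℂ (𝒜 0) z)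
  have h2 : (Proj.toSpecZero 𝒜 ≫
      Spec.map (CommRingCat.ofHom (algebraMap ℂ (𝒜 0)))).appTop.hom ((Scheme.ΓSpecIso (CommRingCat.of ℂ)).inv.hom z) =
      (Proj.toSpecZero 𝒜).appTop.hom ((Scheme.ΓSpecIso (CommRingCat.of (𝒜 0))).inv.hom
        (algebraMap ℂ (𝒜 0) z)) := by
    rw [Scheme.Hom.comp_appTop]
    have := ConcreteCategory.congr_hom
      (Scheme.ΓSpecIso_inv_naturality (CommRingCat.ofHom (algebraMap ℂ (𝒜 0)))) z
    exact congrArg (Proj.toSpecZero 𝒜).appTop.hom this.symm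
  have h3 : (Proj.toSpecZero 𝒜).appTop.hom ((Scheme.ΓSpecIso (CommRingCat.of (𝒜 0))).inv.hom
      (algebraMap ℂ (𝒜 0) z)) =
      (Proj 𝒜).presheaf.map (eqToHom (Proj.basicOpen_one 𝒜).symm).op
        ((AlgebraicGeometry.Proj.awayToSection 𝒜 1).hom
          (fromZeroRingHom 𝒜 _ (algebraMap ℂ (𝒜 0) z))) := h1
  have hx : x ∈ Proj.basicOpen 𝒜 1 := by
    rw [Proj.basicOpen_one]
    trivial
  have h4 := (Proj 𝒜).presheaf.germ_res_apply (eqToHom (Proj.basicOpen_one 𝒜).symm) x trivial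
    ((AlgebraicGeometry.Proj.awayToSection 𝒜 1).hom
      (fromZeroRingHom 𝒜 _ (algebraMap ℂ (𝒜 0) z)))
  rw [h2, h3]
  refine (congrArg (stalkToFrac 𝒜 x) h4).trans ?_
  refine (stalkToFrac_germ_awayToSection 𝒜 x hx _).trans ?_
  change algebraMap A _ (algebraMap ℂ A z) / algebraMap A _ 1 = _
  rw [map_one, div_one, ← IsScalarTower.algebraMap_apply]

/-- The localization of a domain at a prime, inside the fraction field. -/
def fracAt (p : Ideal A) [hp : p.IsPrime] : Subring (FractionRing A) where
  carrier := {z | ∃ a b : A, b ∉ p ∧ z = algebraMap A _ a / algebraMap A _ b}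
  mul_mem' := by
    rintro _ _ ⟨a, b, hb, rfl⟩ ⟨a', b', hb', rfl⟩
    exact ⟨a * a', b * b', fun h => (hp.mem_or_mem h).elim hb hb', by
      rw [map_mul, map_mul, div_mul_div_comm]⟩
  one_mem' := ⟨1, 1, hp.one_notMem, by simp⟩
  add_mem' := by
    rintro _ _ ⟨a, b, hb, rfl⟩ ⟨a', b', hb', rfl⟩
    refine ⟨a * b' + b * a', b * b', fun h => (hp.mem_or_mem h).elim hb hb', ?_⟩
    have h0 : ∀ c ∉ p, algebraMap A (FractionRing A) c ≠ 0 := fun c hc h =>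
      hc (((FaithfulSMul.algebraMap_eq_zero_iff A (FractionRing A)).1 h) ▸ p.zero_mem)
    rw [div_add_div _ _ (h0 b hb) (h0 b' hb')]
    simp
  zero_mem' := ⟨0, 1, hp.one_notMem, by simp⟩
  neg_mem' := by
    rintro _ ⟨a, b, hb, rfl⟩
    exact ⟨-a, b, hb, by rw [map_neg, neg_div]⟩

theorem algebraMap_mem_fracAt (p : Ideal A) [hp : p.IsPrime] (a : A) :
    algebraMap A (FractionRing A) a ∈ fracAt p := ⟨a, 1, hp.one_notMem, by simp⟩

theorem inv_algebraMap_mem_fracAt {p : Ideal A} [p.IsPrime] {b : A} (hb : b ∉ p) :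
    (algebraMap A (FractionRing A) b)⁻¹ ∈ fracAt p := ⟨1, b, hb, by simp⟩

variable [IsIntegral (Proj 𝒜)]

theorem functionFieldToFrac_algebraMap_complex (z : ℂ) :
    letI := functionFieldAlgebra (Proj.toSpecZero 𝒜 ≫
      Spec.map (CommRingCat.ofHom (algebraMap ℂ (𝒜 0))))
    functionFieldToFrac 𝒜 (algebraMap ℂ (Proj 𝒜).functionField z) =
      algebraMap ℂ (FractionRing A) z :=
  stalkToFrac_germ_constant 𝒜 _ z

-- If $z=a/b$ with $b\notin p$, some homogeneous component $b_i$ is outside the homogeneous ideal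
-- $p$. Comparing components in the cross-multiplied identity with a degree-zero representation of
-- $z$ gives $z=a_i/b_i$. Local rings of `Proj` can thus be tested with inhomogeneous denominators.
variable {𝒜} in
theorem mem_localSubring_iff_mem_fracAt (x : Proj 𝒜) (z : (Proj 𝒜).functionField) :
    z ∈ localSubring x ↔ functionFieldToFrac 𝒜 z ∈ fracAt x.asHomogeneousIdeal.toIdeal := by
  rw [mem_localSubring_iff]
  constructor
  · rintro ⟨n, a, b, -, -, hb, h⟩
    exact ⟨a, b, hb, h⟩
  rintro ⟨a, b, hb, h⟩
  obtain ⟨n, a', b', ha', hb', hb0, h'⟩ := (stalkToFrac_range 𝒜 (genericPoint (Proj 𝒜)) _).1 ⟨z, rfl⟩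
  obtain ⟨i, hi⟩ : ∃ i, GradedRing.proj 𝒜 i b ∉ x.asHomogeneousIdeal.toIdeal := by
    by_contra! hcon
    exact hb ((Ideal.IsHomogeneous.mem_iff 𝒜 x.asHomogeneousIdeal.isHomogeneous).2 hcon)
  have h0 : ∀ c : A, c ≠ 0 → algebraMap A (FractionRing A) c ≠ 0 := fun c hc h =>
    hc ((FaithfulSMul.algebraMap_eq_zero_iff A (FractionRing A)).1 h)
  have hbne : b ≠ 0 := fun h => hb (h ▸ Ideal.zero_mem _)
  have hb'ne : b' ≠ 0 := fun h => hb0 (h ▸ Submodule.zero_mem _)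
  have hcross : a * b' = a' * b := by
    have h1 : algebraMap A (FractionRing A) a / algebraMap A _ b =
      algebraMap A _ a' / algebraMap A _ b' := h.symm.trans h'
    rw [div_eq_div_iff (h0 b hbne) (h0 b' hb'ne), ← map_mul, ← map_mul] at h1
    exact IsFractionRing.injective A (FractionRing A) h1
  have hcross' : GradedRing.proj 𝒜 i a * b' = a' * GradedRing.proj 𝒜 i b := by
    have h1 := congrArg (fun t => (DirectSum.decompose 𝒜 t (i + n) : A)) hcross
    simp only at h1
    rw [DirectSum.coe_decompose_mul_add_of_right_mem 𝒜 hb', mul_comm a' b,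
      DirectSum.coe_decompose_mul_add_of_right_mem 𝒜 ha'] at h1
    rw [mul_comm a']
    exact h1
  have hine : GradedRing.proj 𝒜 i b ≠ 0 := fun h => hi (h ▸ Ideal.zero_mem _)
  refine ⟨i, GradedRing.proj 𝒜 i a, GradedRing.proj 𝒜 i b, SetLike.coe_mem _, SetLike.coe_mem _,
    hi, ?_⟩
  refine h'.trans ?_
  rw [div_eq_div_iff (h0 b' hb'ne) (h0 _ hine), ← map_mul, ← map_mul, hcross']

-- A denominator $s\notin p$ makes $sz$ integral over $A$, hence an element of the normal ring
-- $A_f$. So $z$ has a denominator $f^ns\notin p$.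
variable {𝒜} in
theorem isIntegrallyClosed_stalk (x : Proj 𝒜) {f : A} (hf : f ∉ x.asHomogeneousIdeal.toIdeal)
    (hcl : IsIntegrallyClosed (Localization.Away f)) :
    IsIntegrallyClosed ((Proj 𝒜).presheaf.stalk x) := by
  set p := x.asHomogeneousIdeal.toIdeal with hp
  rw [isIntegrallyClosed_iff (Proj 𝒜).functionField]
  intro z hz
  let alg₁ : Algebra (Localization p.primeCompl) (FractionRing A) :=
    (IsLocalization.map (FractionRing A) (RingHom.id A)
      (show p.primeCompl ≤ (nonZeroDivisors A).comap (RingHom.id A) from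
        fun _ ha => mem_nonZeroDivisors_of_ne_zero fun h => ha (h ▸ p.zero_mem)) :
      Localization p.primeCompl →+* FractionRing A).toAlgebra
  have tow₁ : IsScalarTower A (Localization p.primeCompl) (FractionRing A) :=
    IsScalarTower.of_algebraMap_eq fun a => by
      rw [RingHom.algebraMap_toAlgebra, IsLocalization.map_eq]
      rfl
  have hint : _root_.IsIntegral (Localization p.primeCompl) (functionFieldToFrac 𝒜 z) := by
    let φ : (Proj 𝒜).presheaf.stalk x →+* Localization p.primeCompl :=
      (algebraMap (HomogeneousLocalization.AtPrime 𝒜 p) (Localization p.primeCompl)).comp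
        (Proj.stalkIso' 𝒜 x).toRingHom
    refine IsIntegral.map_of_comp_eq (R := (Proj 𝒜).presheaf.stalk x) φ
      (functionFieldToFrac 𝒜) ?_ hz
    refine RingHom.ext fun t => ?_
    exact (functionFieldToFrac_algebraMap 𝒜 x t).symm
  obtain ⟨⟨s, hs⟩, hsz⟩ :=
    IsIntegral.exists_multiple_integral_of_isLocalization p.primeCompl _ hint
  have hf0 : f ≠ 0 := fun h => hf (h ▸ p.zero_mem)
  have hpow : Submonoid.powers f ≤ nonZeroDivisors A :=
    powers_le_nonZeroDivisors_of_noZeroDivisors hf0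
  let alg₂ : Algebra (Localization.Away f) (FractionRing A) :=
    (IsLocalization.map (FractionRing A) (RingHom.id A)
      (show Submonoid.powers f ≤ (nonZeroDivisors A).comap (RingHom.id A) from hpow) :
      Localization.Away f →+* FractionRing A).toAlgebra
  have tow₂ : IsScalarTower A (Localization.Away f) (FractionRing A) :=
    IsScalarTower.of_algebraMap_eq fun a => by
      rw [RingHom.algebraMap_toAlgebra, IsLocalization.map_eq]
      rfl
  have hfr : IsFractionRing (Localization.Away f) (FractionRing A) :=
    IsFractionRing.isFractionRing_of_isDomain_of_isLocalization (Submonoid.powers f)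
      (Localization.Away f) (FractionRing A)
  have hint₂ : _root_.IsIntegral (Localization.Away f) ((⟨s, hs⟩ : p.primeCompl) •
      functionFieldToFrac 𝒜 z) := hsz.tower_top
  obtain ⟨t, ht⟩ := (isIntegrallyClosed_iff (FractionRing A)).1 hcl hint₂
  obtain ⟨⟨a, ⟨_, n, rfl⟩⟩, hat⟩ := IsLocalization.surj (Submonoid.powers f) t
  have hloc : z ∈ localSubring x := by
    rw [mem_localSubring_iff_mem_fracAt]
    have hsf : f ^ n * s ∉ p := fun h => (Ideal.IsPrime.mem_or_mem inferInstance h).elim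
      (fun h => hf (Ideal.IsPrime.mem_of_pow_mem inferInstance _ h)) hs
    refine ⟨a, f ^ n * s, hsf, ?_⟩
    have h0 : algebraMap A (FractionRing A) (f ^ n * s) ≠ 0 := fun h =>
      hsf (((FaithfulSMul.algebraMap_eq_zero_iff A (FractionRing A)).1 h) ▸ p.zero_mem)
    rw [eq_div_iff h0]
    have h1 := congrArg (algebraMap (Localization.Away f) (FractionRing A)) hat
    rw [map_mul, ← IsScalarTower.algebraMap_apply, ← IsScalarTower.algebraMap_apply, ht,
      Submonoid.smul_def, Algebra.smul_def] at h1
    rw [← h1, map_mul]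
    ring
  exact hloc

end ProjFractions


/-! ### Differentials and transcendence degree. -/

section Dimension

open Cardinal

variable (K : Type) [Field K] [Algebra ℂ K]

/-- A polynomial ring on a transcendence basis maps formally étale to `K`: localization, followed by
an algebraic extension that is separable in characteristic zero. So its basis of differentials
becomes a basis of $\Omega_K$. -/
theorem rank_kaehlerDifferential : Module.rank K (Ω[K⁄ℂ]) = Algebra.trdeg ℂ K := by
  obtain ⟨ι, x, hx⟩ := exists_isTranscendenceBasis' ℂ K
  rw [← hx.cardinalMk_eq_trdeg]
  let alg : Algebra (MvPolynomial ι ℂ) K := (aeval x).toRingHom.toAlgebra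
  have tow : IsScalarTower ℂ (MvPolynomial ι ℂ) K :=
    IsScalarTower.of_algebraMap_eq fun z => ((aeval x).commutes z).symm
  have hinj : Function.Injective (algebraMap (MvPolynomial ι ℂ) K) := hx.1
  have : FaithfulSMul (MvPolynomial ι ℂ) K := (faithfulSMul_iff_algebraMap_injective _ _).2 hinj
  have halg : Algebra.IsAlgebraic (MvPolynomial ι ℂ) K := by
    have h := hx.isAlgebraic
    refine Algebra.IsAlgebraic.ringHom_of_comp_eq
      hx.1.aevalEquiv.symm
      (RingHom.id K) hx.1.aevalEquiv.symm.injective Function.surjective_id ?_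
    refine RingHom.ext fun a => ?_
    obtain ⟨p, rfl⟩ := hx.1.aevalEquiv.surjective a
    have h1 := hx.1.algebraMap_aevalEquiv p
    change algebraMap (MvPolynomial ι ℂ) K (hx.1.aevalEquiv.symm (hx.1.aevalEquiv p)) =
      algebraMap (Algebra.adjoin ℂ (Set.range x)) K (hx.1.aevalEquiv p)
    rw [AlgEquiv.symm_apply_apply, h1]
    rfl
  let alg' : Algebra (FractionRing (MvPolynomial ι ℂ)) K := FractionRing.liftAlgebra _ K
  have tow' : IsScalarTower (MvPolynomial ι ℂ) (FractionRing (MvPolynomial ι ℂ)) K :=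
    FractionRing.isScalarTower_liftAlgebra _ K
  have halg' : Algebra.IsAlgebraic (FractionRing (MvPolynomial ι ℂ)) K :=
    (IsFractionRing.comap_isAlgebraic_iff (A := MvPolynomial ι ℂ)).1 halg
  have h1 : Algebra.FormallyEtale (MvPolynomial ι ℂ) (FractionRing (MvPolynomial ι ℂ)) :=
    Algebra.FormallyEtale.of_isLocalization (nonZeroDivisors _)
  have h2 : Algebra.FormallyEtale (FractionRing (MvPolynomial ι ℂ)) K :=
    Algebra.FormallyEtale.of_isSeparable _ _
  have h3 : Algebra.FormallyEtale (MvPolynomial ι ℂ) K :=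
    Algebra.FormallyEtale.comp _ (FractionRing (MvPolynomial ι ℂ)) _
  have b := ((KaehlerDifferential.mvPolynomialBasis ℂ ι).baseChange K).map
    (KaehlerDifferential.tensorKaehlerEquivOfFormallyEtale ℂ (MvPolynomial ι ℂ) K)
  exact b.mk_eq_rank''.symm

end Dimension

/-! ### Fractions on the affine cone, and coordinates relative to a function of degree one. -/

section ConeModel

open Cardinal

variable {σ : Type} [Fintype σ] [DecidableEq σ] {w : σ → ℕ} {F : MvPolynomial σ ℂ} {d : ℕ}
  {K L : Type} [Field K] [Algebra ℂ K] [Field L] [Algebra ℂ L] {ξ : σ → L} {ψ : K →ₐ[ℂ] L}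

/-- `L` is the function field of the affine cone `{F = 0}`, with coordinate functions `ξ`, and
`ψ` identifies `K` with the subfield of fractions of degree `0`. -/
structure IsConeModel (w : σ → ℕ) (F : MvPolynomial σ ℂ) (ξ : σ → L) (ψ : K →ₐ[ℂ] L) : Prop where
  aeval_eq_zero : ∀ P : MvPolynomial σ ℂ, aeval ξ P = 0 ↔ F ∣ P
  exists_fraction : ∀ z : L, ∃ P Q : MvPolynomial σ ℂ, aeval ξ Q ≠ 0 ∧ z = aeval ξ P / aeval ξ Q
  mem_range : ∀ z : L, z ∈ Set.range ψ ↔ ∃ (n : ℕ) (P Q : MvPolynomial σ ℂ),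
    IsWeightedHomogeneous w P n ∧ IsWeightedHomogeneous w Q n ∧ aeval ξ Q ≠ 0 ∧
      z = aeval ξ P / aeval ξ Q

/-- The fractions of degree `n` of the affine cone. -/
def IsHomFrac (w : σ → ℕ) (ξ : σ → L) (n : ℤ) (z : L) : Prop :=
  ∃ (i j : ℕ) (P Q : MvPolynomial σ ℂ), IsWeightedHomogeneous w P i ∧
    IsWeightedHomogeneous w Q j ∧ aeval ξ Q ≠ 0 ∧ (i : ℤ) = j + n ∧ z = aeval ξ P / aeval ξ Q

theorem isHomFrac_aeval {P : MvPolynomial σ ℂ} {n : ℕ} (hP : IsWeightedHomogeneous w P n) :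
    IsHomFrac w ξ n (aeval ξ P) :=
  ⟨n, 0, P, 1, hP, isWeightedHomogeneous_one ℂ w, by simp, by simp, by simp⟩

theorem isHomFrac_apply (ξ : σ → L) (k : σ) : IsHomFrac w ξ (w k) (ξ k) := by
  simpa using isHomFrac_aeval (ξ := ξ) (isWeightedHomogeneous_X ℂ w k)

theorem IsHomFrac.mul {m n : ℤ} {y z : L} (hy : IsHomFrac w ξ m y) (hz : IsHomFrac w ξ n z) :
    IsHomFrac w ξ (m + n) (y * z) := by
  obtain ⟨i, j, P, Q, hP, hQ, hQ0, h, rfl⟩ := hy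
  obtain ⟨i', j', P', Q', hP', hQ', hQ0', h', rfl⟩ := hz
  exact ⟨i + i', j + j', P * P', Q * Q', hP.mul hP', hQ.mul hQ', by
    rw [map_mul]; exact mul_ne_zero hQ0 hQ0', by push_cast; linarith, by
    rw [map_mul, map_mul, div_mul_div_comm]⟩

theorem IsHomFrac.inv {m : ℤ} {y : L} (hy : IsHomFrac w ξ m y) (h0 : y ≠ 0) :
    IsHomFrac w ξ (-m) y⁻¹ := by
  obtain ⟨i, j, P, Q, hP, hQ, hQ0, h, rfl⟩ := hy
  exact ⟨j, i, Q, P, hQ, hP, fun h1 => h0 (by rw [h1, zero_div]), by linarith, by rw [inv_div]⟩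

theorem isHomFrac_one (ξ : σ → L) : IsHomFrac w ξ 0 (1 : L) := by
  simpa using isHomFrac_aeval (ξ := ξ) (isWeightedHomogeneous_one ℂ w)

theorem IsHomFrac.pow {m : ℤ} {y : L} (hy : IsHomFrac w ξ m y) (n : ℕ) :
    IsHomFrac w ξ (n * m) (y ^ n) := by
  induction n with
  | zero => simpa using isHomFrac_one ξ
  | succ n ih =>
    rw [pow_succ]
    convert ih.mul hy using 1
    push_cast
    ring

theorem IsHomFrac.zpow {m : ℤ} {y : L} (hy : IsHomFrac w ξ m y) (h0 : y ≠ 0) (n : ℤ) :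
    IsHomFrac w ξ (n * m) (y ^ n) := by
  obtain ⟨n, rfl | rfl⟩ := n.eq_nat_or_neg
  · simpa using hy.pow n
  · rw [zpow_neg, zpow_natCast, neg_mul]
    exact (hy.pow n).inv (pow_ne_zero n h0)

theorem IsHomFrac.prod {ι : Type} (s : Finset ι) {m : ι → ℤ} {y : ι → L}
    (hy : ∀ i ∈ s, IsHomFrac w ξ (m i) (y i)) : IsHomFrac w ξ (∑ i ∈ s, m i) (∏ i ∈ s, y i) := by
  classical
  induction s using Finset.induction_on with
  | empty => simpa using isHomFrac_one ξ
  | insert a s ha ih =>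
    rw [Finset.sum_insert ha, Finset.prod_insert ha]
    exact (hy a (Finset.mem_insert_self a s)).mul
      (ih fun i hi => hy i (Finset.mem_insert_of_mem hi))

/-- The Laurent monomial `∏ ξ_k ^ a_k` has degree `∑ a_k w_k`. -/
theorem isHomFrac_laurent (hξ : ∀ k, ξ k ≠ 0) (a : σ → ℤ) :
    IsHomFrac w ξ (∑ k, a k * w k) (∏ k, ξ k ^ a k) :=
  IsHomFrac.prod _ fun k _ => (isHomFrac_apply ξ k).zpow (hξ k) (a k)

theorem IsConeModel.exists_of_isHomFrac (hM : IsConeModel w F ξ ψ) {z : L}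
    (hz : IsHomFrac w ξ 0 z) : ∃ y, ψ y = z := by
  obtain ⟨i, j, P, Q, hP, hQ, hQ0, h, rfl⟩ := hz
  obtain rfl : i = j := by omega
  exact (hM.mem_range _).2 ⟨i, P, Q, hP, hQ, hQ0, rfl⟩

/-- Affine coordinates of the points of the cone with respect to a function `t` of degree one. -/
theorem IsConeModel.exists_coord (hM : IsConeModel w F ξ ψ) {t : L} (ht : IsHomFrac w ξ 1 t)
    (ht0 : t ≠ 0) : ∃ c : σ → K, ∀ k, ξ k = t ^ w k * ψ (c k) := by
  have : ∀ k, ∃ c : K, ψ c = (t ^ w k)⁻¹ * ξ k := fun k => hM.exists_of_isHomFrac (by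
    have := ((ht.pow (w k)).inv (pow_ne_zero _ ht0)).mul (isHomFrac_apply ξ k)
    simpa using this)
  choose c hc using this
  exact ⟨c, fun k => by rw [hc, mul_inv_cancel_left₀ (pow_ne_zero _ ht0)]⟩

variable {t : L} {c : σ → K}

theorem aeval_eq_pow_mul (hc : ∀ k, ξ k = t ^ w k * ψ (c k)) {P : MvPolynomial σ ℂ} {n : ℕ}
    (hP : IsWeightedHomogeneous w P n) : aeval ξ P = t ^ n * ψ (aeval c P) := by
  rw [funext hc, aeval_pow_mul hP, comp_aeval_apply]

theorem IsConeModel.aeval_coord_eq_zero (hM : IsConeModel w F ξ ψ) (ht0 : t ≠ 0)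
    (hc : ∀ k, ξ k = t ^ w k * ψ (c k)) {P : MvPolynomial σ ℂ} {n : ℕ}
    (hP : IsWeightedHomogeneous w P n) : aeval c P = 0 ↔ F ∣ P := by
  rw [← hM.aeval_eq_zero, aeval_eq_pow_mul hc hP, mul_eq_zero, or_iff_right (pow_ne_zero n ht0),
    map_eq_zero_iff ψ ψ.toRingHom.injective]

theorem IsConeModel.exists_eq_div (hM : IsConeModel w F ξ ψ) (ht0 : t ≠ 0)
    (hc : ∀ k, ξ k = t ^ w k * ψ (c k)) (z : K) :
    ∃ P Q : MvPolynomial σ ℂ, aeval c Q ≠ 0 ∧ z = aeval c P / aeval c Q := by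
  obtain ⟨n, P, Q, hP, hQ, hQ0, h⟩ := (hM.mem_range _).1 ⟨z, rfl⟩
  rw [aeval_eq_pow_mul hc hQ] at hQ0
  refine ⟨P, Q, fun h0 => hQ0 (by rw [h0, map_zero, mul_zero]), ψ.toRingHom.injective ?_⟩
  change ψ _ = ψ _
  rw [h, aeval_eq_pow_mul hc hQ, aeval_eq_pow_mul hc hP, map_div₀,
    mul_div_mul_left _ _ (pow_ne_zero n ht0)]

theorem diffMap_surjective (h : ∀ z : K, ∃ P Q : MvPolynomial σ ℂ,
    aeval c Q ≠ 0 ∧ z = aeval c P / aeval c Q) : Function.Surjective (diffMap c) := by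
  rw [← LinearMap.range_eq_top, eq_top_iff, ← KaehlerDifferential.span_range_derivation,
    Submodule.span_le]
  rintro _ ⟨z, rfl⟩
  obtain ⟨P, Q, hQ, rfl⟩ := h z
  rw [div_eq_mul_inv, Derivation.leibniz, Derivation.leibniz_inv, ← diffMap_gradAt,
    ← diffMap_gradAt]
  exact ⟨aeval c P • (-(aeval c Q)⁻¹ ^ 2 • gradAt Q c) + (aeval c Q)⁻¹ • gradAt P c, by simp⟩

theorem derivation_prod_zpow {ι : Type} (s : Finset ι) (c : ι → K) (a : ι → ℤ)
    (hc : ∀ k ∈ s, c k ≠ 0) : KaehlerDifferential.D ℂ K (∏ k ∈ s, c k ^ a k) =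
      (∏ k ∈ s, c k ^ a k) • ∑ k ∈ s, ((a k : K) / c k) • KaehlerDifferential.D ℂ K (c k) := by
  classical
  induction s using Finset.induction_on with
  | empty => simp
  | insert i s hi ih =>
    have h0 := hc i (Finset.mem_insert_self i s)
    rw [Finset.prod_insert hi, Finset.sum_insert hi, Derivation.leibniz,
      ih fun k hk => hc k (Finset.mem_insert_of_mem hk), Derivation.leibniz_zpow, smul_add,
      smul_smul, smul_smul, ← Int.cast_smul_eq_zsmul K, smul_smul, smul_smul, add_comm]
    congr 2
    rw [zpow_sub_one₀ h0]
    field_simp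

/-- A Laurent monomial of degree one equal to `1` in the coordinates `c` provides a vector in the
kernel of `diffMap c` on which the Euler form is `1`. -/
theorem diffMap_eulerForm_laurent (a : σ → ℤ) (ha : ∑ k, a k * (w k : ℤ) = 1)
    (hc : ∀ k, c k ≠ 0) (h1 : ∏ k, c k ^ a k = 1) :
    diffMap c (fun k => (a k : K) / c k) = 0 ∧ eulerForm w c (fun k => (a k : K) / c k) = 1 := by
  constructor
  · have h := derivation_prod_zpow Finset.univ c a fun k _ => hc k
    rw [h1, one_smul, Derivation.map_one_eq_zero] at h
    exact h.symm
  · rw [eulerForm_apply]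
    have : ((∑ k, a k * (w k : ℤ) : ℤ) : K) = 1 := by rw [ha, Int.cast_one]
    rw [← this]
    push_cast
    refine Finset.sum_congr rfl fun k _ => ?_
    have := hc k
    field_simp

theorem prod_zpow_eq_zpow_sum {ι M : Type} [CommGroupWithZero M] {t : M} (ht0 : t ≠ 0) (s : Finset ι) (f : ι → ℤ) :
    ∏ k ∈ s, t ^ f k = t ^ ∑ k ∈ s, f k := by
  classical
  induction s using Finset.induction_on with
  | empty => simp
  | insert i s hi ih => rw [Finset.prod_insert hi, Finset.sum_insert hi, ih, zpow_add₀ ht0]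

/-- When $t$ is itself the Laurent monomial, the same monomial in the coordinates
$c_k=\xi_k/t^{w_k}$ becomes $1$. Its logarithmic derivative then provides a kernel vector of Euler
form one. -/
theorem prod_coord_zpow (ht0 : t ≠ 0) (hc : ∀ k, ξ k = t ^ w k * ψ (c k)) (hξ : ∀ k, ξ k ≠ 0)
    (a : σ → ℤ) (ha : ∑ k, a k * (w k : ℤ) = 1) (hta : t = ∏ k, ξ k ^ a k) :
    (∀ k, c k ≠ 0) ∧ ∏ k, c k ^ a k = 1 := by
  refine ⟨fun k h0 => hξ k (by rw [hc, h0, map_zero, mul_zero]), ψ.toRingHom.injective ?_⟩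
  change ψ _ = ψ _
  have h1 : ∏ k, ξ k ^ a k = t * ψ (∏ k, c k ^ a k) := by
    calc ∏ k, ξ k ^ a k = ∏ k, (t ^ (a k * (w k : ℤ)) * ψ (c k ^ a k)) := by
          refine Finset.prod_congr rfl fun k _ => ?_
          rw [hc k, mul_zpow, map_zpow₀, ← zpow_natCast, ← zpow_mul, mul_comm (a k)]
      _ = _ := by
          rw [Finset.prod_mul_distrib, ← map_prod, prod_zpow_eq_zpow_sum ht0, ha, zpow_one]
  rw [← hta] at h1
  rw [map_one]
  exact (mul_eq_left₀ ht0).1 h1.symm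

/-- The gradient and $\rho$ both lie in the kernel; the Euler form, $0$ on one and $1$ on the other,
shows that they are independent. -/
theorem finrank_ker_diffMap_ge (hF : IsWeightedHomogeneous w F d) (hc0 : aeval c F = 0)
    (hne : gradAt F c ≠ 0) (h2 : ∃ ρ, diffMap c ρ = 0 ∧ eulerForm w c ρ = 1) :
    2 ≤ Module.finrank K (LinearMap.ker (diffMap c)) := by
  obtain ⟨ρ, hρ, hlρ⟩ := h2
  have h1 : diffMap c (gradAt F c) = 0 := by rw [diffMap_gradAt, hc0, map_zero]
  have h2 : eulerForm w c (gradAt F c) = 0 := by rw [eulerForm_gradAt hF, hc0, mul_zero]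
  have hli : LinearIndependent K ![(⟨gradAt F c, h1⟩ : LinearMap.ker (diffMap c)), ⟨ρ, hρ⟩] := by
    rw [LinearIndependent.pair_iff]
    intro x y hxy
    have h3 : x • gradAt F c + y • ρ = 0 := congrArg Subtype.val hxy
    have h4 := congrArg (eulerForm w c) h3
    simp only [map_add, map_smul, h2, hlρ, smul_eq_mul, mul_zero, mul_one, zero_add,
      map_zero] at h4
    rw [h4, zero_smul, add_zero, smul_eq_zero, or_iff_left hne] at h3
    exact ⟨h3, h4⟩
  simpa using hli.fintype_card_le_finrank

/-- The coordinates $\xi_k=t^{w_k}c_k$ lie in $K[t]$, so `L` consists of fractions of $K[t]$ and has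
transcendence degree at most one over `K`. -/
theorem isAlgebraic_adjoin_singleton [Algebra K L] [IsScalarTower ℂ K L]
    (hfrac : ∀ z : L, ∃ P Q : MvPolynomial σ ℂ, aeval ξ Q ≠ 0 ∧ z = aeval ξ P / aeval ξ Q)
    (hc : ∀ k, ξ k = t ^ w k * algebraMap K L (c k)) :
    Algebra.IsAlgebraic (Algebra.adjoin K {t}) L := by
  have hsub : ∀ k, ξ k ∈ (Algebra.adjoin K {t}) := fun k => by
    rw [hc k]
    exact mul_mem (pow_mem (Algebra.subset_adjoin (Set.mem_singleton t)) _) (Subalgebra.algebraMap_mem _ (c k))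
  have hadj : ∀ P : MvPolynomial σ ℂ, aeval ξ P ∈ Algebra.adjoin K {t} := by
    intro P
    induction P using MvPolynomial.induction_on with
    | C a =>
      rw [aeval_C, IsScalarTower.algebraMap_apply ℂ K L]
      exact Subalgebra.algebraMap_mem _ _
    | add p q hp hq => rw [map_add]; exact add_mem hp hq
    | mul_X p i hp => rw [map_mul, aeval_X]; exact mul_mem hp (hsub i)
  refine ⟨fun z => ?_⟩
  obtain ⟨P, Q, -, rfl⟩ := hfrac z
  rw [div_eq_mul_inv]
  have h : ∀ P, IsAlgebraic (Algebra.adjoin K {t}) (aeval ξ P) := fun P =>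
    isAlgebraic_algebraMap (⟨aeval ξ P, hadj P⟩ : Algebra.adjoin K {t})
  exact (h P).mul (h Q).inv

/-- All coordinates but $\xi_j$ are algebraically independent in `L`, since `F` really involves
$x_j$, and passing from `L` to `K` loses at most one. -/
theorem IsConeModel.card_le_trdeg (hM : IsConeModel w F ξ ψ) {j : σ} (hj : pderiv j F ≠ 0)
    (hc : ∀ k, ξ k = t ^ w k * ψ (c k)) :
    (Fintype.card σ : Cardinal) ≤ Algebra.trdeg ℂ K + 2 := by
  have hai : AlgebraicIndependent ℂ fun k : {k // k ≠ j} => ξ k := by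
    rw [algebraicIndependent_iff]
    intro p hp
    by_contra h0
    refine rename_notMem_span hj h0 (Ideal.mem_span_singleton.2 ((hM.aeval_eq_zero _).1 ?_))
    rw [aeval_rename]
    exact hp
  let alg : Algebra K L := ψ.toRingHom.toAlgebra
  have tow : IsScalarTower ℂ K L := IsScalarTower.of_algebraMap_eq fun z => (ψ.commutes z).symm
  have halg : Algebra.IsAlgebraic (Algebra.adjoin K {t}) L :=
    isAlgebraic_adjoin_singleton hM.exists_fraction hc
  have h1 := hai.cardinalMk_le_trdeg
  have h2 : Algebra.trdeg K L ≤ 1 := by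
    have := Algebra.IsAlgebraic.trdeg_le_cardinalMk K ({t} : Set L)
    simpa using this
  have h3 := _root_.trdeg_add_eq ℂ K (A := L)
  have h4 : (Fintype.card σ : Cardinal) = #{k // k ≠ j} + 1 := by
    rw [mk_fintype, ← Nat.cast_one, ← Nat.cast_add, Nat.cast_inj]
    have := Fintype.card_subtype_compl (· = j)
    have h5 : 0 < Fintype.card σ := Fintype.card_pos_iff.2 ⟨j⟩
    simp only [Fintype.card_subtype_eq] at this
    have h6 : Fintype.card {k // k ≠ j} = Fintype.card σ - 1 := this
    rw [h6]
    omega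
  calc (Fintype.card σ : Cardinal) ≤ Algebra.trdeg ℂ L + 1 := by rw [h4]; gcongr
    _ ≤ Algebra.trdeg ℂ K + 1 + 1 := by rw [← h3]; gcongr
    _ = _ := by rw [add_assoc]; norm_num

theorem IsConeModel.exists_gradAt_ne_zero (hM : IsConeModel w F ξ ψ) (ht0 : t ≠ 0)
    (hc : ∀ k, ξ k = t ^ w k * ψ (c k)) (hF : IsWeightedHomogeneous w F d)
    {j : σ} (hj : ¬ F ∣ pderiv j F) : gradAt F c j ≠ 0 := by
  have h0 : pderiv j F ≠ 0 := fun h => hj (h ▸ dvd_zero F)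
  have hle := isWeightedHomogeneous_pderiv_ne_zero hF h0
  have hp : IsWeightedHomogeneous w (pderiv j F) (d - w j) := hF.pderiv (by omega)
  exact fun h => hj ((hM.aeval_coord_eq_zero ht0 hc hp).1 h)

/-- The two kernel vectors bound the rank from above, the transcendence degree from below. -/
theorem IsConeModel.finrank_kaehlerDifferential (hM : IsConeModel w F ξ ψ)
    (hF : IsWeightedHomogeneous w F d) {j : σ} (hj : ¬ F ∣ pderiv j F)
    (ht0 : t ≠ 0) (hc : ∀ k, ξ k = t ^ w k * ψ (c k))
    (h2 : ∃ ρ, diffMap c ρ = 0 ∧ eulerForm w c ρ = 1) :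
    Module.finrank K (Ω[K⁄ℂ]) + 2 = Fintype.card σ ∧ FiniteDimensional K (Ω[K⁄ℂ]) ∧
      Algebra.trdeg ℂ K = Module.finrank K (Ω[K⁄ℂ]) := by
  have hsurj := diffMap_surjective (hM.exists_eq_div ht0 hc)
  have hfin : FiniteDimensional K (Ω[K⁄ℂ]) := Module.Finite.of_surjective _ hsurj
  have htr : Algebra.trdeg ℂ K = Module.finrank K (Ω[K⁄ℂ]) := by
    rw [← rank_kaehlerDifferential, Module.finrank_eq_rank]
  refine ⟨le_antisymm ?_ ?_, hfin, htr⟩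
  · have h1 := LinearMap.finrank_range_add_finrank_ker (diffMap c)
    have h3 := finrank_ker_diffMap_ge hF ((hM.aeval_coord_eq_zero ht0 hc hF).2 dvd_rfl)
      (fun h => hM.exists_gradAt_ne_zero ht0 hc hF hj (congrFun h j)) h2
    rw [LinearMap.range_eq_top.2 hsurj, finrank_top, Module.finrank_fintype_fun_eq_card] at h1
    omega
  · have h1 := hM.card_le_trdeg (fun h => hj (h ▸ dvd_zero F)) hc
    rw [htr] at h1
    exact_mod_cast h1

end ConeModel


/-! ### Bézout coefficients with prescribed support. -/

section Bezout

variable {σ : Type} [Fintype σ] [DecidableEq σ]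

theorem exists_sum_mul_eq_gcd (w : σ → ℕ) (s : Finset σ) :
    ∃ a : σ → ℤ, (∀ k ∉ s, a k = 0) ∧ ∑ k, a k * (w k : ℤ) = s.gcd w := by
  induction s using Finset.induction_on with
  | empty => exact ⟨0, by simp, by simp⟩
  | insert i s hi ih =>
    obtain ⟨a, ha, hs⟩ := ih
    refine ⟨fun k => Pi.single (M := fun _ => ℤ) i (Nat.gcdA (w i) (s.gcd w)) k +
      Nat.gcdB (w i) (s.gcd w) * a k, fun k hk => ?_, ?_⟩
    · rw [Finset.mem_insert, not_or] at hk
      simp only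
      rw [Pi.single_eq_of_ne hk.1, ha k hk.2, mul_zero, add_zero]
    · simp only [add_mul, Finset.sum_add_distrib, mul_assoc]
      rw [← Finset.mul_sum, hs, Finset.gcd_insert]
      change _ = ((Nat.gcd (w i) (s.gcd w) : ℕ) : ℤ)
      rw [Nat.gcd_eq_gcd_ab]
      simp [Pi.single_apply, mul_comm]

end Bezout

/-- A quasi-smooth, well-formed cone that is not contained in a coordinate hyperplane. -/
structure IsWellFormedCone {σ : Type} [Fintype σ] [DecidableEq σ] (w : σ → ℕ)
    (F : MvPolynomial σ ℂ) (d : ℕ) : Prop where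
  pos : ∀ i, 0 < w i
  homogeneous : IsWeightedHomogeneous w F d
  degree_pos : 0 < d
  card : 3 ≤ Fintype.card σ
  prime : Prime F
  not_dvd_X : ∀ k, ¬ F ∣ X k
  nondegenerate : IsNondegenerate F
  wellFormed : IsWellFormed w F

/-! ### The fraction field of the coordinate ring as a cone model of the hypersurface. -/

section Cone

variable {σ : Type} {w : σ → ℕ} {F : MvPolynomial σ ℂ} {d : ℕ}

/-- The coordinate functions in the function field of the affine cone. -/
def coneCoord (F : MvPolynomial σ ℂ) (k : σ) : FractionRing (CoordRing F) :=
  algebraMap (CoordRing F) _ (Ideal.Quotient.mkₐ ℂ (Ideal.span {F}) (X k))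

theorem aeval_coneCoord (P : MvPolynomial σ ℂ) : aeval (coneCoord F) P =
    algebraMap (CoordRing F) (FractionRing (CoordRing F))
      (Ideal.Quotient.mkₐ ℂ (Ideal.span {F}) P) := by
  have : aeval (coneCoord F) = (IsScalarTower.toAlgHom ℂ (CoordRing F)
      (FractionRing (CoordRing F))).comp (Ideal.Quotient.mkₐ ℂ (Ideal.span {F})) := by
    apply MvPolynomial.algHom_ext
    intro i
    rw [aeval_X]
    rfl
  rw [this]
  rfl

theorem isDomain_coordRing (hF : Prime F) : IsDomain (CoordRing F) :=
  (Ideal.Quotient.isDomain_iff_prime _).2 ((Ideal.span_singleton_prime hF.ne_zero).2 hF)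

variable [IsDomain (CoordRing F)]

theorem aeval_coneCoord_eq_zero (P : MvPolynomial σ ℂ) : aeval (coneCoord F) P = 0 ↔ F ∣ P := by
  rw [aeval_coneCoord, FaithfulSMul.algebraMap_eq_zero_iff, Ideal.Quotient.mkₐ_eq_mk,
    Ideal.Quotient.eq_zero_iff_mem, Ideal.mem_span_singleton]

theorem coneCoord_ne_zero {k : σ} (hk : ¬ F ∣ X k) : coneCoord F k ≠ 0 := by
  have := (aeval_coneCoord_eq_zero (F := F) (X k)).not.2 hk
  rwa [aeval_X] at this

theorem exists_ne_zero_mem_coordGrading {k : σ} (hw : 0 < w k) (hk : ¬ F ∣ X k) :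
    ∃ n > 0, ∃ a ∈ coordGrading w F n, a ≠ 0 :=
  ⟨w k, hw, _, mk_mem_coordGrading w F (isWeightedHomogeneous_X ℂ w k), fun h => hk (by
    rwa [Ideal.Quotient.mkₐ_eq_mk, Ideal.Quotient.eq_zero_iff_mem, Ideal.mem_span_singleton] at h)⟩

variable [GradedAlgebra (coordGrading w F)] [IsIntegral (Proj (coordGrading w F))]

variable (w F) in
/-- The structure morphism of `Proj (ℂ[x] / (F))`. -/
def projToSpec : Proj (coordGrading w F) ⟶ Spec (CommRingCat.of ℂ) :=
  Proj.toSpecZero (coordGrading w F) ≫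
    Spec.map (CommRingCat.ofHom (algebraMap ℂ (coordGrading w F 0)))

/-- The function field of `Proj (ℂ[x] / (F))` as a `ℂ`-algebra. -/
@[reducible]
def projFunctionFieldAlgebra : Algebra ℂ (Proj (coordGrading w F)).functionField :=
  functionFieldAlgebra (projToSpec w F)

attribute [local instance] projFunctionFieldAlgebra

variable (w F) in
/-- The inclusion of the function field of the hypersurface in that of the affine cone. -/
def projToCone : (Proj (coordGrading w F)).functionField →ₐ[ℂ] FractionRing (CoordRing F) :=
  { functionFieldToFrac (coordGrading w F) with
    commutes' := functionFieldToFrac_algebraMap_complex (coordGrading w F) }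

theorem isConeModel {k : σ} (hw : 0 < w k) (hk : ¬ F ∣ X k) :
    IsConeModel w F (coneCoord F) (projToCone w F) where
  aeval_eq_zero := aeval_coneCoord_eq_zero
  exists_fraction z := by
    obtain ⟨a, b, hb, rfl⟩ := IsFractionRing.div_surjective (A := CoordRing F) z
    obtain ⟨P, rfl⟩ := Ideal.Quotient.mkₐ_surjective ℂ (Ideal.span {F}) a
    obtain ⟨Q, rfl⟩ := Ideal.Quotient.mkₐ_surjective ℂ (Ideal.span {F}) b
    refine ⟨P, Q, ?_, by rw [aeval_coneCoord, aeval_coneCoord]⟩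
    rw [aeval_coneCoord]
    exact fun h => nonZeroDivisors.ne_zero hb ((FaithfulSMul.algebraMap_eq_zero_iff _ _).1 h)
  mem_range z := by
    refine (functionFieldToFrac_range (coordGrading w F)
      (exists_ne_zero_mem_coordGrading hw hk) z).trans ⟨?_, ?_⟩
    · rintro ⟨n, _, _, ⟨P, hP, rfl⟩, ⟨Q, hQ, rfl⟩, hb0, rfl⟩
      refine ⟨n, P, Q, hP, hQ, ?_, ?_⟩
      · rw [aeval_coneCoord]
        exact fun h => hb0 ((FaithfulSMul.algebraMap_eq_zero_iff _ _).1 h)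
      · rw [aeval_coneCoord, aeval_coneCoord]
        rfl
    · rintro ⟨n, P, Q, hP, hQ, hQ0, rfl⟩
      refine ⟨n, _, _, mk_mem_coordGrading w F hP, mk_mem_coordGrading w F hQ, fun h => hQ0 ?_, ?_⟩
      · rw [aeval_coneCoord, h, map_zero]
      · rw [aeval_coneCoord, aeval_coneCoord]

end Cone

/-! ### Points of the hypersurface, and Laurent monomials at points of codimension one. -/

section Points

variable {σ : Type} [Fintype σ] [DecidableEq σ] {w : σ → ℕ} {F : MvPolynomial σ ℂ} {d : ℕ}
  [IsDomain (CoordRing F)] [GradedAlgebra (coordGrading w F)]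

/-- The prime ideal of `ℂ[x]` of a point of the hypersurface. -/
def pointIdeal (x : Proj (coordGrading w F)) : Ideal (MvPolynomial σ ℂ) :=
  x.asHomogeneousIdeal.toIdeal.comap (Ideal.Quotient.mk (Ideal.span {F}))

instance isPrime_pointIdeal (x : Proj (coordGrading w F)) : (pointIdeal x).IsPrime :=
  Ideal.IsPrime.comap _

theorem mem_pointIdeal {x : Proj (coordGrading w F)} {P : MvPolynomial σ ℂ} :
    P ∈ pointIdeal x ↔ Ideal.Quotient.mkₐ ℂ (Ideal.span {F}) P ∈ x.asHomogeneousIdeal.toIdeal :=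
  Iff.rfl

theorem self_mem_pointIdeal (x : Proj (coordGrading w F)) : F ∈ pointIdeal x := by
  have h : Ideal.Quotient.mkₐ ℂ (Ideal.span {F}) F = 0 :=
    Ideal.Quotient.eq_zero_iff_mem.2 (Ideal.mem_span_singleton_self F)
  rw [mem_pointIdeal, h]
  exact Ideal.zero_mem _

theorem exists_X_notMem_pointIdeal (x : Proj (coordGrading w F)) : ∃ k, X k ∉ pointIdeal x := by
  by_contra! hcon
  refine x.not_irrelevant_le ((HomogeneousIdeal.toIdeal_irrelevant_le _).2 ?_)
  rintro n hn _ ⟨P, hP, rfl⟩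
  change P ∈ pointIdeal x
  rw [P.as_sum]
  refine Ideal.sum_mem _ fun a ha => ?_
  have hwt : Finsupp.weight w a = n := hP (mem_support_iff.1 ha)
  obtain ⟨k, hk⟩ : ∃ k, a k ≠ 0 := by
    by_contra! h0
    rw [Finsupp.ext (g := 0) h0, map_zero] at hwt
    exact hn.ne hwt
  exact Ideal.mem_of_dvd _ (X_dvd_monomial.2 (Or.inr hk)) (hcon k)

/-- A point of `Proj` misses some $x_k$, while a power of $x_k$ lies in the Jacobian ideal. -/
theorem exists_pderiv_notMem_pointIdeal (hC : IsWellFormedCone w F d)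
    (x : Proj (coordGrading w F)) : ∃ j, pderiv j F ∉ pointIdeal x := by
  by_contra! hcon
  obtain ⟨k, hk⟩ := exists_X_notMem_pointIdeal x
  obtain ⟨M, hM⟩ := exists_pow_mem_span_pderiv hC.homogeneous hC.degree_pos hC.nondegenerate k
  refine hk (Ideal.IsPrime.mem_of_pow_mem inferInstance M ?_)
  refine (Ideal.span_le.2 ?_) hM
  rintro _ ⟨j, rfl⟩
  exact hcon j

theorem isIntegrallyClosed_stalk_proj [IsIntegral (Proj (coordGrading w F))]
    (hC : IsWellFormedCone w F d)
    (x : Proj (coordGrading w F)) :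
    IsIntegrallyClosed ((Proj (coordGrading w F)).presheaf.stalk x) := by
  obtain ⟨j, hj⟩ := exists_pderiv_notMem_pointIdeal hC x
  refine isIntegrallyClosed_stalk x (f := pderivClass F j) hj
    (isIntegrallyClosed_jacobianAway hC.prime (j := j) (fun h => hj ?_) _)
  obtain ⟨B, hB⟩ := Ideal.mem_span_singleton'.1 h
  rw [← hB]
  exact Ideal.mul_mem_left _ _ (self_mem_pointIdeal x)

/-- A minimal prime of $(F,x_i)$ inside the ideal of $x$ has height at most two, so it is strictly
smaller. Its homogeneous core modulo `F` is a point strictly between $x$ and the generic point. -/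
theorem two_le_ringKrullDim_stalk (hC : IsWellFormedCone w F d) (x : Proj (coordGrading w F))
    {i : σ} (hi : X i ∈ pointIdeal x) (h3 : 3 ≤ (pointIdeal x).height) :
    2 ≤ ringKrullDim ((Proj (coordGrading w F)).presheaf.stalk x) := by
  have hne : ∃ n > 0, ∃ a ∈ coordGrading w F n, a ≠ 0 :=
    exists_ne_zero_mem_coordGrading (hC.pos i) (hC.not_dvd_X i)
  obtain ⟨q, hq, hqx⟩ := Ideal.exists_minimalPrimes_le
    (show Ideal.span {F, X i} ≤ pointIdeal x from Ideal.span_le.2 (by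
      rintro _ (rfl | rfl)
      · exact self_mem_pointIdeal x
      · exact hi))
  have hqp : q.IsPrime := hq.1.1
  have hq2 : q.height ≤ 2 := by
    have h := Ideal.height_le_card_of_mem_minimalPrimes_span (s := {F, X i}) (Set.toFinite _) hq
    refine h.trans ?_
    exact_mod_cast (Set.ncard_insert_le F {X i}).trans (by rw [Set.ncard_singleton])
  have hqne : q ≠ pointIdeal x := by
    rintro rfl
    exact absurd (h3.trans hq2) (by decide)
  have hFq : F ∈ q := hq.1.2 (Ideal.subset_span (by simp))
  have hXq : X i ∈ q := hq.1.2 (Ideal.subset_span (by simp))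
  have hker : RingHom.ker (Ideal.Quotient.mk (Ideal.span {F})) ≤ q := by
    rw [Ideal.mk_ker, Ideal.span_singleton_le_iff_mem]
    exact hFq
  have hq'p : (q.map (Ideal.Quotient.mk (Ideal.span {F}))).IsPrime :=
    Ideal.map_isPrime_of_surjective Ideal.Quotient.mk_surjective hker
  have hcomap : (q.map (Ideal.Quotient.mk (Ideal.span {F}))).comap
      (Ideal.Quotient.mk (Ideal.span {F})) = q := by
    rw [Ideal.comap_map_of_surjective' _ Ideal.Quotient.mk_surjective, sup_eq_left]
    exact hker
  have hq'x : q.map (Ideal.Quotient.mk (Ideal.span {F})) ≤ x.asHomogeneousIdeal.toIdeal :=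
    Ideal.map_le_iff_le_comap.2 hqx
  set J := (q.map (Ideal.Quotient.mk (Ideal.span {F}))).homogeneousCore (coordGrading w F) with hJ
  have hJx : J.toIdeal ≤ x.asHomogeneousIdeal.toIdeal :=
    (Ideal.toIdeal_homogeneousCore_le _ _).trans hq'x
  let y : Proj (coordGrading w F) := ⟨J, hq'p.homogeneousCore, fun h =>
    x.not_irrelevant_le (h.trans hJx)⟩
  let η : Proj (coordGrading w F) := projGenericPoint (coordGrading w F) hne
  have hspec : ∀ z z' : Proj (coordGrading w F), z' ≤ z ↔
      z.asHomogeneousIdeal.toIdeal ≤ z'.asHomogeneousIdeal.toIdeal := fun z z' =>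
    (specializes_iff_mem_closure.trans
      (ProjectiveSpectrum.le_iff_mem_closure (coordGrading w F) z z').symm)
  have hxy : x < y := by
    rw [lt_iff_le_not_ge, hspec, hspec]
    refine ⟨hJx, fun h => hqne (le_antisymm hqx ?_)⟩
    rw [← hcomap]
    exact Ideal.comap_mono (h.trans (Ideal.toIdeal_homogeneousCore_le _ _))
  have hyη : y < η := by
    rw [lt_iff_le_not_ge, hspec, hspec]
    refine ⟨bot_le (α := Ideal (CoordRing F)), fun h => hC.not_dvd_X i ?_⟩
    have h1 : Ideal.Quotient.mkₐ ℂ (Ideal.span {F}) (X i) ∈ J.toIdeal :=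
      Ideal.mem_homogeneousCore_of_homogeneous_of_mem
        ⟨w i, mk_mem_coordGrading w F (isWeightedHomogeneous_X ℂ w i)⟩ (Ideal.mem_map_of_mem _ hXq)
    have h2 := (Ideal.mem_bot (R := CoordRing F)).1 (h h1)
    exact Ideal.mem_span_singleton.1 (Ideal.Quotient.eq_zero_iff_mem.1 h2)
  rw [ringKrullDim_stalk_eq_coheight]
  have h1 := Order.coheight_add_one_le hxy
  have h2 := Order.coheight_add_one_le hyη
  have h3 : (2 : ℕ∞) ≤ Order.coheight x := by
    calc (2 : ℕ∞) = 0 + 1 + 1 := by norm_num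
      _ ≤ Order.coheight η + 1 + 1 := by gcongr; exact zero_le
      _ ≤ Order.coheight y + 1 := by gcongr
      _ ≤ _ := h1
  exact WithBot.coe_le_coe.2 h3

/-- At a point of codimension one there is a Laurent monomial of degree one in the variables not
vanishing at the point. -/
theorem exists_unit_laurent (hC : IsWellFormedCone w F d) (x : Proj (coordGrading w F))
    (hx : ringKrullDim ((Proj (coordGrading w F)).presheaf.stalk x) = 1) :
    ∃ a : σ → ℤ, ∑ k, a k * (w k : ℤ) = 1 ∧ ∀ k, X k ∈ pointIdeal x → a k = 0 := by
  classical
  -- If two coordinates vanish at a point of codimension one, its ideal is exactly $(x_i,x_j)$. Then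
  -- `F` vanishes on this stratum, and well-formedness makes the remaining weights coprime.
  have hkey : ∀ i j, i ≠ j → X i ∈ pointIdeal x → X j ∈ pointIdeal x →
      ((Finset.univ.erase i).erase j).gcd w = 1 ∧ ∀ k, X k ∈ pointIdeal x → k = i ∨ k = j := by
    intro i j hij hi hj
    have hle : Ideal.span {X i, X j} ≤ pointIdeal x := Ideal.span_le.2 (by
      rintro _ (rfl | rfl)
      · exact hi
      · exact hj)
    by_contra hcon
    have hlt : Ideal.span {X i, X j} < pointIdeal x := by
      refine lt_of_le_of_ne hle fun heq => hcon ⟨?_, ?_⟩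
      · have hF : F ∈ Ideal.span {X i, X j} := heq ▸ self_mem_pointIdeal x
        -- Well-formedness only excludes a gcd greater than one; the value $0$ of an empty gcd is
        -- excluded by the third variable.
        have h0 : ((Finset.univ.erase i).erase j).gcd w ≠ 0 := by
          intro h
          rw [Finset.gcd_eq_zero_iff] at h
          have hcard := Finset.card_erase_of_mem
            (Finset.mem_erase.2 ⟨hij.symm, Finset.mem_univ j⟩)
          rw [Finset.card_erase_of_mem (Finset.mem_univ i), Finset.card_univ] at hcard
          have h3 := hC.card
          obtain ⟨k, hk⟩ : ((Finset.univ.erase i).erase j).Nonempty := by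
            rw [← Finset.card_pos]
            omega
          exact (hC.pos k).ne' (h k hk)
        by_contra h1
        obtain ⟨z, hzi, hzj, hz⟩ := hC.wellFormed.2 i j hij (by omega)
        obtain ⟨b, c, hbc⟩ := Ideal.mem_span_pair.1 hF
        refine hz ?_
        rw [← hbc]
        simp [hzi, hzj]
      · intro k hk
        have hk' : X k ∈ Ideal.span (X '' {i, j} : Set (MvPolynomial σ ℂ)) := by
          rw [Set.image_insert_eq, Set.image_singleton, heq]
          exact hk
        simpa using X_mem_span_X_image.1 hk'
    have h2 := two_le_ringKrullDim_stalk hC x hi (three_le_height hij _ hlt)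
    rw [hx] at h2
    exact absurd h2 (by decide)
  have hfin : ∀ s : Finset σ, s.gcd w = 1 → (∀ k, X k ∈ pointIdeal x → k ∉ s) →
      ∃ a : σ → ℤ, ∑ k, a k * (w k : ℤ) = 1 ∧ ∀ k, X k ∈ pointIdeal x → a k = 0 := by
    intro s hs hsx
    obtain ⟨a, ha, hsum⟩ := exists_sum_mul_eq_gcd w s
    exact ⟨a, by rw [hsum, hs, Nat.cast_one], fun k hk => ha k (hsx k hk)⟩
  by_cases h : ∃ i, X i ∈ pointIdeal x
  · obtain ⟨i, hi⟩ := h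
    by_cases h' : ∃ j, i ≠ j ∧ X j ∈ pointIdeal x
    · obtain ⟨j, hij, hj⟩ := h'
      obtain ⟨h1, h2⟩ := hkey i j hij hi hj
      refine hfin _ h1 fun k hk hks => ?_
      rcases h2 k hk with rfl | rfl <;> simp at hks
    · push Not at h'
      refine hfin _ (hC.wellFormed.1 i) fun k hk hks => ?_
      exact h' k (Finset.ne_of_mem_erase hks).symm hk
  · push Not at h
    obtain ⟨i⟩ : Nonempty σ := Fintype.card_pos_iff.1 (by have := hC.card; omega)
    exact hfin _ (hC.wellFormed.1 i) fun k hk => absurd hk (h k)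

end Points


/-! ### First consequences of well-formedness and quasi-smoothness. -/

section WellFormedCone

variable {σ : Type} [Fintype σ] [DecidableEq σ] {w : σ → ℕ} {F : MvPolynomial σ ℂ} {d : ℕ}

theorem IsWellFormedCone.nonempty (hC : IsWellFormedCone w F d) : Nonempty σ :=
  Fintype.card_pos_iff.1 (by have := hC.card; omega)

theorem IsWellFormedCone.exists_laurent (hC : IsWellFormedCone w F d) :
    ∃ a : σ → ℤ, ∑ k, a k * (w k : ℤ) = 1 := by
  obtain ⟨i⟩ := hC.nonempty
  obtain ⟨a, -, ha⟩ := exists_sum_mul_eq_gcd w (Finset.univ.erase i)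
  exact ⟨a, by rw [ha, hC.wellFormed.1 i, Nat.cast_one]⟩

theorem IsWellFormedCone.exists_not_dvd_pderiv (hC : IsWellFormedCone w F d) :
    ∃ j, ¬ F ∣ pderiv j F := by
  by_contra! hcon
  obtain ⟨k⟩ := hC.nonempty
  obtain ⟨M, hM⟩ := exists_pow_mem_span_pderiv hC.homogeneous hC.degree_pos hC.nondegenerate k
  refine hC.not_dvd_X k (hC.prime.dvd_of_dvd_pow (n := M) (Ideal.mem_span_singleton.1 ?_))
  refine (Ideal.span_le.2 ?_) hM
  rintro _ ⟨j, rfl⟩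
  exact Ideal.mem_span_singleton.2 (hcon j)

theorem prod_zpow_mem {M ι : Type} [Field M] (A : Subring M) (s : Finset ι) (y : ι → M) (a : ι → ℤ)
    (h : ∀ k ∈ s, a k ≠ 0 → y k ∈ A ∧ (y k)⁻¹ ∈ A) : ∏ k ∈ s, y k ^ a k ∈ A := by
  refine A.prod_mem fun k hk => ?_
  by_cases h0 : a k = 0
  · rw [h0, zpow_zero]
    exact A.one_mem
  · obtain ⟨h1, h2⟩ := h k hk h0
    obtain ⟨n, hn | hn⟩ := (a k).eq_nat_or_neg
    · rw [hn, zpow_natCast]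
      exact A.pow_mem h1 n
    · rw [hn, zpow_neg, zpow_natCast, ← inv_pow]
      exact A.pow_mem h2 n

end WellFormedCone

/-! ### Coordinates adapted to a local ring of dimension one. -/

section LocalCoordinates

variable {σ : Type} [Fintype σ] [DecidableEq σ] {w : σ → ℕ} {F : MvPolynomial σ ℂ} {d : ℕ}
  [IsDomain (CoordRing F)] [GradedAlgebra (coordGrading w F)]

theorem IsWellFormedCone.coneCoord_ne_zero (hC : IsWellFormedCone w F d) (k : σ) :
    coneCoord F k ≠ 0 := WeightedCY.coneCoord_ne_zero (hC.not_dvd_X k)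

variable [IsIntegral (Proj (coordGrading w F))]

attribute [local instance] projFunctionFieldAlgebra

theorem mem_localSubring_iff_projToCone (x : Proj (coordGrading w F))
    (z : (Proj (coordGrading w F)).functionField) :
    z ∈ localSubring x ↔ projToCone w F z ∈ fracAt x.asHomogeneousIdeal.toIdeal :=
  mem_localSubring_iff_mem_fracAt x z

theorem aeval_coneCoord_mem_fracAt (x : Proj (coordGrading w F)) (P : MvPolynomial σ ℂ) :
    aeval (coneCoord F) P ∈ fracAt x.asHomogeneousIdeal.toIdeal := by
  rw [aeval_coneCoord]
  exact algebraMap_mem_fracAt _ _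

theorem inv_aeval_coneCoord_mem_fracAt (x : Proj (coordGrading w F)) {P : MvPolynomial σ ℂ}
    (hP : P ∉ pointIdeal x) : (aeval (coneCoord F) P)⁻¹ ∈ fracAt x.asHomogeneousIdeal.toIdeal := by
  rw [aeval_coneCoord]
  exact inv_algebraMap_mem_fracAt hP

theorem coneCoord_mem_fracAt (x : Proj (coordGrading w F)) (k : σ) :
    coneCoord F k ∈ fracAt x.asHomogeneousIdeal.toIdeal := by
  simpa using aeval_coneCoord_mem_fracAt x (X k)

theorem inv_coneCoord_mem_fracAt (x : Proj (coordGrading w F)) {k : σ} (hk : X k ∉ pointIdeal x) :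
    (coneCoord F k)⁻¹ ∈ fracAt x.asHomogeneousIdeal.toIdeal := by
  simpa using inv_aeval_coneCoord_mem_fracAt x hk

theorem algebraMap_mem_localSubring (x : Proj (coordGrading w F)) (z : ℂ) :
    algebraMap ℂ (Proj (coordGrading w F)).functionField z ∈ localSubring x := by
  rw [mem_localSubring_iff_projToCone, AlgHom.commutes]
  simpa using aeval_coneCoord_mem_fracAt x (C z)

/-- At a point of codimension one there are coordinates of the cone, with respect to a function
of degree one that is invertible at the point, that are adapted to the local ring. -/
theorem exists_local_coord (hC : IsWellFormedCone w F d) (x : Proj (coordGrading w F))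
    (hx : ringKrullDim ((Proj (coordGrading w F)).presheaf.stalk x) = 1) :
    ∃ (t : FractionRing (CoordRing F)) (c : σ → (Proj (coordGrading w F)).functionField),
      t ≠ 0 ∧ IsHomFrac w (coneCoord F) 1 t ∧
      (∀ k, coneCoord F k = t ^ w k * projToCone w F (c k)) ∧ (∀ k, c k ∈ localSubring x) ∧
      (∃ ρ, diffMap c ρ = 0 ∧ eulerForm w c ρ = 1 ∧ ∀ k, ρ k ∈ localSubring x) ∧
      (∃ j, gradAt F c j ≠ 0 ∧ (gradAt F c j)⁻¹ ∈ localSubring x) ∧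
      ∀ a ∈ localSubring x, ∃ P Q : MvPolynomial σ ℂ, aeval c Q ≠ 0 ∧
        (aeval c Q)⁻¹ ∈ localSubring x ∧ a = aeval c P / aeval c Q := by
  -- Only variables not vanishing at $x$ occur in this monomial, so `t` and its inverse lie in the
  -- local ring of the cone, and dividing by powers of `t` preserves regularity.
  obtain ⟨a, ha, hax⟩ := exists_unit_laurent hC x hx
  obtain ⟨i₀⟩ := hC.nonempty
  have hξ := hC.coneCoord_ne_zero
  have hM := isConeModel (w := w) (hC.pos i₀) (hC.not_dvd_X i₀)
  set A := fracAt x.asHomogeneousIdeal.toIdeal with hA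
  set t := ∏ k, coneCoord F k ^ a k with ht
  have ht1 : IsHomFrac w (coneCoord F) 1 t := ha ▸ isHomFrac_laurent hξ a
  have ht0 : t ≠ 0 := Finset.prod_ne_zero_iff.2 fun k _ => zpow_ne_zero _ (hξ k)
  have hu : ∀ k, a k ≠ 0 → coneCoord F k ∈ A ∧ (coneCoord F k)⁻¹ ∈ A := fun k hk =>
    ⟨coneCoord_mem_fracAt x k, inv_coneCoord_mem_fracAt x fun h => hk (hax k h)⟩
  have htA : t ∈ A := prod_zpow_mem A _ _ _ fun k _ => hu k
  have htA' : t⁻¹ ∈ A := by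
    have : t⁻¹ = ∏ k, coneCoord F k ^ (-a k) := by
      rw [ht, ← Finset.prod_inv_distrib]
      exact Finset.prod_congr rfl fun k _ => (zpow_neg _ _).symm
    rw [this]
    exact prod_zpow_mem A _ _ _ fun k _ hk => hu k fun h => hk (by rw [h, neg_zero])
  obtain ⟨c, hc⟩ := hM.exists_coord ht1 ht0
  obtain ⟨hc0, hc1⟩ := prod_coord_zpow ht0 hc hξ a ha ht
  obtain ⟨hρ, hlρ⟩ := diffMap_eulerForm_laurent a ha hc0 hc1
  have hψc : ∀ k, projToCone w F (c k) = t⁻¹ ^ w k * coneCoord F k := fun k => by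
    rw [hc k, inv_pow, inv_mul_cancel_left₀ (pow_ne_zero _ ht0)]
  -- Evaluation at `c` is evaluation on the cone divided by $t^n$, so a homogeneous polynomial
  -- outside the ideal of $x$ becomes a unit.
  have hinv : ∀ {Q : MvPolynomial σ ℂ} {n : ℕ}, IsWeightedHomogeneous w Q n → Q ∉ pointIdeal x →
      aeval c Q ≠ 0 ∧ (aeval c Q)⁻¹ ∈ localSubring x := by
    intro Q n hQ hQx
    have h1 : projToCone w F (aeval c Q) = t⁻¹ ^ n * aeval (coneCoord F) Q := by
      rw [aeval_eq_pow_mul hc hQ, inv_pow, inv_mul_cancel_left₀ (pow_ne_zero _ ht0)]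
    constructor
    · intro h
      have h2 : F ∣ Q := (hM.aeval_coord_eq_zero ht0 hc hQ).1 h
      exact hQx (Ideal.mem_of_dvd _ h2 (self_mem_pointIdeal x))
    · rw [mem_localSubring_iff_projToCone, map_inv₀, h1, mul_inv, inv_pow, inv_inv]
      exact A.mul_mem (A.pow_mem htA n) (inv_aeval_coneCoord_mem_fracAt x hQx)
  refine ⟨t, c, ht0, ht1, hc, fun k => ?_, ⟨_, hρ, hlρ, fun k => ?_⟩, ?_, fun z hz => ?_⟩
  · rw [mem_localSubring_iff_projToCone, hψc]
    exact A.mul_mem (A.pow_mem htA' _) (coneCoord_mem_fracAt x k)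
  · by_cases h0 : a k = 0
    · simp only [h0, Int.cast_zero, zero_div]
      exact Subring.zero_mem _
    · have h1 := (hinv (isWeightedHomogeneous_X ℂ w k) fun h => h0 (hax k h)).2
      rw [aeval_X] at h1
      rw [div_eq_mul_inv]
      exact Subring.mul_mem _ (intCast_mem _ _) h1
  · obtain ⟨j, hj⟩ := exists_pderiv_notMem_pointIdeal hC x
    have h0 : pderiv j F ≠ 0 := fun h => hj (h ▸ Ideal.zero_mem _)
    have hle := isWeightedHomogeneous_pderiv_ne_zero hC.homogeneous h0
    have hp : IsWeightedHomogeneous w (pderiv j F) (d - w j) :=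
      hC.homogeneous.pderiv (by omega)
    exact ⟨j, hinv hp hj⟩
  · obtain ⟨n, _, _, ⟨P, hP, rfl⟩, ⟨Q, hQ, rfl⟩, hQx, h⟩ :=
      (mem_localSubring_iff (coordGrading w F) x z).1 hz
    obtain ⟨h1, h2⟩ := hinv (Q := Q) hQ hQx
    refine ⟨P, Q, h1, h2, (projToCone w F).toRingHom.injective ?_⟩
    have h3 := aeval_coneCoord (F := F) P
    have h4 := aeval_coneCoord (F := F) Q
    rw [aeval_eq_pow_mul hc hP] at h3
    rw [aeval_eq_pow_mul hc hQ] at h4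
    change _ = projToCone w F _
    refine h.trans ?_
    change algebraMap (CoordRing F) (FractionRing (CoordRing F))
        (Ideal.Quotient.mkₐ ℂ (Ideal.span {F}) P) /
      algebraMap (CoordRing F) _ (Ideal.Quotient.mkₐ ℂ (Ideal.span {F}) Q) = _
    rw [← h3, ← h4, mul_div_mul_left _ _ (pow_ne_zero n ht0), map_div₀]

end LocalCoordinates


/-! ### No cone satisfies binomial equations in all pairs of variables. -/

section Disjoint

variable {σ : Type} [Fintype σ] [DecidableEq σ] {w : σ → ℕ} {F : MvPolynomial σ ℂ} {d : ℕ}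

theorem degreeOf_le_of_dvd {P Q : MvPolynomial σ ℂ} (h : P ∣ Q) (hQ : Q ≠ 0) (k : σ) :
    degreeOf k P ≤ degreeOf k Q := by
  obtain ⟨B, rfl⟩ := h
  rw [degreeOf_mul_eq (left_ne_zero_of_mul hQ) (right_ne_zero_of_mul hQ)]
  exact Nat.le_add_right _ _

/-- A cone in at least three variables cannot be contained in the binomial hypersurfaces
`λ x_k ^ a = μ x_l ^ b` for all pairs of variables. -/
theorem not_forall_dvd_binomial (hF : IsWeightedHomogeneous w F d) (hd : 0 < d) (hF0 : F ≠ 0)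
    (h3 : 3 ≤ Fintype.card σ) (h : ∀ k l, k ≠ l → ∃ (a b : ℕ) (x y : ℂ), 0 < a ∧ 0 < b ∧ x ≠ 0 ∧
      F ∣ C x * X k ^ a - C y * X l ^ b) : False := by
  -- With three variables some pair avoids $x_m$, and a divisor of a nonzero polynomial without
  -- $x_m$ does not involve $x_m$ either.
  have hdeg : ∀ m, degreeOf m F = 0 := by
    intro m
    have hcard : 1 < (Finset.univ.erase m).card := by
      rw [Finset.card_erase_of_mem (Finset.mem_univ m), Finset.card_univ]
      omega
    obtain ⟨k, hk, l, hl, hkl⟩ := Finset.one_lt_card.1 hcard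
    obtain ⟨a, b, x, y, ha, hb, hx, hdvd⟩ := h k l hkl
    have hne : (C x * X k ^ a - C y * X l ^ b : MvPolynomial σ ℂ) ≠ 0 := by
      intro h0
      have h1 := congrArg (eval (Pi.single k (1 : ℂ))) h0
      simp [Pi.single_eq_of_ne hkl.symm, hb.ne', hx] at h1
    have h1 := degreeOf_le_of_dvd hdvd hne m
    have h2 : ∀ (z : ℂ) (k : σ) (a : ℕ), k ≠ m →
        degreeOf m (C z * X k ^ a : MvPolynomial σ ℂ) = 0 := by
      intro z k a hk
      refine Nat.le_zero.1 ((degreeOf_C_mul_le _ _ _).trans ((degreeOf_pow_le _ _ _).trans ?_))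
      rw [degreeOf_X_of_ne hk.symm, mul_zero]
    have h4 := degreeOf_sub_le m (C x * X k ^ a : MvPolynomial σ ℂ) (C y * X l ^ b)
    rw [h2 _ _ _ (Finset.ne_of_mem_erase hk), h2 _ _ _ (Finset.ne_of_mem_erase hl)] at h4
    exact Nat.le_zero.1 (h1.trans (h4.trans (by simp)))
  obtain ⟨a, ha⟩ := support_nonempty.2 hF0
  have hwt : Finsupp.weight w a = d := hF (mem_support_iff.1 ha)
  have h0 : a = 0 := Finsupp.ext fun m => by
    have := monomial_le_degreeOf m ha
    rw [hdeg m] at this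
    simpa using this
  rw [h0, map_zero] at hwt
  exact hd.ne hwt

end Disjoint

/-! ### Forms without zeros and poles in codimension one determine the degree. -/

section Canonical

variable {σ : Type} [Fintype σ] [DecidableEq σ] {w : σ → ℕ} {F : MvPolynomial σ ℂ} {d : ℕ}
  {K L : Type} [Field K] [Algebra ℂ K] [Field L] [Algebra ℂ L] {ξ : σ → L} {ψ : K →ₐ[ℂ] L}
  {r : ℕ} {e : Fin 2 ⊕ Fin r ≃ σ}

/-- Coordinates of the cone with respect to a function of degree one. -/
structure IsCoord (w : σ → ℕ) (ξ : σ → L) (ψ : K →ₐ[ℂ] L) (t : L) (c : σ → K) : Prop where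
  ne_zero : t ≠ 0
  isHomFrac : IsHomFrac w ξ 1 t
  eq : ∀ k, ξ k = t ^ w k * ψ (c k)
  exists_ker : ∃ ρ, diffMap c ρ = 0 ∧ eulerForm w c ρ = 1

/-- A subring of `K` that contains suitable coordinates of the cone. -/
def IsAdapted (w : σ → ℕ) (F : MvPolynomial σ ℂ) (ξ : σ → L) (ψ : K →ₐ[ℂ] L) (A : Subring K) :
    Prop :=
  (∀ z : ℂ, algebraMap ℂ K z ∈ A) ∧ ∃ (t : L) (c : σ → K),
      t ≠ 0 ∧ IsHomFrac w ξ 1 t ∧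
      (∀ k, ξ k = t ^ w k * ψ (c k)) ∧ (∀ k, c k ∈ A) ∧
      (∃ ρ, diffMap c ρ = 0 ∧ eulerForm w c ρ = 1 ∧ ∀ k, ρ k ∈ A) ∧
      (∃ j, gradAt F c j ≠ 0 ∧ (gradAt F c j)⁻¹ ∈ A) ∧
      ∀ a ∈ A, ∃ P Q : MvPolynomial σ ℂ, aeval c Q ≠ 0 ∧
        (aeval c Q)⁻¹ ∈ A ∧ a = aeval c P / aeval c Q

theorem IsConeModel.coord_ne_zero (hM : IsConeModel w F ξ ψ) (hC : IsWellFormedCone w F d) (k : σ) :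
    ξ k ≠ 0 := by
  have := (hM.aeval_eq_zero (X k)).not.2 (hC.not_dvd_X k)
  rwa [aeval_X] at this

theorem IsConeModel.exists_isCoord (hM : IsConeModel w F ξ ψ) (hC : IsWellFormedCone w F d) :
    ∃ (t : L) (c : σ → K), IsCoord w ξ ψ t c := by
  obtain ⟨a, ha⟩ := hC.exists_laurent
  have hξ := hM.coord_ne_zero hC
  have ht1 : IsHomFrac w ξ 1 (∏ k, ξ k ^ a k) := ha ▸ isHomFrac_laurent hξ a
  have ht0 : ∏ k, ξ k ^ a k ≠ 0 :=
    Finset.prod_ne_zero_iff.2 fun k _ => zpow_ne_zero _ (hξ k)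
  obtain ⟨c, hc⟩ := hM.exists_coord ht1 ht0
  obtain ⟨hc0, hc1⟩ := prod_coord_zpow ht0 hc hξ a ha rfl
  exact ⟨_, c, ht0, ht1, hc, _, diffMap_eulerForm_laurent a ha hc0 hc1⟩

variable {t : L} {c : σ → K}

theorem IsCoord.diffMap_surjective (h : IsCoord w ξ ψ t c) (hM : IsConeModel w F ξ ψ) :
    Function.Surjective (diffMap c) :=
  WeightedCY.diffMap_surjective (hM.exists_eq_div h.ne_zero h.eq)

theorem IsCoord.aeval_eq_zero (h : IsCoord w ξ ψ t c) (hM : IsConeModel w F ξ ψ)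
    (hF : IsWeightedHomogeneous w F d) : aeval c F = 0 :=
  (hM.aeval_coord_eq_zero h.ne_zero h.eq hF).2 dvd_rfl

theorem IsCoord.exists_isResidueForm (h : IsCoord w ξ ψ t c) (hM : IsConeModel w F ξ ψ)
    (hC : IsWellFormedCone w F d) (e : Fin 2 ⊕ Fin r ≃ σ) :
    ∃ ω : ⋀[K]^r (Ω[K⁄ℂ]), ω ≠ 0 ∧ IsResidueForm w F e c ω := by
  obtain ⟨j, hj⟩ := hC.exists_not_dvd_pderiv
  obtain ⟨h3, h4, -⟩ := hM.finrank_kaehlerDifferential hC.homogeneous hj h.ne_zero h.eq h.exists_ker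
  refine WeightedCY.exists_isResidueForm hC.homogeneous (h.aeval_eq_zero hM hC.homogeneous)
    (h.diffMap_surjective hM) ?_
    (fun h' => hM.exists_gradAt_ne_zero h.ne_zero h.eq hC.homogeneous hj (congrFun h' j))
    h.exists_ker e
  have := Fintype.card_congr e
  simp only [Fintype.card_sum, Fintype.card_fin] at this
  omega

/-- The residue form generates the differential forms at the points of codimension one, up to
a power of the quotient of two functions of degree one. -/
theorem IsCoord.exists_span_residueForm_eq (h : IsCoord w ξ ψ t c) (hM : IsConeModel w F ξ ψ)
    (hF : IsWeightedHomogeneous w F d) {ω : ⋀[K]^r (Ω[K⁄ℂ])} (hω : IsResidueForm w F e c ω)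
    {A : Subring K} (hA : IsAdapted w F ξ ψ A) :
    ∃ τ : K, τ ≠ 0 ∧ (∀ k, τ ^ w k * c k ∈ A) ∧
      Submodule.span A {τ ^ ((∑ k, w k : ℕ) - d : ℤ) • ω} = regularForms K r A := by
  obtain ⟨hAC, t', c', ht0', ht1', hc', hcx, ⟨ρ, hρ, hlρ, hρx⟩, ⟨j, hj0, hj⟩, hfrac⟩ := hA
  have h' : IsCoord w ξ ψ t' c' := ⟨ht0', ht1', hc', ρ, hρ, hlρ⟩
  -- Here $\tau=t/t'$ compares the given degree-one function with the adapted one.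
  obtain ⟨τ, hτ⟩ := hM.exists_of_isHomFrac (by simpa using h.isHomFrac.mul (ht1'.inv ht0'))
  have hτ0 : τ ≠ 0 := by
    rintro rfl
    rw [map_zero] at hτ
    exact mul_ne_zero h.ne_zero (inv_ne_zero ht0') hτ.symm
  have hcc : c' = fun k => τ ^ w k * c k := funext fun k => by
    apply (ψ).toRingHom.injective
    change ψ _ = ψ _
    rw [map_mul, map_pow, hτ, mul_pow, mul_right_comm, ← h.eq k, hc' k, inv_pow, mul_right_comm,
      mul_inv_cancel₀ (pow_ne_zero _ ht0'), one_mul]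
  have hω' : IsResidueForm w F e c' (τ ^ ((∑ k, w k : ℕ) - d : ℤ) • ω) := by
    rw [hcc]
    refine hω.rescale hF (h.aeval_eq_zero hM hF) (h.diffMap_surjective hM) h.exists_ker hτ0 ?_
    rw [smul_smul, ← zpow_natCast, ← zpow_add₀ hτ0, ← zpow_natCast]
    congr 2
    ring
  refine ⟨τ, hτ0, fun k => ?_, ?_⟩
  · have := hcx k
    rwa [hcc] at this
  · exact hω'.span_eq_regularForms hF (h'.aeval_eq_zero hM hF) hAC ⟨ρ, hρ, hlρ, hρx⟩ hcx hj0 hj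
      hfrac

theorem exists_units_of_span_eq {M V : Type} [Field M] [AddCommGroup V] [Module M V]
    {A : Subring M} {y z : V} (hy : y ≠ 0)
    (h : Submodule.span A {y} = Submodule.span A {z}) :
    ∃ u ∈ A, u⁻¹ ∈ A ∧ u ≠ 0 ∧ y = u • z := by
  obtain ⟨u, hu⟩ := Submodule.mem_span_singleton.1 (h ▸ Submodule.mem_span_singleton_self y :
    y ∈ Submodule.span A {z})
  obtain ⟨v, hv⟩ := Submodule.mem_span_singleton.1 (h ▸ Submodule.mem_span_singleton_self z :
    z ∈ Submodule.span A {y})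
  have hu' : (u : M) • z = y := hu
  have hv' : (v : M) • y = z := hv
  have h1 : ((u : M) * v) • y = y := by rw [mul_smul, hv', hu']
  have h2 : (u : M) * v = 1 := by
    have h3 : ((u : M) * v - 1) • y = 0 := by rw [sub_smul, h1, one_smul, sub_self]
    exact sub_eq_zero.1 ((smul_eq_zero.1 h3).resolve_right hy)
  have hu0 : (u : M) ≠ 0 := left_ne_zero_of_mul (h2 ▸ one_ne_zero)
  refine ⟨u, u.2, ?_, hu0, hu'.symm⟩
  rw [← eq_inv_of_mul_eq_one_right h2]
  exact v.2

/-- A rational form without zeros and poles in codimension one exists only if the degree is the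
sum of the weights. -/
theorem IsConeModel.degree_eq_sum (hM : IsConeModel w F ξ ψ) (hC : IsWellFormedCone w F d)
    {ι : Type} (A : ι → Subring K) (hA : ∀ x, IsAdapted w F ξ ψ (A x))
    (hglob : ∀ z, (∀ x, z ∈ A x) → ∃ y : ℂ, algebraMap ℂ K y = z)
    (hr : r + 2 = Fintype.card σ) {ω : ⋀[K]^r (Ω[K⁄ℂ])} (hω0 : ω ≠ 0)
    (hωx : ∀ x, Submodule.span (A x) {ω} = regularForms K r (A x)) : d = ∑ k, w k := by
  obtain ⟨t, c, hcoord⟩ := hM.exists_isCoord hC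
  have ht0 := hcoord.ne_zero
  have ht1 := hcoord.isHomFrac
  have hc := hcoord.eq
  obtain ⟨j, hj⟩ := hC.exists_not_dvd_pderiv
  obtain ⟨hfr, hfd, -⟩ := hM.finrank_kaehlerDifferential hC.homogeneous hj ht0 hc hcoord.exists_ker
  obtain ⟨e⟩ : Nonempty (Fin 2 ⊕ Fin r ≃ σ) := ⟨Fintype.equivOfCardEq (by simp; omega)⟩
  obtain ⟨ω₀, hω₀, hres⟩ := hcoord.exists_isResidueForm hM hC e
  have hfr' : Module.finrank K (Ω[K⁄ℂ]) = r := by omega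
  obtain ⟨h, rfl⟩ := exists_smul_eq_of_finrank_eq_one
    (by rw [exteriorPower.finrank_eq, hfr', Nat.choose_self]) hω₀ ω
  have hh0 : h ≠ 0 := fun h0 => hω0 (by rw [h0, zero_smul])
  by_contra hne
  set E : ℤ := d - (∑ k, w k : ℕ) with hE
  have hE0 : E ≠ 0 := fun h0 => hne (by omega)
  have hn : 0 < E.natAbs := Int.natAbs_pos.2 hE0
  have hsE : E.sign * E = E.natAbs := Int.sign_mul_self_eq_natAbs E
  have hψ0 : ∀ {z : K}, z ≠ 0 → ψ z ≠ 0 :=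
    fun hz h0 => hz ((ψ).toRingHom.injective (h0.trans (map_zero _).symm))
  -- In an adapted ring with degree-one function $t'$, the comparison of generators gives
  -- $h=u\tau^{-E}$ with $u$ a unit and $\tau=t/t'$. So $\eta=u\,t'^E$ has neither zero nor pole
  -- there.
  set η := ψ h * t ^ E with hη
  have hη0 : η ≠ 0 := mul_ne_zero (hψ0 hh0) (zpow_ne_zero _ ht0)
  have hh1 : IsHomFrac w ξ 0 (ψ h) := by
    obtain ⟨n, P, Q, hP, hQ, hQ0, hz⟩ := (hM.mem_range _).1 ⟨h, rfl⟩
    exact ⟨n, n, P, Q, hP, hQ, hQ0, by simp, hz⟩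
  have hη1 : IsHomFrac w ξ E η := by
    simpa using hh1.mul (ht1.zpow ht0 E)
  -- Both sides have degree $|E|w_k$ because $\operatorname{sign}(E)\,E=|E|$; their quotient is a
  -- function regular in codimension one, hence constant.
  have hz : ∀ k, ∃ z : ℂ, z ≠ 0 ∧ ξ k ^ E.natAbs =
      algebraMap ℂ _ z * η ^ (E.sign * w k) := by
    intro k
    obtain ⟨z, hz⟩ := hM.exists_of_isHomFrac
      (z := ξ k ^ E.natAbs * η ^ (-(E.sign * w k))) (by
        convert ((isHomFrac_apply ξ k).pow E.natAbs).mul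
          (hη1.zpow hη0 (-(E.sign * w k))) using 1
        rw [← hsE]
        ring)
    have hloc : ∀ x, z ∈ A x := by
      intro x
      obtain ⟨τ, hτ0, hcτ, hspan⟩ := hcoord.exists_span_residueForm_eq hM hC.homogeneous hres (hA x)
      obtain ⟨u, hu, hu', hu0, huz⟩ := exists_units_of_span_eq hω0 ((hωx x).trans hspan.symm)
      have hhu : h = u * τ ^ (-E) := by
        rw [smul_smul] at huz
        rw [smul_left_injective K hω₀ huz]
        congr 2
        omega
      have hzu : z = (τ ^ w k * c k) ^ E.natAbs * u ^ (-(E.sign * w k)) := by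
        apply (ψ).toRingHom.injective
        change ψ _ = ψ _
        rw [hz, hc k, hη, hhu]
        simp only [map_mul, map_pow, map_zpow₀, mul_pow, mul_zpow]
        have h4 : (t ^ w k) ^ E.natAbs * (t ^ E) ^ (-(E.sign * w k)) = 1 := by
          rw [← pow_mul, ← zpow_natCast, ← zpow_mul, ← zpow_add₀ ht0]
          convert zpow_zero t
          push_cast
          rw [← Int.natCast_natAbs, ← hsE]
          ring
        have h5 : (ψ τ ^ (-E)) ^ (-(E.sign * w k)) =
            (ψ τ ^ w k) ^ E.natAbs := by
          rw [← pow_mul, ← zpow_natCast, ← zpow_mul]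
          congr 1
          push_cast
          rw [← Int.natCast_natAbs, ← hsE]
          ring
        rw [h5]
        linear_combination (ψ (c k) ^ E.natAbs *
          ψ u ^ (-(E.sign * ↑(w k))) * (ψ τ ^ w k) ^ E.natAbs) * h4
      rw [hzu]
      refine Subring.mul_mem _ (Subring.pow_mem _ (hcτ k) _) ?_
      have := prod_zpow_mem (A x) ({k} : Finset σ) (fun _ => u) (fun _ => -(E.sign * w k))
        fun _ _ _ => ⟨hu, hu'⟩
      simpa using this
    obtain ⟨y, hy⟩ := hglob z hloc
    have hy' : algebraMap ℂ _ y = ξ k ^ E.natAbs * η ^ (-(E.sign * w k)) := by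
      rw [← hz, ← hy]
      exact ((ψ).commutes y).symm
    refine ⟨y, ?_, ?_⟩
    · rintro rfl
      rw [map_zero] at hy'
      exact mul_ne_zero (pow_ne_zero _ (hM.coord_ne_zero hC k)) (zpow_ne_zero _ hη0) hy'.symm
    · rw [hy', mul_assoc, ← zpow_add₀ hη0, neg_add_cancel, zpow_zero, mul_one]
  choose lam hlam0 hlam using hz
  -- Eliminating $\eta$ between the relations for $k$ and $l$ leaves a binomial in $\xi_k,\xi_l$.
  refine not_forall_dvd_binomial hC.homogeneous hC.degree_pos hC.prime.ne_zero hC.card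
    fun k l hkl => ⟨E.natAbs * w l, E.natAbs * w k, lam l ^ w k, lam k ^ w l,
      Nat.mul_pos hn (hC.pos l), Nat.mul_pos hn (hC.pos k), pow_ne_zero _ (hlam0 l), ?_⟩
  rw [← hM.aeval_eq_zero]
  simp only [map_sub, map_mul, map_pow, aeval_C, aeval_X, pow_mul]
  rw [hlam k, hlam l, mul_pow, mul_pow, ← zpow_natCast (η ^ _), ← zpow_natCast (η ^ (E.sign * w l)),
    ← zpow_mul, ← zpow_mul, mul_right_comm _ (w k : ℤ)]
  ring

end Canonical

/-! ### Dimension, constancy of functions, and degree for the actual hypersurface. -/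

section Hypersurface

variable {σ : Type} [Fintype σ] [DecidableEq σ] {w : σ → ℕ} {F : MvPolynomial σ ℂ} {d : ℕ}
  [IsDomain (CoordRing F)] [GradedAlgebra (coordGrading w F)]
  [IsIntegral (Proj (coordGrading w F))]

attribute [local instance] projFunctionFieldAlgebra

theorem IsWellFormedCone.isConeModel (hC : IsWellFormedCone w F d) :
    IsConeModel w F (coneCoord F) (projToCone w F) := by
  obtain ⟨i₀⟩ := hC.nonempty
  exact WeightedCY.isConeModel (hC.pos i₀) (hC.not_dvd_X i₀)

theorem isAdapted_localSubring (hC : IsWellFormedCone w F d) (x : Proj (coordGrading w F))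
    (hx : ringKrullDim ((Proj (coordGrading w F)).presheaf.stalk x) = 1) :
    IsAdapted w F (coneCoord F) (projToCone w F) (localSubring x) :=
  ⟨algebraMap_mem_localSubring x, exists_local_coord hC x hx⟩

theorem varietyDim_projToSpec (hC : IsWellFormedCone w F d) :
    varietyDim (projToSpec w F) + 2 = Fintype.card σ := by
  obtain ⟨t, c, h⟩ := hC.isConeModel.exists_isCoord hC
  obtain ⟨j, hj⟩ := hC.exists_not_dvd_pderiv
  obtain ⟨h3, -, h5⟩ :=
    hC.isConeModel.finrank_kaehlerDifferential hC.homogeneous hj h.ne_zero h.eq h.exists_ker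
  change Cardinal.toNat (Algebra.trdeg ℂ (Proj (coordGrading w F)).functionField) + 2 = _
  rw [h5, Cardinal.toNat_natCast, h3]

theorem exists_algebraMap_eq_of_codim_one (hC : IsWellFormedCone w F d)
    [IsProper (projToSpec w F)] {z : (Proj (coordGrading w F)).functionField}
    (hz : ∀ x : Proj (coordGrading w F),
      ringKrullDim ((Proj (coordGrading w F)).presheaf.stalk x) = 1 → z ∈ localSubring x) :
    ∃ y : ℂ, algebraMap ℂ _ y = z := by
  have : IsLocallyNoetherian (Proj (coordGrading w F)) :=
    LocallyOfFiniteType.isLocallyNoetherian (projToSpec w F)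
  exact exists_algebraMap_eq_of_isProper (projToSpec w F)
    (mem_localSubring_of_forall_codim_one (isIntegrallyClosed_stalk_proj hC) hz)

/-- A well-formed hypersurface with trivial canonical sheaf has degree the sum of the weights. -/
theorem degree_eq_sum_of_trivialCanonicalSheaf (hC : IsWellFormedCone w F d)
    [IsProper (projToSpec w F)]
    (hcan : HasTrivialCanonicalSheafAndCanonicalSingularities (projToSpec w F)) :
    d = ∑ k, w k := by
  obtain ⟨ω, hω0, hωx, -⟩ := hcan
  exact hC.isConeModel.degree_eq_sum hC
    (ι := {x : Proj (coordGrading w F) //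
      ringKrullDim ((Proj (coordGrading w F)).presheaf.stalk x) = 1})
    (fun x => localSubring x.1) (fun x => isAdapted_localSubring hC x.1 x.2)
    (fun z hz => exists_algebraMap_eq_of_codim_one hC fun x hx => hz ⟨x, hx⟩)
    (varietyDim_projToSpec hC) hω0 fun x => hωx x.1 x.2

end Hypersurface


/-! ### Logarithmic forms along a discrete valuation ring. -/

section Discrete

variable {K : Type} [Field K] [Algebra ℂ K] {V : Subalgebra ℂ K}

/-- A uniformizer of a discrete valuation subring. -/
theorem exists_uniformizer (hd : IsDiscreteValuationRing V) (hf : IsFractionRing V K) :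
    ∃ p ∈ V, p ≠ 0 ∧ (∀ y : K, y ≠ 0 → ∃ (n : ℤ) (u : K), u ∈ V ∧ u⁻¹ ∈ V ∧ u ≠ 0 ∧
      y = p ^ n * u) ∧ ∀ y ∈ V, y⁻¹ ∉ V → ∃ g ∈ V, y = p * g := by
  obtain ⟨p, hp⟩ := IsDiscreteValuationRing.exists_irreducible V
  have hp0 : (p : K) ≠ 0 := fun h => hp.ne_zero (Subtype.ext h)
  have hunit : ∀ u : Vˣ, ((u : V) : K)⁻¹ ∈ V := fun u => by
    have h1 : ((u : V) : K) * ((u⁻¹ : Vˣ) : V) = 1 := congrArg Subtype.val u.mul_inv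
    rw [← eq_inv_of_mul_eq_one_right h1]
    exact ((u⁻¹ : Vˣ) : V).2
  have hunit0 : ∀ u : Vˣ, ((u : V) : K) ≠ 0 := fun u h => u.ne_zero (Subtype.ext h)
  have hV : ∀ y : V, y ≠ 0 → ∃ (n : ℕ) (u : Vˣ), (y : K) = (u : V) * (p : K) ^ n := fun y hy => by
    obtain ⟨n, u, h⟩ := IsDiscreteValuationRing.eq_unit_mul_pow_irreducible hy hp
    exact ⟨n, u, by rw [h]; rfl⟩
  refine ⟨p, p.2, hp0, fun y hy => ?_, fun y hy hy' => ?_⟩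
  · obtain ⟨a, b, hb, rfl⟩ := IsFractionRing.div_surjective (A := V) y
    have hb0 := nonZeroDivisors.ne_zero hb
    have ha0 : a ≠ 0 := by
      rintro rfl
      simp at hy
    obtain ⟨n, u, hu⟩ := hV a ha0
    obtain ⟨n', u', hu'⟩ := hV b hb0
    refine ⟨n - n', (u : V) * ((u' : V) : K)⁻¹, mul_mem (u : V).2 (hunit u'), ?_,
      mul_ne_zero (hunit0 u) (inv_ne_zero (hunit0 u')), ?_⟩
    · rw [mul_inv, inv_inv]
      exact mul_mem (hunit u) (u' : V).2
    · change (a : K) / (b : K) = _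
      rw [hu, hu', zpow_sub₀ hp0, zpow_natCast, zpow_natCast]
      have := hunit0 u'
      field_simp
  · by_cases h0 : (⟨y, hy⟩ : V) = 0
    · exact ⟨0, V.zero_mem, by rw [mul_zero]; exact congrArg Subtype.val h0⟩
    obtain ⟨n, u, hu⟩ := hV ⟨y, hy⟩ h0
    have hu : y = (u : V) * (p : K) ^ n := hu
    cases n with
    | zero =>
      rw [pow_zero, mul_one] at hu
      exact absurd (hu ▸ hunit u) hy'
    | succ n =>
      exact ⟨(u : V) * (p : K) ^ n, mul_mem (u : V).2 (pow_mem p.2 n), by rw [hu, pow_succ]; ring⟩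

/-- A logarithmic form becomes regular when it is multiplied by the uniformizer. -/
theorem uniformizer_smul_dlog_mem {r : ℕ} {p : K} (hp : p ∈ V) (hp0 : p ≠ 0)
    (y : Fin r → K) (hy : ∀ i, ∃ (n : ℤ) (u : K), u ∈ V ∧ u⁻¹ ∈ V ∧ u ≠ 0 ∧ y i = p ^ n * u) :
    p • exteriorPower.ιMulti K r (fun i => (y i)⁻¹ • KaehlerDifferential.D ℂ K (y i)) ∈
      regularForms K r V.toSubring := by
  classical
  choose n u hu hu' hu0 hyu using hy
  -- With $y=p^nu$ one has $dy/y=n\,dp/p+du/u$. In the expanded wedge a term with two factors $dp$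
  -- vanishes, so at most one pole $p^{-1}$ survives.
  have h1 : (fun i => (y i)⁻¹ • KaehlerDifferential.D ℂ K (y i)) =
      (fun i => ((n i : K) * p⁻¹) • KaehlerDifferential.D ℂ K p) +
        fun i => (u i)⁻¹ • KaehlerDifferential.D ℂ K (u i) := by
    funext i
    rw [Pi.add_apply, hyu, Derivation.leibniz, Derivation.leibniz_zpow, smul_add, smul_smul,
      smul_smul, ← Int.cast_smul_eq_zsmul K, smul_smul, smul_smul, add_comm]
    congr 2
    · rw [zpow_sub_one₀ hp0]
      have := hu0 i
      have := zpow_ne_zero (n i) hp0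
      field_simp
    · have := hu0 i
      have := zpow_ne_zero (n i) hp0
      field_simp
  have h2 := (exteriorPower.ιMulti K r (M := Ω[K⁄ℂ])).toMultilinearMap.map_add_univ
    (fun i => ((n i : K) * p⁻¹) • KaehlerDifferential.D ℂ K p)
    (fun i => (u i)⁻¹ • KaehlerDifferential.D ℂ K (u i))
  rw [h1]
  refine (congrArg (p • ·) h2).symm ▸ ?_
  simp only [Finset.smul_sum]
  refine Submodule.sum_mem _ fun s _ => ?_
  have h3 : s.piecewise (fun i => ((n i : K) * p⁻¹) • KaehlerDifferential.D ℂ K p)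
      (fun i => (u i)⁻¹ • KaehlerDifferential.D ℂ K (u i)) =
      fun i => (if i ∈ s then (n i : K) * p⁻¹ else (u i)⁻¹) •
        KaehlerDifferential.D ℂ K (if i ∈ s then p else u i) := by
    funext i
    by_cases hi : i ∈ s <;> simp [hi]
  rw [h3, MultilinearMap.map_smul_univ, smul_smul]
  by_cases hs : 1 < s.card
  · obtain ⟨i, hi, k, hk, hik⟩ := Finset.one_lt_card.1 hs
    have h4 : (exteriorPower.ιMulti K r (M := Ω[K⁄ℂ])).toMultilinearMap
        (fun i => KaehlerDifferential.D ℂ K (if i ∈ s then p else u i)) = 0 :=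
      AlternatingMap.map_eq_zero_of_eq _ _ (i := i) (j := k) (by simp [hi, hk]) hik
    rw [h4, smul_zero]
    exact Submodule.zero_mem _
  · refine smul_mem_regularForms ?_ (Submodule.subset_span ⟨fun i => ⟨if i ∈ s then p else u i, ?_⟩,
      rfl⟩)
    · rw [Finset.prod_ite, Finset.filter_mem_eq_inter, Finset.univ_inter]
      have h5 : ∏ i with i ∉ s, (u i)⁻¹ ∈ V := prod_mem fun i _ => hu' i
      rw [← mul_assoc]
      refine V.toSubring.mul_mem ?_ h5
      rcases Nat.le_one_iff_eq_zero_or_eq_one.1 (not_lt.1 hs) with h | h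
      · obtain rfl := Finset.card_eq_zero.1 h
        simpa using hp
      · obtain ⟨i, rfl⟩ := Finset.card_eq_one.1 h
        rw [Finset.prod_singleton, mul_left_comm, mul_inv_cancel₀ hp0, mul_one]
        exact intCast_mem _ _
    · split_ifs
      exacts [hp, hu i]

end Discrete


/-! ### Weighted orders of coordinates and partial derivatives. -/

section Valuation

variable {K : Type} [Field K] [Algebra ℂ K] {σ : Type} [Fintype σ] [DecidableEq σ]
  {w : σ → ℕ} {F : MvPolynomial σ ℂ} {d : ℕ} {Γ : Type} [LinearOrderedCommGroupWithZero Γ]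
  {v : Valuation K Γ} {c : σ → K} {q : ℕ} {s : Γ}

/-- The weighted sizes $y_k^{1/w_k}$ are compared without roots, through $y_k^{P/w_k}$ with $P=\prod
w_k$. -/
theorem exists_dominant (hw : ∀ k, 0 < w k) [Nonempty σ] (y : σ → Γ) :
    ∃ k₀, ∀ k, y k ^ w k₀ ≤ y k₀ ^ w k := by
  set P := ∏ k, w k with hP
  have hP0 : 0 < P := Finset.prod_pos fun k _ => hw k
  have hdvd : ∀ k, w k ∣ P := fun k => Finset.dvd_prod_of_mem w (Finset.mem_univ k)
  obtain ⟨k₀, -, h⟩ := Finset.exists_max_image Finset.univ (fun k => y k ^ (P / w k))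
    Finset.univ_nonempty
  refine ⟨k₀, fun k => ?_⟩
  have h1 := pow_le_pow_left₀ zero_le (h k (Finset.mem_univ k)) (w k * w k₀)
  rw [← pow_mul, ← pow_mul, ← mul_assoc, Nat.div_mul_cancel (hdvd k), mul_comm (w k), ← mul_assoc,
    Nat.div_mul_cancel (hdvd k₀), mul_comm P, mul_comm P, pow_mul, pow_mul] at h1
  exact (pow_le_pow_iff_left₀ zero_le zero_le hP0.ne').1 h1

theorem valuation_sum_pow_le {ι : Type} (t : Finset ι) (f : ι → K) {g : Γ} (hq : q ≠ 0)
    (h : ∀ i ∈ t, v (f i) ^ q ≤ g) : v (∑ i ∈ t, f i) ^ q ≤ g := by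
  classical
  induction t using Finset.induction_on with
  | empty => simp [hq]
  | insert i t hi ih =>
    rw [Finset.sum_insert hi]
    have h1 := ih fun k hk => h k (Finset.mem_insert_of_mem hk)
    have h2 := h i (Finset.mem_insert_self i t)
    rcases le_max_iff.1 (v.map_add (f i) (∑ k ∈ t, f k)) with h3 | h3
    · exact (pow_le_pow_left₀ zero_le h3 q).trans h2
    · exact (pow_le_pow_left₀ zero_le h3 q).trans h1

theorem valuation_sum_pow_lt {ι : Type} (t : Finset ι) (f : ι → K) {g : Γ} (hq : q ≠ 0)
    (hg : 0 < g) (h : ∀ i ∈ t, v (f i) ^ q < g) : v (∑ i ∈ t, f i) ^ q < g := by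
  classical
  induction t using Finset.induction_on with
  | empty => simpa [hq] using hg
  | insert i t hi ih =>
    rw [Finset.sum_insert hi]
    have h1 := ih fun k hk => h k (Finset.mem_insert_of_mem hk)
    have h2 := h i (Finset.mem_insert_self i t)
    rcases le_max_iff.1 (v.map_add (f i) (∑ k ∈ t, f k)) with h3 | h3
    · exact (pow_le_pow_left₀ zero_le h3 q).trans_lt h2
    · exact (pow_le_pow_left₀ zero_le h3 q).trans_lt h1

theorem valuation_aeval_pow_le (hv : ∀ z : ℂ, v (algebraMap ℂ K z) ≤ 1) (hq : q ≠ 0)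
    (hs : ∀ k, v (c k) ^ q ≤ s ^ w k) {P : MvPolynomial σ ℂ} {n : ℕ}
    (hP : IsWeightedHomogeneous w P n) : v (aeval c P) ^ q ≤ s ^ n := by
  rw [aeval_def, eval₂_eq']
  refine valuation_sum_pow_le _ _ hq fun a ha => ?_
  have hw : Finsupp.weight w a = n := hP (mem_support_iff.1 ha)
  rw [Finsupp.weight_apply, Finsupp.sum_fintype _ _ (by simp)] at hw
  rw [map_mul, mul_pow, map_prod, ← hw, ← Finset.prod_pow_eq_pow_sum, ← Finset.prod_pow]
  refine (mul_le_mul' (pow_le_one₀ zero_le (hv _)) (Finset.prod_le_prod' fun k _ => ?_)).trans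
    (one_mul _).le
  rw [map_pow, ← pow_mul, mul_comm, pow_mul, smul_eq_mul, mul_comm (a k), pow_mul]
  exact pow_le_pow_left₀ zero_le (hs k) _

/-- Some partial derivative has minimal order with respect to the weighted order. -/
theorem exists_dominant_pderiv (hC : IsWellFormedCone w F d)
    (hv : ∀ z : ℂ, v (algebraMap ℂ K z) ≤ 1) {k₀ : σ} (hc0 : c k₀ ≠ 0)
    (hs : ∀ k, v (c k) ^ w k₀ ≤ v (c k₀) ^ w k) :
    ∃ j, pderiv j F ≠ 0 ∧ v (c k₀) ^ (d - w j) ≤ v (gradAt F c j) ^ w k₀ := by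
  by_contra! hcon
  set s := v (c k₀) with hs'
  have hs0 : 0 < s := zero_lt_iff.2 (v.ne_zero_iff.2 hc0)
  have hq := (hC.pos k₀).ne'
  -- In $x_{k_0}^M=\sum_jA_j\,\partial_jF$ with homogeneous coefficients, the dominance of $k_0$
  -- bounds each $A_j$. If all partial derivatives were too small, the right side would be strictly
  -- smaller than the left.
  obtain ⟨M, hM⟩ := exists_pow_mem_span_pderiv hC.homogeneous hC.degree_pos hC.nondegenerate k₀
  obtain ⟨A, hA⟩ := (Submodule.mem_span_range_iff_exists_fun (MvPolynomial σ ℂ)).1 hM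
  have hX : IsWeightedHomogeneous w (X k₀ ^ M : MvPolynomial σ ℂ) (M * w k₀) := by
    simpa using (isWeightedHomogeneous_X ℂ w k₀).pow M
  have h1 := congrArg (weightedHomogeneousComponent w (M * w k₀)) hA
  rw [map_sum, weightedHomogeneousComponent_of_mem hX, if_pos rfl] at h1
  have h2 : ∀ j, v (aeval c (weightedHomogeneousComponent w (M * w k₀) (A j • pderiv j F))) ^ w k₀ <
      s ^ (M * w k₀) := by
    intro j
    by_cases h0 : pderiv j F = 0
    · rw [h0, smul_zero, map_zero, map_zero, map_zero, zero_pow hq]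
      exact pow_pos hs0 _
    have hle := isWeightedHomogeneous_pderiv_ne_zero hC.homogeneous h0
    have hp : IsWeightedHomogeneous w (pderiv j F) (d - w j) :=
      hC.homogeneous.pderiv (by omega)
    obtain ⟨A', hA', h⟩ := weightedHomogeneousComponent_mul_of_isWeightedHomogeneous
      (A := A j) hp (M * w k₀)
    rw [smul_eq_mul, hA', map_mul, map_mul, mul_pow]
    rcases h with rfl | ⟨m, hm, hAm⟩
    · rw [map_zero, map_zero, zero_pow hq, zero_mul]
      exact pow_pos hs0 _
    · rw [← hm, pow_add]
      exact mul_lt_mul_of_le_of_lt_of_nonneg_of_pos (valuation_aeval_pow_le hv hq hs hAm)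
        (hcon j h0) zero_le (pow_pos hs0 _)
  have h3 := valuation_sum_pow_lt Finset.univ _ hq (pow_pos hs0 _) fun j _ => h2 j
  rw [← map_sum, h1, map_pow, aeval_X, map_pow, ← pow_mul] at h3
  exact lt_irrefl _ h3

theorem eq_of_prod_le_prod {ι : Type} [DecidableEq ι] (t : Finset ι) {f g : ι → Γ}
    (hg : ∀ i ∈ t, 0 < g i)
    (hfg : ∀ i ∈ t, f i ≤ g i) (h : ∏ i ∈ t, g i ≤ ∏ i ∈ t, f i) {i : ι} (hi : i ∈ t) :
    f i = g i := by
  refine le_antisymm (hfg i hi) ?_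
  rw [← Finset.mul_prod_erase t g hi, ← Finset.mul_prod_erase t f hi] at h
  have h1 : 0 < ∏ k ∈ t.erase i, g k := Finset.prod_pos fun k hk => hg k (Finset.mem_of_mem_erase hk)
  refine le_of_mul_le_mul_right (h.trans ?_) h1
  exact mul_le_mul_right (Finset.prod_le_prod' fun k hk => hfg k (Finset.mem_of_mem_erase hk)) _

end Valuation

/-! ### Regularity of the residue form along all discrete valuation rings. -/

section CanonicalSingularities

variable {σ : Type} [Fintype σ] [DecidableEq σ] {w : σ → ℕ} {F : MvPolynomial σ ℂ} {d : ℕ}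
  {K L : Type} [Field K] [Algebra ℂ K] [Field L] [Algebra ℂ L] {ξ : σ → L} {ψ : K →ₐ[ℂ] L}
  {r : ℕ} {e : Fin 2 ⊕ Fin r ≃ σ} {t : L} {c : σ → K}

theorem IsCoord.coord_ne_zero (h : IsCoord w ξ ψ t c) (hM : IsConeModel w F ξ ψ)
    (hC : IsWellFormedCone w F d) (k : σ) : c k ≠ 0 := fun h0 =>
  hM.coord_ne_zero hC k (by rw [h.eq k, h0, map_zero, mul_zero])

/-- Coordinates with respect to a Laurent monomial. -/
theorem IsCoord.exists_rescale_laurent (h : IsCoord w ξ ψ t c) (hM : IsConeModel w F ξ ψ)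
    (hC : IsWellFormedCone w F d) {a : σ → ℤ} (ha : ∑ k, a k * (w k : ℤ) = 1) :
    ∃ τ : K, τ ≠ 0 ∧ ∏ k, (τ ^ w k * c k) ^ a k = 1 ∧
      ∃ t', IsCoord w ξ ψ t' (fun k => τ ^ w k * c k) := by
  have hξ := hM.coord_ne_zero hC
  have ht1 : IsHomFrac w ξ 1 (∏ k, ξ k ^ a k) := ha ▸ isHomFrac_laurent hξ a
  have ht0 : ∏ k, ξ k ^ a k ≠ 0 :=
    Finset.prod_ne_zero_iff.2 fun k _ => zpow_ne_zero _ (hξ k)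
  obtain ⟨τ, hτ⟩ := hM.exists_of_isHomFrac (by simpa using h.isHomFrac.mul (ht1.inv ht0))
  have hτ0 : τ ≠ 0 := by
    rintro rfl
    rw [map_zero] at hτ
    exact mul_ne_zero h.ne_zero (inv_ne_zero ht0) hτ.symm
  have hc : ∀ k, ξ k = (∏ k, ξ k ^ a k) ^ w k * ψ (τ ^ w k * c k) := fun k => by
    rw [map_mul, map_pow, hτ, mul_pow, inv_pow, mul_comm (t ^ w k), mul_assoc,
      mul_inv_cancel_left₀ (pow_ne_zero _ ht0), ← h.eq k]
  obtain ⟨hc0, hc1⟩ := prod_coord_zpow ht0 hc hξ a ha rfl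
  exact ⟨τ, hτ0, hc1, _, ht0, ht1, hc, _, diffMap_eulerForm_laurent a ha hc0 hc1⟩

/-- In degree the sum of the weights, the residue form is regular along every discrete valuation
ring. -/
theorem IsCoord.residueForm_mem_regularForms (h : IsCoord w ξ ψ t c) (hM : IsConeModel w F ξ ψ)
    (hC : IsWellFormedCone w F d) (hd : d = ∑ k, w k) {ω : ⋀[K]^r (Ω[K⁄ℂ])}
    (hω : IsResidueForm w F e c ω) {V : Subalgebra ℂ K} (hV : IsDiscreteValuationRing V)
    (hf : IsFractionRing V K) : ω ∈ regularForms K r V.toSubring := by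
  set v := ValuationRing.valuation V K with hvdef
  have hvV : ∀ x : K, x ∈ V ↔ v x ≤ 1 := fun x => by
    rw [hvdef, ← Valuation.mem_integer_iff, ValuationRing.mem_integer_iff]
    exact ⟨fun hx => ⟨⟨x, hx⟩, rfl⟩, by rintro ⟨a, rfl⟩; exact a.2⟩
  have hvC : ∀ z : ℂ, v (algebraMap ℂ K z) ≤ 1 := fun z => (hvV _).1 (V.algebraMap_mem z)
  have hc0 := h.coord_ne_zero hM hC
  have hcF := h.aeval_eq_zero hM hC.homogeneous
  have hne := hC.nonempty
  obtain ⟨k₀, hk₀⟩ := exists_dominant hC.pos fun k => v (c k)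
  obtain ⟨j, hj0, hj⟩ := exists_dominant_pderiv hC hvC (hc0 k₀) hk₀
  set s := v (c k₀) with hs
  set q := w k₀ with hq
  have hq0 : q ≠ 0 := (hC.pos k₀).ne'
  have hs0 : 0 < s := zero_lt_iff.2 (v.ne_zero_iff.2 (hc0 k₀))
  have hjle := isWeightedHomogeneous_pderiv_ne_zero hC.homogeneous hj0
  have hg0 : gradAt F c j ≠ 0 := fun h0 => by
    rw [h0, map_zero, zero_pow hq0] at hj
    exact absurd hj (not_le.2 (pow_pos hs0 _))
  -- The equality $d=\sum w$ enters here: the weights other than $w_j$ add up to $d-w_j$.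
  have hdj : ∏ l ∈ Finset.univ.erase j, s ^ w l = s ^ (d - w j) := by
    rw [Finset.prod_pow_eq_pow_sum, hd, ← Finset.add_sum_erase _ _ (Finset.mem_univ j),
      Nat.add_sub_cancel_left]
  set f := (∏ l ∈ Finset.univ.erase j, c l) / gradAt F c j with hfdef
  have hfle : v f ≤ 1 := by
    refine (pow_le_one_iff_of_nonneg zero_le hq0).1 ?_
    rw [hfdef, map_div₀, div_pow, map_prod, ← Finset.prod_pow]
    refine div_le_one_of_le₀ (le_trans ?_ hj) zero_le
    rw [← hdj]
    exact Finset.prod_le_prod' fun k _ => hk₀ k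
  by_cases hfV : f⁻¹ ∈ V
  -- When $f$ is a unit all the inequalities are equalities: every coordinate except possibly $c_j$
  -- has size exactly proportional to its weight.
  · have hge : ∏ l ∈ Finset.univ.erase j, s ^ w l ≤ ∏ l ∈ Finset.univ.erase j, v (c l) ^ q := by
      rw [hdj, Finset.prod_pow, ← map_prod]
      refine hj.trans (pow_le_pow_left₀ zero_le ?_ q)
      have h1 := (hvV _).1 hfV
      rw [hfdef, inv_div, map_div₀] at h1
      exact (div_le_one₀ (zero_lt_iff.2 (v.ne_zero_iff.2
        (Finset.prod_ne_zero_iff.2 fun l _ => hc0 l)))).1 h1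
    have heq : ∀ l, l ≠ j → v (c l) ^ q = s ^ w l := fun l hl =>
      eq_of_prod_le_prod _ (fun i _ => pow_pos hs0 _) (fun i _ => hk₀ i) hge
        (Finset.mem_erase.2 ⟨hl, Finset.mem_univ l⟩)
    -- Normalization gives a Laurent monomial of degree one without $x_j$. Scaling it to $1$ forces
    -- $\theta=1$, so the new coordinates lie in $V$ and $\partial_jF$ is invertible in $V$; as
    -- $d=\sum w$, the form does not change.
    obtain ⟨a, haj, ha⟩ := exists_sum_mul_eq_gcd w (Finset.univ.erase j)
    rw [hC.wellFormed.1 j, Nat.cast_one] at ha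
    have haj := haj j (by simp)
    obtain ⟨τ, hτ0, hprod, t', h'⟩ := h.exists_rescale_laurent hM hC ha
    set θ := v τ ^ q * s with hθ
    have hvτ0 : v τ ≠ 0 := v.ne_zero_iff.2 hτ0
    have hθ0 : θ ≠ 0 := mul_ne_zero (pow_ne_zero _ hvτ0) hs0.ne'
    have hpow : ∀ k, v (τ ^ w k * c k) ^ q = v τ ^ (q * w k) * v (c k) ^ q := fun k => by
      rw [map_mul, map_pow, mul_pow, ← pow_mul, mul_comm q]
    have hθpow : ∀ n, θ ^ n = v τ ^ (q * n) * s ^ n := fun n => by rw [hθ, mul_pow, ← pow_mul]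
    have hθ1 : θ = 1 := by
      have h1 := congrArg (fun x => v x ^ q) hprod
      simp only [map_prod, map_one, one_pow, map_zpow₀, ← Finset.prod_pow] at h1
      have h2 : ∏ k, (v (τ ^ w k * c k) ^ a k) ^ q = ∏ k, θ ^ (a k * (w k : ℤ)) := by
        refine Finset.prod_congr rfl fun k _ => ?_
        by_cases hk : k = j
        · rw [hk, haj, zero_mul, zpow_zero, zpow_zero, one_pow]
        · rw [← zpow_natCast, zpow_comm, zpow_natCast, hpow, heq k hk, ← hθpow, ← zpow_natCast,
            ← zpow_mul, mul_comm]
      rw [h2, prod_zpow_eq_zpow_sum hθ0, ha, zpow_one] at h1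
      exact h1
    have hcV : ∀ k, τ ^ w k * c k ∈ V := fun k => by
      rw [hvV]
      refine (pow_le_one_iff_of_nonneg zero_le hq0).1 ?_
      rw [hpow]
      refine (mul_le_mul_right (hk₀ k) _).trans ?_
      rw [← hθpow, hθ1, one_pow]
    have hgrad : v (gradAt F (fun k => τ ^ w k * c k) j) = v τ ^ (d - w j) * v (gradAt F c j) := by
      have h1 := congrArg v (pow_mul_gradAt (c := c) hC.homogeneous τ j)
      rw [map_mul, map_mul, map_pow, map_pow, ← Nat.add_sub_cancel' hjle, pow_add, mul_assoc] at h1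
      exact mul_left_cancel₀ (pow_ne_zero _ hvτ0) h1
    have hω' : IsResidueForm w F e (fun k => τ ^ w k * c k) ω :=
      hω.rescale hC.homogeneous hcF (h.diffMap_surjective hM) h.exists_ker hτ0 (by rw [hd])
    have hgrad0 : gradAt F (fun k => τ ^ w k * c k) j ≠ 0 := by
      rw [← v.ne_zero_iff, hgrad]
      exact mul_ne_zero (pow_ne_zero _ hvτ0) (v.ne_zero_iff.2 hg0)
    refine hω'.mem_regularForms hC.homogeneous (h'.aeval_eq_zero hM hC.homogeneous) h'.exists_ker
      hcV hgrad0 ?_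
    change _ ∈ V
    rw [hvV, map_inv₀]
    refine inv_le_one_of_one_le₀ ?_
    refine (one_le_pow_iff_of_nonneg zero_le hq0).1 ?_
    rw [hgrad, mul_pow, ← pow_mul, mul_comm _ q]
    refine le_trans ?_ (mul_le_mul_right hj _)
    rw [← hθpow, hθ1, one_pow]
  -- When $f$ is not a unit, the expansion writes $\omega$ as a sum of terms $\pm
  -- w_k\,f\bigwedge_{l\ne j,k}dc_l/c_l$, and the factor $p$ of $f$ removes the logarithmic pole.
  · obtain ⟨p, hp, hp0, hpu, hpd⟩ := exists_uniformizer hV hf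
    obtain ⟨g, hg, hfg⟩ := hpd f ((hvV f).2 hfle) hfV
    obtain ⟨S, ε, hS, hexp⟩ := hω.expansion hC.homogeneous hcF h.exists_ker j
    have h1 : ω = (gradAt F c j)⁻¹ • gradAt F c j • ω := by
      rw [smul_smul, inv_mul_cancel₀ hg0, one_smul]
    rw [h1, hexp, Finset.smul_sum]
    refine Submodule.sum_mem _ fun k hk => ?_
    obtain ⟨hcov, hinj, hSj, hSk⟩ := hS k (Finset.ne_of_mem_erase hk)
    have h2 : exteriorPower.ιMulti K r (fun i => KaehlerDifferential.D ℂ K (c (S k i))) =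
        (∏ i, c (S k i)) • exteriorPower.ιMulti K r
          (fun i => (c (S k i))⁻¹ • KaehlerDifferential.D ℂ K (c (S k i))) := by
      have h3 := (exteriorPower.ιMulti K r (M := Ω[K⁄ℂ])).toMultilinearMap.map_smul_univ
        (fun i => c (S k i)) (fun i => (c (S k i))⁻¹ • KaehlerDifferential.D ℂ K (c (S k i)))
      refine Eq.trans ?_ h3
      simp only [smul_smul, mul_inv_cancel₀ (hc0 _), one_smul]
      rfl
    have h4 : c k * ∏ i, c (S k i) = ∏ l ∈ Finset.univ.erase j, c l := by
      rw [← Finset.mul_prod_erase _ _ hk]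
      congr 1
      rw [← Finset.prod_image (g := S k) (f := c) (s := Finset.univ) hinj.injOn]
      refine Finset.prod_congr ?_ fun _ _ => rfl
      ext l
      have hl : l ∈ ({j} ∪ {k} ∪ Set.range (S k) : Set σ) := hcov ▸ Set.mem_univ l
      simp only [Set.union_singleton, Set.mem_union, Set.mem_insert_iff, Set.mem_singleton_iff,
        Set.mem_range] at hl
      simp only [Finset.mem_image, Finset.mem_univ, true_and, Finset.mem_erase, and_true]
      constructor
      · rintro ⟨i, rfl⟩
        exact ⟨hSk i, hSj i⟩
      · rintro ⟨hlk, hlj⟩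
        tauto
    rw [h2, smul_smul, smul_smul]
    have h5 : (gradAt F c j)⁻¹ * ((w k : K) * c k * ((ε k : ℤ) : K) * ∏ i, c (S k i)) =
        ((w k : K) * ((ε k : ℤ) : K) * g) * p := by
      have h6 : (w k : K) * c k * ((ε k : ℤ) : K) * ∏ i, c (S k i) =
          (w k : K) * ((ε k : ℤ) : K) * ∏ l ∈ Finset.univ.erase j, c l := by
        rw [← h4]; ring
      have h7 : (gradAt F c j)⁻¹ * ∏ l ∈ Finset.univ.erase j, c l = g * p := by
        rw [mul_comm g, ← hfg, hfdef, div_eq_inv_mul]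
      rw [h6, mul_left_comm, h7]
      ring
    rw [mul_assoc, h5, mul_smul]
    exact smul_mem_regularForms (V.mul_mem (V.mul_mem (natCast_mem _ _) (intCast_mem _ _)) hg)
      (uniformizer_smul_dlog_mem hp hp0 _ fun i => hpu _ (hc0 _))

end CanonicalSingularities


/-! ### The alternating differential on functions of tuples. -/

section Tuples

variable {σ : Type} {M : Type} [AddCommGroup M]

/-- The Čech differential of functions of tuples. -/
def tupleDiff {n : ℕ} (c : (Fin n → σ) → M) (t : Fin (n + 1) → σ) : M :=
  ∑ j : Fin (n + 1), (-1 : ℤ) ^ (j : ℕ) • c fun i => t (j.succAbove i)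

/-- Omitting the prefixed index gives `c t`; the other faces keep it and change sign. This is the
homotopy formula behind exactness. -/
theorem tupleDiff_cons {n : ℕ} (c : (Fin (n + 1) → σ) → M) (k : σ) (t : Fin (n + 1) → σ) :
    tupleDiff c (Fin.cons k t : Fin (n + 2) → σ) =
      c t - tupleDiff (fun s => c (Fin.cons k s : Fin (n + 1) → σ)) t := by
  rw [tupleDiff, Fin.sum_univ_succ, tupleDiff, sub_eq_add_neg, ← Finset.sum_neg_distrib]
  congr 1
  · simp
  · refine Finset.sum_congr rfl fun j _ => ?_
    rw [Fin.val_succ, pow_succ, mul_neg_one, neg_smul]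
    congr 3
    funext i
    refine Fin.cases ?_ (fun i => ?_) i
    · simp
    · simp

theorem tupleDiff_sub {n : ℕ} (c c' : (Fin n → σ) → M) (t : Fin (n + 1) → σ) :
    tupleDiff (fun s => c s - c' s) t = tupleDiff c t - tupleDiff c' t := by
  simp only [tupleDiff, smul_sub, Finset.sum_sub_distrib]

theorem tupleDiff_tupleDiff {n : ℕ} (c : (Fin n → σ) → M) (t : Fin (n + 2) → σ) :
    tupleDiff (tupleDiff c) t = 0 := by
  induction n with
  | zero =>
    have h : ∀ s, tupleDiff c s = c ![] := fun s => by
      simp [tupleDiff, Subsingleton.elim _ (![] : Fin 0 → σ)]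
    simp [tupleDiff, Fin.sum_univ_two, Subsingleton.elim _ (![] : Fin 0 → σ)]
  | succ n ih =>
    rw [← Fin.cons_self_tail t, tupleDiff_cons]
    have h : (fun s => tupleDiff c (Fin.cons (t 0) s : Fin (n + 2) → σ)) = fun s =>
        c s - tupleDiff (fun s => c (Fin.cons (t 0) s : Fin (n + 1) → σ)) s :=
      funext fun s => tupleDiff_cons c _ s
    rw [h, tupleDiff_sub, ih, sub_zero, sub_self]

theorem map_tupleDiff {M' G : Type} [AddCommGroup M'] [FunLike G M M'] [AddMonoidHomClass G M M']
    (φ : G) {n : ℕ} (c : (Fin n → σ) → M) (t : Fin (n + 1) → σ) :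
    φ (tupleDiff c t) = tupleDiff (fun s => φ (c s)) t := by
  simp only [tupleDiff, map_sum, map_zsmul]

end Tuples

/-! ### Čech cochains as polynomials over a common monomial denominator. -/

section PolynomialCochains

variable {σ : Type} [Fintype σ] [DecidableEq σ] {w : σ → ℕ} {F : MvPolynomial σ ℂ} {d : ℕ}

theorem X_pow_dvd_iff (k : σ) (n : ℕ) (P : MvPolynomial σ ℂ) :
    X k ^ n ∣ P ↔ ∀ a ∈ P.support, n ≤ a k := by
  rw [X_pow_eq_monomial, monomial_one_dvd_iff_modMonomial_eq_zero]
  constructor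
  · intro h a ha
    by_contra hlt
    have h1 := coeff_modMonomial_of_not_le (s := Finsupp.single k n) (s' := a) P
      (by rwa [Finsupp.single_le_iff])
    rw [h, coeff_zero] at h1
    exact mem_support_iff.1 ha h1.symm
  · intro h
    ext a
    by_cases hle : Finsupp.single k n ≤ a
    · rw [coeff_modMonomial_of_le P hle, coeff_zero]
    · rw [coeff_modMonomial_of_not_le P hle, coeff_zero]
      by_contra h0
      exact hle (Finsupp.single_le_iff.2 (h a (mem_support_iff.2 h0)))

/-- Polynomials `P_t` representing the Laurent polynomials `P_t / ∏ x_k ^ n` without poles along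
`x_k = 0` when `k` does not belong to `t`. -/
def HasPoles {m : ℕ} (n : ℕ) (c : (Fin m → σ) → MvPolynomial σ ℂ) : Prop :=
  ∀ t k, k ∉ Set.range t → X k ^ n ∣ c t

/-- Intermediate cohomology of the weighted projective space vanishes. -/
theorem exists_tupleDiff_eq {m n : ℕ} (hm : m + 2 < Fintype.card σ)
    {c : (Fin (m + 2) → σ) → MvPolynomial σ ℂ} (hc : HasPoles n c) (h : ∀ t, tupleDiff c t = 0) :
    ∃ b : (Fin (m + 1) → σ) → MvPolynomial σ ℂ, HasPoles n b ∧ ∀ t, tupleDiff b t = c t := by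
  classical
  have hne : Nonempty σ := Fintype.card_pos_iff.1 (by omega)
  -- For each exponent vector $a$, a variable along which the Laurent monomial has no pole. The
  -- choice depends only on $a$, so prefixing $\kappa(a)$ gives a contracting homotopy monomial by
  -- monomial.
  have hκ : ∀ a : σ →₀ ℕ, ∃ k, (∃ l, n ≤ a l) → n ≤ a k := fun a => by
    by_cases h : ∃ l, n ≤ a l
    · exact ⟨h.choose, fun _ => h.choose_spec⟩
    · exact ⟨hne.some, fun h' => absurd h' h⟩
  choose κ hκ using hκ
  have hsupp : ∀ t, ∀ a ∈ (c t).support, n ≤ a (κ a) := by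
    intro t a ha
    -- A tuple of $m+2$ indices misses a variable; this is where the bound on the degree is used.
    obtain ⟨l, hl⟩ : ∃ l, l ∉ Set.range t := by
      by_contra! hcon
      have := Fintype.card_le_of_surjective t fun l => hcon l
      rw [Fintype.card_fin] at this
      omega
    exact hκ a ⟨l, (X_pow_dvd_iff l n _).1 (hc t l hl) a ha⟩
  let b : (Fin (m + 1) → σ) → MvPolynomial σ ℂ := fun s =>
    ∑ k, ∑ a ∈ (c (Fin.cons k s : Fin (m + 2) → σ)).support with κ a = k,
      monomial a (coeff a (c (Fin.cons k s : Fin (m + 2) → σ)))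
  have hb : ∀ s a, coeff a (b s) = coeff a (c (Fin.cons (κ a) s : Fin (m + 2) → σ)) := by
    intro s a
    simp only [b, coeff_sum, coeff_monomial]
    rw [Finset.sum_eq_single (κ a)]
    · rw [Finset.sum_ite_eq']
      split_ifs with h1
      · rfl
      · simp only [Finset.mem_filter, and_true] at h1
        exact (notMem_support_iff.1 h1).symm
    · intro k _ hk
      refine Finset.sum_eq_zero fun a' ha' => ?_
      rw [if_neg]
      rintro rfl
      exact hk (Finset.mem_filter.1 ha').2.symm
    · simp
  refine ⟨b, fun s k hk => ?_, fun t => ?_⟩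
  · rw [X_pow_dvd_iff]
    intro a ha
    rw [mem_support_iff, hb, ← mem_support_iff] at ha
    by_cases hka : k = κ a
    · rw [hka]
      exact hsupp _ a ha
    · refine (X_pow_dvd_iff k n _).1 (hc _ k ?_) a ha
      rintro ⟨i, hi⟩
      refine Fin.cases (fun h0 => ?_) (fun i hi => ?_) i hi
      · exact hka h0.symm
      · exact hk ⟨i, hi⟩
  · ext a
    have h1 := congrArg (coeff a) (h (Fin.cons (κ a) t : Fin (m + 3) → σ))
    rw [tupleDiff_cons, coeff_sub, coeff_zero, sub_eq_zero] at h1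
    rw [h1, tupleDiff, tupleDiff, coeff_sum, coeff_sum]
    refine Finset.sum_congr rfl fun j _ => ?_
    rw [coeff_smul, coeff_smul, hb]

/-- Intermediate cohomology of a hypersurface in weighted projective space vanishes. -/
theorem exists_dvd_sub_tupleDiff (hF : Prime F) (hX : ∀ k, ¬ F ∣ X k) {m n : ℕ}
    (hm : m + 3 < Fintype.card σ) {c : (Fin (m + 2) → σ) → MvPolynomial σ ℂ} (hc : HasPoles n c)
    (h : ∀ t, F ∣ tupleDiff c t) :
    ∃ b : (Fin (m + 1) → σ) → MvPolynomial σ ℂ, HasPoles n b ∧ ∀ t, F ∣ c t - tupleDiff b t := by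
  choose e he using h
  have hdiff : ∀ {m : ℕ} {c : (Fin m → σ) → MvPolynomial σ ℂ}, HasPoles n c →
      HasPoles n (tupleDiff c) := by
    intro m c hc t k hk
    refine Finset.dvd_sum fun j _ => ?_
    rw [zsmul_eq_mul]
    exact Dvd.dvd.mul_left (hc _ k fun ⟨i, hi⟩ => hk ⟨_, hi⟩) _
  -- So divisibility by $x_k^n$ passes from $F\,e$ to $e$: the cochain $e$ with $\delta c=Fe$ has
  -- admissible poles. It is a cocycle, hence $e=\delta e'$, and $c-Fe'$ is a cocycle of the ambient
  -- space.
  have hcop : ∀ k, ¬ X k ∣ F := fun k hk =>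
    hX k ((X_prime.irreducible.associated_of_dvd hF.irreducible hk).symm.dvd)
  have hepoles : HasPoles n e := fun t k hk => by
    have h1 := hdiff hc t k hk
    rw [he t] at h1
    exact X_prime.pow_dvd_of_dvd_mul_left n (hcop k) h1
  have hmul : ∀ {m : ℕ} (b : (Fin m → σ) → MvPolynomial σ ℂ) t,
      tupleDiff (fun s => F * b s) t = F * tupleDiff b t := fun b t =>
    (map_tupleDiff (AddMonoidHom.mulLeft F) b t).symm
  have hde : ∀ t, tupleDiff e t = 0 := fun t => by
    have h1 := tupleDiff_tupleDiff c t
    rw [funext he, hmul] at h1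
    exact (mul_eq_zero.1 h1).resolve_left hF.ne_zero
  obtain ⟨e', he', hde'⟩ := exists_tupleDiff_eq hm hepoles hde
  have hc' : HasPoles n fun t => c t - F * e' t := fun t k hk =>
    dvd_sub (hc t k hk) (Dvd.dvd.mul_left (he' t k hk) _)
  obtain ⟨b, hb, hdb⟩ := exists_tupleDiff_eq (m := m) (by omega) hc' fun t => by
    rw [tupleDiff_sub, hmul, hde', he, sub_self]
  exact ⟨b, hb, fun t => ⟨e' t, by rw [hdb]; ring⟩⟩

/-- The homogeneous version of the vanishing of the intermediate cohomology. -/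
theorem exists_homogeneous_dvd_sub_tupleDiff (hF : Prime F) (hX : ∀ k, ¬ F ∣ X k)
    (hFw : IsWeightedHomogeneous w F d) {m n W : ℕ}
    (hm : m + 3 < Fintype.card σ) {c : (Fin (m + 2) → σ) → MvPolynomial σ ℂ} (hc : HasPoles n c)
    (hcw : ∀ t, IsWeightedHomogeneous w (c t) W) (h : ∀ t, F ∣ tupleDiff c t) :
    ∃ b : (Fin (m + 1) → σ) → MvPolynomial σ ℂ, HasPoles n b ∧
      (∀ t, IsWeightedHomogeneous w (b t) W) ∧ ∀ t, F ∣ c t - tupleDiff b t := by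
  obtain ⟨b, hb, hdb⟩ := exists_dvd_sub_tupleDiff hF hX hm hc h
  refine ⟨fun t => weightedHomogeneousComponent w W (b t), fun t k hk => ?_,
    fun t => weightedHomogeneousComponent_isWeightedHomogeneous W (b t), fun t => ?_⟩
  · rw [X_pow_dvd_iff]
    intro a ha
    refine (X_pow_dvd_iff k n _).1 (hb t k hk) a ?_
    rw [mem_support_iff, coeff_weightedHomogeneousComponent] at ha
    rw [mem_support_iff]
    exact fun h0 => ha (by rw [h0, ite_self])
  · obtain ⟨e, he⟩ := hdb t
    have h1 := congrArg (weightedHomogeneousComponent w W) he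
    rw [map_sub, map_tupleDiff, weightedHomogeneousComponent_of_mem (hcw t), if_pos rfl,
      mul_comm] at h1
    obtain ⟨A', hA', -⟩ := weightedHomogeneousComponent_mul_of_isWeightedHomogeneous
      (A := e) hFw W
    rw [h1, hA']
    exact Dvd.intro_left _ rfl

/-- Division by a power of the product of all variables. -/
theorem exists_mul_prod_X_pow {n W D : ℕ} {P : MvPolynomial σ ℂ} (hP : ∀ k, X k ^ n ∣ P)
    (hPw : IsWeightedHomogeneous w P D) (hW : W + ∑ k, n * w k = D) :
    ∃ Q, IsWeightedHomogeneous w Q W ∧ P = Q * ∏ k, X k ^ n := by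
  set a : σ →₀ ℕ := Finsupp.equivFunOnFinite.symm fun _ => n with ha
  have haX : (∏ k, X k ^ n : MvPolynomial σ ℂ) = monomial a 1 := by
    rw [monomial_eq, Finsupp.prod_fintype _ _ (by simp)]
    simp [ha]
  have hwa : Finsupp.weight w a = ∑ k, n * w k := by
    rw [Finsupp.weight_apply, Finsupp.sum_fintype _ _ (by simp)]
    simp [ha]
  have hmod : P.modMonomial a = 0 := by
    ext b
    by_cases hle : a ≤ b
    · rw [coeff_modMonomial_of_le P hle, coeff_zero]
    · rw [coeff_modMonomial_of_not_le P hle, coeff_zero]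
      by_contra h0
      exact hle fun k => (X_pow_dvd_iff k n P).1 (hP k) b (mem_support_iff.2 h0)
  refine ⟨P.divMonomial a, fun {b} hb => ?_, ?_⟩
  · rw [coeff_divMonomial] at hb
    have := hPw hb
    rw [map_add, hwa] at this
    omega
  · have := divMonomial_add_modMonomial P a
    rw [hmod, add_zero] at this
    rw [haX, mul_comm, this]

end PolynomialCochains


/-! ### Sections on coordinate charts and vanishing of the intermediate cohomology. -/

section Sections

variable {σ : Type} [Fintype σ] [DecidableEq σ] {w : σ → ℕ} {F : MvPolynomial σ ℂ} {d : ℕ}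

theorem isWeightedHomogeneous_prod_X_pow (n : σ → ℕ) :
    IsWeightedHomogeneous w (∏ k, X k ^ n k : MvPolynomial σ ℂ) (∑ k, n k * w k) := by
  refine IsWeightedHomogeneous.prod _ _ _ fun k _ => ?_
  simpa using (isWeightedHomogeneous_X ℂ w k).pow (n k)

theorem isWeightedHomogeneous_prod_X {m : ℕ} (s : Fin m → σ) :
    IsWeightedHomogeneous w (∏ j, X (s j) : MvPolynomial σ ℂ) (∑ j, w (s j)) :=
  IsWeightedHomogeneous.prod _ _ _ fun j _ => isWeightedHomogeneous_X ℂ w (s j)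

variable [IsDomain (CoordRing F)]

variable (w F) in
/-- The degree zero elements of the localization of `ℂ[x] / (F)` at `∏ x_{s j}`. -/
def IsMonomialFrac {m : ℕ} (s : Fin m → σ) (z : FractionRing (CoordRing F)) : Prop :=
  ∃ (n : ℕ) (a : CoordRing F), a ∈ coordGrading w F (n * ∑ j, w (s j)) ∧
    z = algebraMap (CoordRing F) (FractionRing (CoordRing F)) a /
      algebraMap (CoordRing F) (FractionRing (CoordRing F)) ((Ideal.Quotient.mkₐ ℂ (Ideal.span {F})
      (∏ j, X (s j))) ^ n)

/-- Passing to the common denominator $\prod_kx_k^n$ records the absence of a pole along $x_k$ as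
divisibility of the numerator by $x_k^n$. Tuples may repeat indices, hence the multiplicities `cnt`.
-/
theorem IsMonomialFrac.exists_polynomial (hX : ∀ k, ¬ F ∣ X k) {m : ℕ} {s : Fin m → σ}
    {z : FractionRing (CoordRing F)} (hz : IsMonomialFrac w F s z) :
    ∃ n₀, ∀ n ≥ n₀, ∃ P : MvPolynomial σ ℂ, IsWeightedHomogeneous w P (∑ k, n * w k) ∧
      (∀ k ∉ Set.range s, X k ^ n ∣ P) ∧ z * ∏ k, coneCoord F k ^ n = aeval (coneCoord F) P := by
  obtain ⟨n₁, _, ⟨Q, hQ, rfl⟩, rfl⟩ := hz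
  set cnt : σ → ℕ := fun k => (Finset.univ.filter fun j => s j = k).card with hcnt
  have hcntle : ∀ k, cnt k ≤ m := fun k => (Finset.card_le_univ _).trans (by simp)
  have hprod : (∏ j, X (s j) : MvPolynomial σ ℂ) = ∏ k, X k ^ cnt k := by
    rw [← Finset.prod_fiberwise Finset.univ s]
    refine Finset.prod_congr rfl fun k _ => ?_
    rw [Finset.prod_congr rfl fun j hj => by rw [(Finset.mem_filter.1 hj).2], Finset.prod_const]
  have hsum : ∑ j, w (s j) = ∑ k, cnt k * w k := by
    rw [← Finset.sum_fiberwise Finset.univ s]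
    refine Finset.sum_congr rfl fun k _ => ?_
    rw [Finset.sum_congr rfl fun j hj => by rw [(Finset.mem_filter.1 hj).2], Finset.sum_const,
      smul_eq_mul]
  refine ⟨n₁ * m, fun n hn => ?_⟩
  have hle : ∀ k, n₁ * cnt k ≤ n := fun k => (Nat.mul_le_mul_left _ (hcntle k)).trans hn
  refine ⟨Q * ∏ k, X k ^ (n - n₁ * cnt k), ?_, fun k hk => ?_, ?_⟩
  · have h1 := IsWeightedHomogeneous.mul (φ := Q) hQ
      (isWeightedHomogeneous_prod_X_pow (w := w) fun k => n - n₁ * cnt k)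
    convert h1 using 1
    rw [hsum, Finset.mul_sum, ← Finset.sum_add_distrib]
    refine Finset.sum_congr rfl fun k _ => ?_
    rw [← mul_assoc, ← add_mul, Nat.add_sub_cancel' (hle k)]
  · have h0 : cnt k = 0 := Finset.card_eq_zero.2 (Finset.filter_eq_empty_iff.2
      fun j _ hj => hk ⟨j, hj⟩)
    refine Dvd.dvd.mul_left ?_ _
    have := Finset.dvd_prod_of_mem (fun k => (X k : MvPolynomial σ ℂ) ^ (n - n₁ * cnt k))
      (Finset.mem_univ k)
    simpa [h0] using this
  · have h1 := aeval_coneCoord (F := F) Q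
    have h2 := aeval_coneCoord (F := F) (∏ j, X (s j))
    have h3 : aeval (coneCoord F) (∏ j, X (s j) : MvPolynomial σ ℂ) ^ n₁ ≠ 0 := by
      refine pow_ne_zero _ ?_
      rw [map_prod]
      exact Finset.prod_ne_zero_iff.2 fun j _ => by
        rw [aeval_X]
        exact coneCoord_ne_zero (hX _)
    change algebraMap _ _ (Ideal.Quotient.mkₐ ℂ (Ideal.span {F}) Q) / _ * _ = _
    rw [map_pow, ← h1, ← h2, div_mul_eq_mul_div, div_eq_iff h3, map_mul, mul_assoc]
    congr 1
    rw [hprod]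
    simp only [map_prod, map_pow, aeval_X, ← Finset.prod_pow, ← Finset.prod_mul_distrib]
    refine Finset.prod_congr rfl fun k _ => ?_
    rw [← pow_mul, ← pow_add, mul_comm (cnt k), Nat.sub_add_cancel (hle k)]

theorem isMonomialFrac_of_polynomial (hX : ∀ k, ¬ F ∣ X k) {m n : ℕ} {s : Fin m → σ}
    {P : MvPolynomial σ ℂ} (hP : IsWeightedHomogeneous w P (∑ k, n * w k))
    (hPs : ∀ k ∉ Set.range s, X k ^ n ∣ P) :
    IsMonomialFrac w F s (aeval (coneCoord F) P / ∏ k, coneCoord F k ^ n) := by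
  have hf := (isWeightedHomogeneous_prod_X (w := w) s).pow n
  obtain ⟨Q, hQ, hPQ⟩ := exists_mul_prod_X_pow (w := w) (n := n) (W := n * ∑ j, w (s j))
    (P := P * (∏ j, X (s j)) ^ n) (D := (∑ k, n * w k) + n • ∑ j, w (s j)) (fun k => by
      by_cases hk : k ∈ Set.range s
      · obtain ⟨j, rfl⟩ := hk
        exact Dvd.dvd.mul_left (pow_dvd_pow_of_dvd (Finset.dvd_prod_of_mem _ (Finset.mem_univ j)) n) _
      · exact Dvd.dvd.mul_right (hPs k hk) _) (hP.mul hf) (by rw [smul_eq_mul, add_comm])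
  refine ⟨n, _, mk_mem_coordGrading w F hQ, ?_⟩
  have h1 := aeval_coneCoord (F := F) Q
  have h2 := aeval_coneCoord (F := F) (∏ j, X (s j))
  have h0 : ∀ k, coneCoord F k ≠ 0 := fun k => coneCoord_ne_zero (hX k)
  have h3 := congrArg (aeval (coneCoord F)) hPQ
  rw [map_pow, ← h1, ← h2, div_eq_div_iff, ← map_pow, ← map_mul, h3]
  · simp [map_prod]
  · exact Finset.prod_ne_zero_iff.2 fun k _ => pow_ne_zero _ (h0 k)
  · refine pow_ne_zero _ ?_
    rw [map_prod]
    exact Finset.prod_ne_zero_iff.2 fun j _ => by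
      rw [aeval_X]
      exact h0 _

variable [GradedAlgebra (coordGrading w F)]

theorem iInf_basicOpen {m : ℕ} (s : Fin m → σ) :
    (⨅ j, Proj.basicOpen (coordGrading w F) (Ideal.Quotient.mkₐ ℂ (Ideal.span {F}) (X (s j)))) =
      Proj.basicOpen (coordGrading w F) (Ideal.Quotient.mkₐ ℂ (Ideal.span {F}) (∏ j, X (s j))) := by
  rw [← Finset.inf_univ_eq_iInf, map_prod]
  generalize (Finset.univ : Finset (Fin m)) = t
  induction t using Finset.induction_on with
  | empty => simp [Proj.basicOpen_one]
  | insert i t hi ih => rw [Finset.inf_insert, Finset.prod_insert hi, Proj.basicOpen_mul, ih]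

variable [IsIntegral (Proj (coordGrading w F))]

/-- Sections over an open set containing the generic point, as elements of the fraction field. -/
def sectionToFrac {U : (Proj (coordGrading w F)).Opens}
    (hη : genericPoint (Proj (coordGrading w F)) ∈ U) :
    Γ(Proj (coordGrading w F), U) →+* FractionRing (CoordRing F) :=
  (functionFieldToFrac (coordGrading w F)).comp ((Proj (coordGrading w F)).presheaf.germ U _ hη).hom

theorem sectionToFrac_injective {U : (Proj (coordGrading w F)).Opens}
    (hη : genericPoint (Proj (coordGrading w F)) ∈ U) : Function.Injective (sectionToFrac hη) :=
  (functionFieldToFrac (coordGrading w F)).injective.comp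
    (germ_injective_of_isIntegral (Proj (coordGrading w F)) _ hη)

theorem sectionToFrac_map {U V : (Proj (coordGrading w F)).Opens} (i : U ⟶ V)
    (hη : genericPoint (Proj (coordGrading w F)) ∈ U)
    (hη' : genericPoint (Proj (coordGrading w F)) ∈ V) (s : Γ(Proj (coordGrading w F), V)) :
    sectionToFrac hη (((Proj (coordGrading w F)).presheaf.map i.op).hom s) = sectionToFrac hη' s :=
  congrArg (functionFieldToFrac (coordGrading w F))
    ((Proj (coordGrading w F)).presheaf.germ_res_apply i _ hη s)

theorem genericPoint_mem_basicOpen (hw : ∀ k, 0 < w k) (hX : ∀ k, ¬ F ∣ X k) [Nonempty σ] (k : σ) :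
    genericPoint (Proj (coordGrading w F)) ∈ Proj.basicOpen (coordGrading w F)
      (Ideal.Quotient.mkₐ ℂ (Ideal.span {F}) (X k)) := by
  have h := exists_ne_zero_mem_coordGrading (w := w) (hw k) (hX k)
  refine ((genericPoint_spec (Proj (coordGrading w F))).mem_open_set_iff
    (Proj.basicOpen (coordGrading w F) _).isOpen).2
      ⟨projGenericPoint (coordGrading w F) h, trivial, fun h0 => hX k ?_⟩
  have h1 := (Ideal.mem_bot (R := CoordRing F)).1 h0
  exact Ideal.mem_span_singleton.1 (Ideal.Quotient.eq_zero_iff_mem.1 h1)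

/-- `H^i(X, 𝒪_X) = 0` for `0 < i < dim X` if `X` is a weighted projective hypersurface. -/
theorem intermediateCohomologyVanishes (hw : ∀ k, 0 < w k) (hF : Prime F) (hX : ∀ k, ¬ F ∣ X k)
    (hFw : IsWeightedHomogeneous w F d) {r : ℕ} (hr : r + 2 = Fintype.card σ) :
    IntermediateCohomologyVanishes (Proj (coordGrading w F)) r := by
  have hne : Nonempty σ := Fintype.card_pos_iff.1 (by omega)
  let e : Fin (Fintype.card σ) ≃ σ := (Fintype.equivFin σ).symm
  let U : Fin (Fintype.card σ) → (Proj (coordGrading w F)).Opens := fun i =>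
    Proj.basicOpen (coordGrading w F) (Ideal.Quotient.mkₐ ℂ (Ideal.span {F}) (X (e i)))
  have hU : ∀ {m : ℕ} (t : Fin m → Fin (Fintype.card σ)), (⨅ j, U (t j)) =
      Proj.basicOpen (coordGrading w F)
        (Ideal.Quotient.mkₐ ℂ (Ideal.span {F}) (∏ j, X (e (t j)))) := fun t =>
    iInf_basicOpen fun j => e (t j)
  have hη : ∀ {m : ℕ} (t : Fin m → Fin (Fintype.card σ)),
      genericPoint (Proj (coordGrading w F)) ∈ ⨅ j, U (t j) := fun t => by
    rw [← Finset.inf_univ_eq_iInf]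
    refine Finset.inf_induction (p := fun V => genericPoint (Proj (coordGrading w F)) ∈ V) trivial
      (fun _ h _ h' => ⟨h, h'⟩) fun j _ => genericPoint_mem_basicOpen hw hX _
  have hsec : ∀ {m : ℕ} (t : Fin (m + 1) → Fin (Fintype.card σ)) (z : FractionRing (CoordRing F)),
      (∃ s, sectionToFrac (hη t) s = z) ↔ IsMonomialFrac w F (fun j => e (t j)) z := fun t z =>
    sections_basicOpen_iff (coordGrading w F)
      (Finset.sum_pos (fun j _ => hw _) Finset.univ_nonempty)
      (mk_mem_coordGrading w F (isWeightedHomogeneous_prod_X fun j => e (t j))) (hU t) (hη t) z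
  have hdiff : ∀ {m : ℕ} (c : CechCochain U m) (t : Fin (m + 2) → Fin (Fintype.card σ)),
      sectionToFrac (hη t) (cechDifferential U m c t) =
        tupleDiff (fun s => sectionToFrac (hη s) (c s)) t := fun c t => by
    rw [cechDifferential, map_sum, tupleDiff]
    refine Finset.sum_congr rfl fun j _ => ?_
    rw [map_mul, map_pow, map_neg, map_one, zsmul_eq_mul, sectionToFrac_map _ (hη t)
      (hη fun i => t (j.succAbove i))]
    push_cast
    rfl
  refine ⟨Fintype.card σ, U, fun i => ?_, ?_, fun p hp c hc => ?_⟩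
  · exact Proj.isAffineOpen_basicOpen (coordGrading w F) _ (mk_mem_coordGrading w F
      (isWeightedHomogeneous_X ℂ w (e i))) (hw _)
  · refine top_le_iff.1 fun x _ => ?_
    obtain ⟨k, hk⟩ := exists_X_notMem_pointIdeal x
    refine TopologicalSpace.Opens.mem_iSup.2 ⟨e.symm k, ?_⟩
    change _ ∉ _
    rw [Equiv.apply_symm_apply]
    exact hk
  have hpoly : ∀ t : Fin (p + 2) → Fin (Fintype.card σ), ∃ n₀, ∀ n ≥ n₀,
      ∃ P : MvPolynomial σ ℂ, IsWeightedHomogeneous w P (∑ k, n * w k) ∧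
      (∀ k ∉ Set.range (fun j => e (t j)), X k ^ n ∣ P) ∧
      sectionToFrac (hη t) (c t) * ∏ k, coneCoord F k ^ n = aeval (coneCoord F) P := fun t =>
    ((hsec t _).1 ⟨c t, rfl⟩).exists_polynomial hX
  choose n₀ hn₀ using hpoly
  -- One exponent that is large enough for all of the finitely many tuples.
  set n := ∑ t, n₀ t with hn
  have hpoly := fun t => hn₀ t n (Finset.single_le_sum (fun _ _ => Nat.zero_le _)
    (Finset.mem_univ t))
  choose P hPw hPd hPeq using hpoly
  set Y := ∏ k, coneCoord F k ^ n with hY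
  have hY0 : Y ≠ 0 := Finset.prod_ne_zero_iff.2 fun k _ => pow_ne_zero _ (coneCoord_ne_zero (hX k))
  have hes : ∀ {m : ℕ} (t : Fin m → Fin (Fintype.card σ)), (fun i => e.symm (e (t i))) = t :=
    fun t => funext fun i => e.symm_apply_apply _
  obtain ⟨b, hb, hbw, hdb⟩ := exists_homogeneous_dvd_sub_tupleDiff hF hX hFw (m := p) (n := n)
    (by omega) (c := fun s => P fun i => e.symm (s i)) (fun s k hk => hPd _ k (by simpa using hk))
    (fun s => hPw _) fun t => by
      rw [← aeval_coneCoord_eq_zero, map_tupleDiff]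
      have h1 := hdiff c fun i => e.symm (t i)
      rw [hc] at h1
      have h2 : tupleDiff (fun s => aeval (coneCoord F) (P fun i => e.symm (s i))) t =
          tupleDiff (fun s => sectionToFrac (hη s) (c s)) (fun i => e.symm (t i)) * Y := by
        simp only [tupleDiff, Finset.sum_mul, smul_mul_assoc]
        refine Finset.sum_congr rfl fun j _ => ?_
        rw [← hPeq]
      rw [h2, ← h1]
      have h3 : (0 : CechCochain U (p + 1 + 1)) (fun i => e.symm (t i)) = 0 := rfl
      rw [h3, map_zero, zero_mul]
  have hbs : ∀ t : Fin (p + 1) → Fin (Fintype.card σ), ∃ s, sectionToFrac (hη t) s =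
      aeval (coneCoord F) (b fun i => e (t i)) / Y := fun t =>
    (hsec t _).2 (isMonomialFrac_of_polynomial hX (hbw _) fun k hk => hb _ k hk)
  choose b' hb' using hbs
  refine ⟨b', funext fun t => sectionToFrac_injective (hη t) ?_⟩
  rw [hdiff, eq_comm, ← mul_left_inj' hY0, hPeq]
  have h1 := (aeval_coneCoord_eq_zero (F := F) _).2 (hdb fun i => e (t i))
  rw [map_sub, sub_eq_zero, map_tupleDiff, hes] at h1
  rw [h1]
  simp only [tupleDiff, Finset.sum_mul, smul_mul_assoc]
  refine Finset.sum_congr rfl fun j _ => ?_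
  rw [hb', div_mul_cancel₀ _ hY0]

end Sections


/-! ### Properness over the field of constants. -/

section Proper

variable {σ : Type} {w : σ → ℕ} {F : MvPolynomial σ ℂ}

theorem eq_C_of_isWeightedHomogeneous_zero (hw : ∀ i, 0 < w i) {p : MvPolynomial σ ℂ}
    (hp : IsWeightedHomogeneous w p 0) : p = C (coeff 0 p) := by
  classical
  ext a
  rw [coeff_C]
  split_ifs with h
  · rw [← h]
  · by_contra h0
    refine h (Finsupp.ext fun i => ?_)
    have h1 := Finsupp.le_weight w (hw i).ne' a
    rw [hp h0] at h1
    exact (Nat.le_zero.1 h1).symm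

theorem algebraMap_coordGrading_zero_bijective (hw : ∀ i, 0 < w i) [IsDomain (CoordRing F)] :
    Function.Bijective (algebraMap ℂ (coordGrading w F 0)) := by
  constructor
  · have : Function.Injective fun z : ℂ => ((algebraMap ℂ (coordGrading w F 0) z :
        coordGrading w F 0) : CoordRing F) := (algebraMap ℂ (CoordRing F)).injective
    exact fun a b h => this (congrArg Subtype.val h)
  · rintro ⟨_, p, hp, rfl⟩
    refine ⟨coeff 0 p, Subtype.ext ?_⟩
    have h := eq_C_of_isWeightedHomogeneous_zero hw hp
    change algebraMap ℂ (CoordRing F) (coeff 0 p) = Ideal.Quotient.mkₐ ℂ (Ideal.span {F}) p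
    conv_rhs => rw [h, ← algebraMap_eq, AlgHom.commutes]

variable [Finite σ] [IsDomain (CoordRing F)] [GradedAlgebra (coordGrading w F)]
  [IsIntegral (Proj (coordGrading w F))]

/-- Positive weights leave only constants in degree zero, so the structure morphism is
`Proj.toSpecZero`, proper for a finitely generated algebra, followed by an isomorphism. -/
theorem isProper_projToSpec (hw : ∀ i, 0 < w i) : IsProper (projToSpec w F) := by
  have h0 : IsScalarTower ℂ (coordGrading w F 0) (CoordRing F) :=
    ⟨fun z a r => smul_mul_assoc z (a : CoordRing F) r⟩
  have h1 : Algebra.FiniteType (coordGrading w F 0) (CoordRing F) :=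
    Algebra.FiniteType.of_restrictScalars_finiteType ℂ (coordGrading w F 0) (CoordRing F)
  have h2 : IsIso (CommRingCat.ofHom (algebraMap ℂ (coordGrading w F 0))) :=
    (ConcreteCategory.isIso_iff_bijective _).2 (algebraMap_coordGrading_zero_bijective hw)
  unfold projToSpec
  infer_instance

end Proper

/-! ### The generator of the canonical sheaf when the degree is the sum of the weights. -/

section ConeModel

variable {σ : Type} [Fintype σ] [DecidableEq σ] {w : σ → ℕ} {F : MvPolynomial σ ℂ} {d r : ℕ}
  {K L : Type} [Field K] [Field L] [Algebra ℂ K] [Algebra ℂ L] {ξ : σ → L} {ψ : K →ₐ[ℂ] L}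

/-- In degree the sum of the weights, there is a form that generates the canonical sheaf and is
regular along every discrete valuation ring. -/
theorem IsConeModel.exists_generator (hM : IsConeModel w F ξ ψ) (hC : IsWellFormedCone w F d)
    (hd : d = ∑ k, w k) (hr : r + 2 = Fintype.card σ) :
    ∃ ω : ⋀[K]^r (Ω[K⁄ℂ]), ω ≠ 0 ∧
      (∀ A : Subring K, IsAdapted w F ξ ψ A → Submodule.span A {ω} = regularForms K r A) ∧
      ∀ V : Subalgebra ℂ K, IsDivisorial V → ω ∈ regularForms K r V.toSubring := by
  obtain ⟨t, c, hcoord⟩ := hM.exists_isCoord hC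
  obtain ⟨e⟩ : Nonempty (Fin 2 ⊕ Fin r ≃ σ) := ⟨Fintype.equivOfCardEq (by simp; omega)⟩
  obtain ⟨ω, hω0, hω⟩ := hcoord.exists_isResidueForm hM hC e
  refine ⟨ω, hω0, fun A hA => ?_, fun V hV => ?_⟩
  · obtain ⟨τ, -, -, h⟩ := hcoord.exists_span_residueForm_eq hM hC.homogeneous hω hA
    rw [← hd, sub_self, zpow_zero, one_smul] at h
    exact h
  · exact hcoord.residueForm_mem_regularForms hM hC hd hω hV.dvr hV.fractionField

end ConeModel

/-! ### The Calabi–Yau criterion for well-formed quasi-smooth hypersurfaces. -/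

section Criterion

variable {σ : Type} [Fintype σ] [DecidableEq σ] {w : σ → ℕ} {F : MvPolynomial σ ℂ} {d : ℕ}

section Instances

variable [IsDomain (CoordRing F)] [GradedAlgebra (coordGrading w F)]
  [IsIntegral (Proj (coordGrading w F))]

attribute [local instance] projFunctionFieldAlgebra

theorem trivialCanonicalSheaf_of_degree_eq_sum (hC : IsWellFormedCone w F d)
    (hd : d = ∑ k, w k) :
    HasTrivialCanonicalSheafAndCanonicalSingularities (projToSpec w F) := by
  obtain ⟨ω, hω0, h1, h2⟩ :=
    hC.isConeModel.exists_generator hC hd (varietyDim_projToSpec hC)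
  exact ⟨ω, hω0, fun x hx => h1 _ (isAdapted_localSubring hC x hx), h2⟩

theorem isCalabiYau_projToSpec_iff (hC : IsWellFormedCone w F d) :
    IsCalabiYau (projToSpec w F) ↔ d = ∑ k, w k := by
  have := isProper_projToSpec (w := w) (F := F) hC.pos
  refine ⟨fun h => degree_eq_sum_of_trivialCanonicalSheaf hC h.canonical, fun hd =>
    { integral := inferInstance
      proper := this
      normal := isIntegrallyClosed_stalk_proj hC
      canonical := trivialCanonicalSheaf_of_degree_eq_sum hC hd
      cohomology := intermediateCohomologyVanishes hC.pos hC.prime hC.not_dvd_X hC.homogeneous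
        (varietyDim_projToSpec hC) }⟩

end Instances

/-- A well-formed quasi-smooth hypersurface of dimension at least one is Calabi–Yau if and only
if its degree is the sum of the weights. -/
theorem isCalabiYau_hypersurfaceToSpec_iff (hC : IsWellFormedCone w F d)
    (hF : IsWeightedHomogeneous w F d) :
    IsCalabiYau (hypersurfaceToSpec w F hF) ↔ d = ∑ k, w k := by
  have h1 := isDomain_coordRing hC.prime
  let h2 := coordGradedAlgebra w F hF
  obtain ⟨k⟩ := hC.nonempty
  have h3 : IsIntegral (Proj (coordGrading w F)) :=
    isIntegral_proj _ (exists_ne_zero_mem_coordGrading (hC.pos k) (hC.not_dvd_X k))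
  exact isCalabiYau_projToSpec_iff hC

end Criterion


/-! ### Zero divisors on a chart of a reducible hypersurface. -/

section Reducible

variable {σ : Type} {w : σ → ℕ} {F : MvPolynomial σ ℂ} {d : ℕ}

theorem away_mk_ne_zero [GradedAlgebra (coordGrading w F)] {k : σ} {a : ℕ}
    {p : MvPolynomial σ ℂ} (hp : IsWeightedHomogeneous w p (a • w k)) {x : σ → ℂ} (hx : x k ≠ 0)
    (hF : eval x F = 0) (hpx : eval x p ≠ 0) :
    HomogeneousLocalization.Away.mk (coordGrading w F)
      (mk_mem_coordGrading w F (isWeightedHomogeneous_X ℂ w k)) a _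
      (mk_mem_coordGrading w F hp) ≠ 0 := by
  intro h
  have h1 := congrArg HomogeneousLocalization.val h
  rw [HomogeneousLocalization.Away.val_mk, HomogeneousLocalization.val_zero,
    Localization.mk_eq_mk', IsLocalization.mk'_eq_zero_iff] at h1
  obtain ⟨⟨_, N, rfl⟩, hN⟩ := h1
  dsimp only at hN
  rw [← map_pow, ← map_mul, Ideal.Quotient.mkₐ_eq_mk, Ideal.Quotient.eq_zero_iff_mem,
    Ideal.mem_span_singleton] at hN
  obtain ⟨B, hB⟩ := hN
  have h2 := congrArg (eval x) hB
  rw [map_mul, map_pow, eval_X, map_mul, hF, zero_mul] at h2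
  exact mul_ne_zero (pow_ne_zero _ hx) hpx h2

/-- On the chart $x_k\ne0$ the functions $p/x_k^a$ and $q/x_k^b$ have product zero, while the points
$x$ and $y$ show that neither is zero. -/
theorem not_isIntegral_proj_of_mul [GradedAlgebra (coordGrading w F)] {k : σ} (hw : 0 < w k)
    {a b : ℕ} {p q : MvPolynomial σ ℂ} (hp : IsWeightedHomogeneous w p (a • w k))
    (hq : IsWeightedHomogeneous w q (b • w k)) (hpq : F = p * q) {x y : σ → ℂ}
    (hx : x k ≠ 0) (hy : y k ≠ 0) (hpx : eval x p ≠ 0) (hqx : eval x q = 0)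
    (hqy : eval y q ≠ 0) (hpy : eval y p = 0) :
    ¬ IsIntegral (Proj (coordGrading w F)) := by
  intro hI
  have h1 := away_mk_ne_zero (F := F) hp hx (by rw [hpq, map_mul, hqx, mul_zero]) hpx
  have h2 := away_mk_ne_zero (F := F) hq hy (by rw [hpq, map_mul, hpy, zero_mul]) hqy
  have hnt := nontrivial_of_ne _ _ h1
  have hne : Nonempty (Spec (CommRingCat.of (HomogeneousLocalization.Away (coordGrading w F)
      (Ideal.Quotient.mkₐ ℂ (Ideal.span {F}) (X k))))) :=
    inferInstanceAs (Nonempty (PrimeSpectrum _))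
  have hd := (affine_isIntegral_iff _).1 (isIntegral_of_isOpenImmersion
    (Proj.awayι (coordGrading w F) _
      (mk_mem_coordGrading w F (isWeightedHomogeneous_X ℂ w k)) hw))
  refine (mul_ne_zero (M₀ := CommRingCat.of (HomogeneousLocalization.Away (coordGrading w F)
      (Ideal.Quotient.mkₐ ℂ (Ideal.span {F}) (X k)))) h1 h2) ?_
  apply HomogeneousLocalization.val_injective
  change HomogeneousLocalization.val (_ * _ : HomogeneousLocalization.Away (coordGrading w F)
      (Ideal.Quotient.mkₐ ℂ (Ideal.span {F}) (X k))) = HomogeneousLocalization.val 0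
  rw [HomogeneousLocalization.val_mul, HomogeneousLocalization.Away.val_mk,
    HomogeneousLocalization.Away.val_mk, Localization.mk_mul, ← map_mul, ← hpq,
    HomogeneousLocalization.val_zero]
  have h0 : Ideal.Quotient.mkₐ ℂ (Ideal.span {F}) F = 0 :=
    Ideal.Quotient.eq_zero_iff_mem.2 (Ideal.mem_span_singleton_self F)
  rw [h0, Localization.mk_zero]

end Reducible

/-! ### Divisibility by a coordinate and values at the origin. -/

section Coordinates

variable {σ : Type} {w : σ → ℕ} {F : MvPolynomial σ ℂ} {d : ℕ}

theorem not_dvd_X_of_coeff_ne_zero (hu : ¬ IsUnit F) {a : σ →₀ ℕ} (ha : coeff a F ≠ 0) {k : σ}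
    (hak : a ≠ Finsupp.single k 1) : ¬ F ∣ X k := by
  classical
  intro h
  rcases ((X_prime (R := ℂ) (i := k)).irreducible.dvd_iff).1 h with h | ⟨c, hc⟩
  · exact hu h
  · obtain ⟨z, -, hz⟩ := isUnit_iff_eq_C_of_isReduced.1 c.isUnit
    rw [hz] at hc
    have h1 := congrArg (coeff a) hc
    rw [mul_comm, coeff_C_mul, coeff_X, if_neg hak.symm] at h1
    exact ha (by rw [← h1, mul_zero])

theorem eval_zero_of_isWeightedHomogeneous (hF : IsWeightedHomogeneous w F d) (hd : 0 < d) :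
    eval 0 F = 0 := by
  change eval (fun _ => (0 : ℂ)) F = 0
  rw [eval_zero', constantCoeff_eq]
  by_contra h
  have := hF h
  rw [map_zero] at this
  omega

theorem not_isUnit_of_isWeightedHomogeneous (hF : IsWeightedHomogeneous w F d) (hd : 0 < d) :
    ¬ IsUnit F := fun h => by
  have := h.map (eval (0 : σ → ℂ))
  rw [eval_zero_of_isWeightedHomogeneous hF hd] at this
  exact not_isUnit_zero this

theorem X_dvd_of_eval_eq_zero {k : σ} (h : ∀ x : σ → ℂ, x k = 0 → eval x F = 0) : X k ∣ F := by
  classical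
  rw [← Ideal.mem_span_singleton, ← Set.image_singleton, ← ker_killVariables, RingHom.mem_ker]
  refine MvPolynomial.funext fun x => ?_
  rw [map_zero, ← coe_aeval_eq_eval, RingHom.coe_coe, comp_aeval_apply]
  have h1 := h (fun i => aeval x (if i ∈ ({k} : Set σ) then (0 : MvPolynomial σ ℂ) else X i))
    (by simp)
  rwa [← coe_aeval_eq_eval] at h1

end Coordinates

/-! ### The cyclic hypersurfaces $x_0^\ell+f=0$. -/

section Cyclic

variable {m ℓ u₀ : ℕ} {u : Fin m → ℕ} {f : MvPolynomial (Fin m) ℂ}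

theorem eval_cyclicPoly (x : Fin (m + 1) → ℂ) :
    eval x (cyclicPoly ℓ f) = x 0 ^ ℓ + eval (fun i => x i.succ) f := by
  rw [cyclicPoly, map_add, map_pow, eval_X, eval_rename]
  rfl

theorem eval_pderiv_zero_cyclicPoly (x : Fin (m + 1) → ℂ) :
    eval x (pderiv 0 (cyclicPoly ℓ f)) = ℓ * x 0 ^ (ℓ - 1) := by
  have h : pderiv 0 (rename Fin.succ f) = 0 := by
    refine pderiv_eq_zero_of_notMem_vars fun h => ?_
    classical
    obtain ⟨i, -, hi⟩ := Finset.mem_image.1 (vars_rename _ _ h)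
    exact Fin.succ_ne_zero i hi
  rw [cyclicPoly, map_add, h, add_zero, pderiv_pow, pderiv_X_self]
  simp

theorem eval_pderiv_succ_cyclicPoly (x : Fin (m + 1) → ℂ) (i : Fin m) :
    eval x (pderiv i.succ (cyclicPoly ℓ f)) = eval (fun i => x i.succ) (pderiv i f) := by
  rw [cyclicPoly, map_add, pderiv_rename (Fin.succ_injective m), pderiv_pow,
    pderiv_X_of_ne (Fin.succ_ne_zero i).symm, mul_zero, zero_add, eval_rename]
  rfl

theorem cyclicWeights_pos (hu₀ : 0 < u₀) (hu : ∀ i, 0 < u i) (i : Fin (m + 1)) :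
    0 < cyclicWeights u₀ u i := by
  refine Fin.cases ?_ (fun j => ?_) i
  · exact hu₀
  · exact hu j

theorem coeff_cyclicPoly (hℓ : 2 ≤ ℓ) : coeff (Finsupp.single 0 ℓ) (cyclicPoly ℓ f) = 1 := by
  have h : coeff (Finsupp.single 0 ℓ) (rename Fin.succ f) = 0 := by
    refine coeff_rename_eq_zero _ _ _ fun a ha => ?_
    exfalso
    have h1 := DFunLike.congr_fun ha 0
    rw [Finsupp.mapDomain_of_notMem_range, Finsupp.single_eq_same] at h1
    · omega
    · rintro ⟨i, hi⟩
      exact Fin.succ_ne_zero i hi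
  rw [cyclicPoly, coeff_add, h, add_zero, coeff_X_pow, if_pos rfl]

/-- A polynomial with non-degenerate cyclic suspension has an isolated critical point. -/
theorem exists_eval_pderiv_ne_zero (hℓ : 2 ≤ ℓ) (hu₀ : 0 < u₀)
    (hf : IsWeightedHomogeneous u f (ℓ * u₀)) (hnd : IsNondegenerate (cyclicPoly ℓ f))
    {x : Fin m → ℂ} (hx : x ≠ 0) : ∃ i, eval x (pderiv i f) ≠ 0 := by
  by_contra! hcon
  have h0 := eval_eq_zero_of_pderiv hf (by positivity) x hcon
  obtain ⟨i, hi⟩ := hnd (Fin.cons 0 x : Fin (m + 1) → ℂ) (fun h => hx (funext fun i => by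
    simpa using congrFun h i.succ)) (by
      rw [eval_cyclicPoly]
      simpa [show ℓ ≠ 0 by omega] using h0)
  revert hi
  refine Fin.cases (fun h => h ?_) (fun j h => h ?_) i
  -- The exponent $\ell-1$ is positive, so the hyperplane $x_0=0$ contributes no derivative of its
  -- own.
  · rw [eval_pderiv_zero_cyclicPoly, Fin.cons_zero, zero_pow (by omega), mul_zero]
  · rw [eval_pderiv_succ_cyclicPoly]
    simpa using hcon j

theorem eq_monomial_of_isWeightedHomogeneous {u : Fin 1 → ℕ} {f : MvPolynomial (Fin 1) ℂ}
    (hu : u 0 = 1) {d : ℕ} (hf : IsWeightedHomogeneous u f d) :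
    f = C (coeff (Finsupp.single 0 d) f) * X 0 ^ d := by
  rw [C_mul_X_pow_eq_monomial]
  ext a
  rw [coeff_monomial]
  split_ifs with h
  · rw [h]
  · by_contra h0
    refine h (Finsupp.ext fun i => ?_)
    obtain rfl : i = 0 := Subsingleton.elim _ _
    have h1 := hf h0
    rw [Finsupp.weight_apply, Finsupp.sum_fintype _ _ (by simp)] at h1
    simpa [hu] using h1.symm

/-- Here $f=zx_1^\ell$ with $z\ne0$, and $x_0^\ell-(bx_1)^\ell$ with $b^\ell=-z$ has the linear
factor $x_0-bx_1$. The cofactor vanishes at $(b\zeta,1)$ for a primitive root of unity $\zeta\neq1$,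
but not at $(b,1)$. -/
theorem not_isIntegral_cyclicPoly_one {u : Fin 1 → ℕ} {f : MvPolynomial (Fin 1) ℂ} (hℓ : 2 ≤ ℓ)
    (hu₀ : u₀ = 1) (hu : u 0 = 1) (hf : IsWeightedHomogeneous u f (ℓ * u₀))
    (hnd : IsNondegenerate (cyclicPoly ℓ f))
    [GradedAlgebra (coordGrading (cyclicWeights u₀ u) (cyclicPoly ℓ f))] :
    ¬ IsIntegral (Proj (coordGrading (cyclicWeights u₀ u) (cyclicPoly ℓ f))) := by
  have hℓ0 : ℓ ≠ 0 := by omega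
  obtain ⟨i, hi⟩ := exists_eval_pderiv_ne_zero hℓ (by omega) hf hnd (one_ne_zero (α := Fin 1 → ℂ))
  have hf' := eq_monomial_of_isWeightedHomogeneous hu hf
  rw [hu₀, mul_one] at hf'
  set z := coeff (Finsupp.single 0 ℓ) f
  have hz : z ≠ 0 := by
    intro h
    rw [hf', h] at hi
    simp at hi
  obtain ⟨b, hb⟩ := IsAlgClosed.exists_pow_nat_eq (-z) (by omega : 0 < ℓ)
  have hb0 : b ≠ 0 := by
    rintro rfl
    rw [zero_pow hℓ0] at hb
    exact hz (by linear_combination hb)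
  obtain ⟨ζ, hζ⟩ : ∃ ζ : ℂ, IsPrimitiveRoot ζ ℓ := ⟨_, Complex.isPrimitiveRoot_exp ℓ hℓ0⟩
  have hζ1 := hζ.ne_one (by omega)
  have h0 : cyclicWeights u₀ u 0 = 1 := hu₀
  have h1 : cyclicWeights u₀ u 1 = 1 := hu
  set G : MvPolynomial (Fin 2) ℂ :=
    ∑ i ∈ Finset.range ℓ, X 0 ^ i * (C b * X 1) ^ (ℓ - 1 - i) with hG
  have hlin : IsWeightedHomogeneous (cyclicWeights u₀ u) (C b * X 1 : MvPolynomial (Fin 2) ℂ) 1 := by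
    have h := (isWeightedHomogeneous_C (cyclicWeights u₀ u) b).mul
      (isWeightedHomogeneous_X ℂ (cyclicWeights u₀ u) 1)
    rwa [h1, zero_add] at h
  have hX0 : IsWeightedHomogeneous (cyclicWeights u₀ u) (X 0 : MvPolynomial (Fin 2) ℂ) 1 := by
    have h := isWeightedHomogeneous_X ℂ (cyclicWeights u₀ u) 0
    rwa [h0] at h
  have hGw : IsWeightedHomogeneous (cyclicWeights u₀ u) G ((ℓ - 1) • cyclicWeights u₀ u 1) := by
    refine IsWeightedHomogeneous.sum _ _ _ fun i hi => ?_
    rw [Finset.mem_range] at hi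
    convert (hX0.pow i).mul (hlin.pow (ℓ - 1 - i)) using 1
    simp only [smul_eq_mul, h1]
    omega
  have hl : IsWeightedHomogeneous (cyclicWeights u₀ u) (X 0 - C b * X 1 : MvPolynomial (Fin 2) ℂ)
      (1 • cyclicWeights u₀ u 1) := by
    rw [one_smul, h1]
    exact (weightedHomogeneousSubmodule ℂ (cyclicWeights u₀ u) 1).sub_mem hX0 hlin
  have hfac : cyclicPoly ℓ f = G * (X 0 - C b * X 1) := by
    rw [hG, geom_sum₂_mul, cyclicPoly, hf', map_mul, map_pow, rename_C, rename_X, mul_pow, ← C_pow,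
      hb, C_neg]
    simp
  have hGe : ∀ s : ℂ, eval ![s, 1] G * (s - b) = s ^ ℓ - b ^ ℓ := fun s => by
    rw [hG]
    simp only [map_sum, map_mul, map_pow, eval_X, eval_C, Matrix.cons_val_zero,
      Matrix.cons_val_one, mul_one]
    exact geom_sum₂_mul s b ℓ
  refine not_isIntegral_proj_of_mul (k := 1) (by rw [h1]; exact one_pos) hGw hl hfac
    (x := ![b, 1]) (y := ![b * ζ, 1]) (by simp) (by simp) ?_ (by simp) ?_ ?_
  · rw [hG]
    simp only [map_sum, map_mul, map_pow, eval_X, eval_C, Matrix.cons_val_zero,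
      Matrix.cons_val_one, mul_one]
    rw [Finset.sum_congr rfl (g := fun _ => b ^ (ℓ - 1)) fun i hi => by
      rw [← pow_add]; rw [Finset.mem_range] at hi; congr 1; omega]
    simp [hb0, hℓ0]
  · have : b * ζ - b ≠ 0 := by
      rw [show b * ζ - b = b * (ζ - 1) by ring]
      exact mul_ne_zero hb0 (sub_ne_zero.2 hζ1)
    simpa using this
  · have h := hGe (b * ζ)
    rw [mul_pow, hζ.pow_eq_one, mul_one, sub_self] at h
    refine (mul_eq_zero.1 h).resolve_right ?_
    rw [show b * ζ - b = b * (ζ - 1) by ring]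
    exact mul_ne_zero hb0 (sub_ne_zero.2 hζ1)

/-- A non-degenerate well-formed integral cyclic hypersurface has positive dimension. -/
theorem two_le_of_isIntegral_cyclicPoly (hℓ : 2 ≤ ℓ)
    (hf : IsWeightedHomogeneous u f (ℓ * u₀)) (hN : IsNormalized (cyclicWeights u₀ u))
    (hnd : IsNondegenerate (cyclicPoly ℓ f))
    (hI : IsIntegral (hypersurface (cyclicWeights u₀ u) (cyclicPoly ℓ f)
      (cyclicPoly_isWeightedHomogeneous hf))) : 2 ≤ m := by
  by_contra! hm
  interval_cases m
  -- For $m=0$ the gcd of the empty family is $0$, not $1$.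
  · have := hN 0
    rw [show (Finset.univ.erase (0 : Fin 1)) = ∅ by decide] at this
    simp at this
  -- For $m=1$ normalization forces both weights to be $1$.
  · have h0 := hN 0
    have h1 := hN 1
    rw [show (Finset.univ.erase (0 : Fin 2)) = {1} by decide, Finset.gcd_singleton] at h0
    rw [show (Finset.univ.erase (1 : Fin 2)) = {0} by decide, Finset.gcd_singleton] at h1
    let hG := coordGradedAlgebra _ _ (cyclicPoly_isWeightedHomogeneous hf)
    exact not_isIntegral_cyclicPoly_one hℓ (by simpa [cyclicWeights] using h1)
      (by simpa [cyclicWeights] using h0) hf hnd hI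

/-- The monomial $x_0^\ell$, with $\ell\ge2$, shows that the polynomial is nonzero and not
proportional to a variable; $m\ge2$ supplies the three variables needed for primality. -/
theorem isWellFormedCone_cyclicPoly (hm : 2 ≤ m) (hℓ : 2 ≤ ℓ) (hu₀ : 0 < u₀) (hu : ∀ i, 0 < u i)
    (hf : IsWeightedHomogeneous u f (ℓ * u₀))
    (hwf : IsWellFormed (cyclicWeights u₀ u) (cyclicPoly ℓ f))
    (hnd : IsNondegenerate (cyclicPoly ℓ f)) :
    IsWellFormedCone (cyclicWeights u₀ u) (cyclicPoly ℓ f) (ℓ * u₀) := by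
  have hF := cyclicPoly_isWeightedHomogeneous hf
  have hd : 0 < ℓ * u₀ := by positivity
  have hc : coeff (Finsupp.single 0 ℓ) (cyclicPoly ℓ f) ≠ 0 := by
    rw [coeff_cyclicPoly hℓ]
    exact one_ne_zero
  have hunit := not_isUnit_of_isWeightedHomogeneous hF hd
  exact
    { pos := cyclicWeights_pos hu₀ hu
      homogeneous := hF
      degree_pos := hd
      card := by simpa using hm
      prime := prime_of_isNondegenerate (i := ⟨0, by omega⟩) (j := ⟨1, by omega⟩)
        (k := ⟨2, by omega⟩) (cyclicWeights_pos hu₀ hu) hF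
        (fun h => hc (by rw [h, coeff_zero])) hunit hnd (by simp) (by simp) (by simp)
      not_dvd_X := fun k => not_dvd_X_of_coeff_ne_zero hunit hc fun h => by
        have := congrArg Finsupp.degree h
        rw [Finsupp.degree_single, Finsupp.degree_single] at this
        omega
      nondegenerate := hnd
      wellFormed := hwf }

theorem degree_cyclicPoly_of_isCalabiYau (hℓ : 2 ≤ ℓ) (hu₀ : 0 < u₀) (hu : ∀ i, 0 < u i)
    (hf : IsWeightedHomogeneous u f (ℓ * u₀))
    (hwf : IsWellFormed (cyclicWeights u₀ u) (cyclicPoly ℓ f))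
    (hnd : IsNondegenerate (cyclicPoly ℓ f))
    (hcy : IsCalabiYau (hypersurfaceToSpec (cyclicWeights u₀ u) (cyclicPoly ℓ f)
        (cyclicPoly_isWeightedHomogeneous hf))) : 2 ≤ m ∧ ℓ * u₀ = u₀ + ∑ i, u i := by
  have hm := two_le_of_isIntegral_cyclicPoly hℓ hf hwf.1 hnd hcy.integral
  refine ⟨hm, ?_⟩
  rw [(isCalabiYau_hypersurfaceToSpec_iff (isWellFormedCone_cyclicPoly hm hℓ hu₀ hu hf hwf hnd)
    _).1 hcy, Fin.sum_univ_succ]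
  rfl

end Cyclic


/-! ### The twisted hypersurface $f-g=0$ and the numerical conclusion. -/

section Twist

variable {m n ℓ u₀ v₀ : ℕ} {u : Fin m → ℕ} {v : Fin n → ℕ}
  {f : MvPolynomial (Fin m) ℂ} {g : MvPolynomial (Fin n) ℂ}

theorem eval_twistPoly (x : Fin m ⊕ Fin n → ℂ) :
    eval x (twistPoly f g) = eval (x ∘ Sum.inl) f - eval (x ∘ Sum.inr) g := by
  rw [twistPoly, map_sub, eval_rename, eval_rename]

theorem eval_pderiv_inl_twistPoly (x : Fin m ⊕ Fin n → ℂ) (i : Fin m) :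
    eval x (pderiv (Sum.inl i) (twistPoly f g)) = eval (x ∘ Sum.inl) (pderiv i f) := by
  have h : pderiv (Sum.inl i) (rename Sum.inr g : MvPolynomial (Fin m ⊕ Fin n) ℂ) = 0 := by
    refine pderiv_eq_zero_of_notMem_vars fun h => ?_
    classical
    obtain ⟨j, -, hj⟩ := Finset.mem_image.1 (vars_rename _ _ h)
    exact Sum.inr_ne_inl hj
  rw [twistPoly, map_sub, h, sub_zero, pderiv_rename Sum.inl_injective, eval_rename]

theorem eval_pderiv_inr_twistPoly (x : Fin m ⊕ Fin n → ℂ) (j : Fin n) :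
    eval x (pderiv (Sum.inr j) (twistPoly f g)) = -eval (x ∘ Sum.inr) (pderiv j g) := by
  have h : pderiv (Sum.inr j) (rename Sum.inl f : MvPolynomial (Fin m ⊕ Fin n) ℂ) = 0 := by
    refine pderiv_eq_zero_of_notMem_vars fun h => ?_
    classical
    obtain ⟨j, -, hj⟩ := Finset.mem_image.1 (vars_rename _ _ h)
    exact Sum.inl_ne_inr hj
  rw [twistPoly, map_sub, h, zero_sub, pderiv_rename Sum.inr_injective, map_neg, eval_rename]

theorem isNondegenerate_twistPoly (hf : ∀ x : Fin m → ℂ, x ≠ 0 → ∃ i, eval x (pderiv i f) ≠ 0)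
    (hg : ∀ y : Fin n → ℂ, y ≠ 0 → ∃ j, eval y (pderiv j g) ≠ 0) :
    IsNondegenerate (twistPoly f g) := by
  intro x hx _
  by_cases h1 : x ∘ Sum.inl = 0
  · by_cases h2 : x ∘ Sum.inr = 0
    · exfalso
      refine hx (funext fun k => ?_)
      rcases k with i | j
      · exact congrFun h1 i
      · exact congrFun h2 j
    · obtain ⟨j, hj⟩ := hg _ h2
      exact ⟨Sum.inr j, by rwa [eval_pderiv_inr_twistPoly, neg_ne_zero]⟩
  · obtain ⟨i, hi⟩ := hf _ h1
    exact ⟨Sum.inl i, by rwa [eval_pderiv_inl_twistPoly]⟩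

theorem twistWeights_pos (hu₀ : 0 < u₀) (hv₀ : 0 < v₀) (hu : ∀ i, 0 < u i) (hv : ∀ j, 0 < v j)
    (k : Fin m ⊕ Fin n) : 0 < twistWeights u₀ v₀ u v k := by
  rcases k with i | j
  · exact Nat.mul_pos hv₀ (hu i)
  · exact Nat.mul_pos hu₀ (hv j)

theorem sum_twistWeights :
    ∑ k, twistWeights u₀ v₀ u v k = v₀ * ∑ i, u i + u₀ * ∑ j, v j := by
  rw [Fintype.sum_sum_type, Finset.mul_sum, Finset.mul_sum]
  rfl

/-- If $p\nmid u_0$, then $p$ divides all $v_j$, against the normalization of $(v_0,v)$ with $v_0$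
left out. By coprimality $p\nmid v_0$, so divisibility of $v_0u_i$ passes to $u_i$. -/
theorem dvd_of_dvd_twistWeights (hgcd : Nat.Coprime u₀ v₀) (hN : IsNormalized (cyclicWeights v₀ v))
    {p : ℕ} (hp : p.Prime) (h : ∀ j, p ∣ u₀ * v j) :
    p ∣ u₀ ∧ ∀ i, p ∣ v₀ * u i → p ∣ u i := by
  have h0 : p ∣ u₀ := by
    by_contra h0
    refine hp.one_lt.ne' (Nat.dvd_one.1 ?_)
    rw [← hN 0, Finset.dvd_gcd_iff]
    intro k hk
    obtain ⟨j, rfl⟩ := Fin.exists_succ_eq.2 (Finset.ne_of_mem_erase hk)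
    exact (hp.dvd_mul.1 (h j)).resolve_left h0
  refine ⟨h0, fun i hi => (hp.dvd_mul.1 hi).resolve_left fun h1 => ?_⟩
  exact hp.one_lt.ne' (Nat.dvd_one.1 (hgcd ▸ Nat.dvd_gcd h0 h1))

/-- Such a prime would divide $u_0$ and all $u_{i'}$ with $i'\ne i$, against the normalization of
$(u_0,u)$ with $u_i$ left out. -/
theorem not_dvd_twistWeights (hgcd : Nat.Coprime u₀ v₀) (hN₁ : IsNormalized (cyclicWeights u₀ u))
    (hN₂ : IsNormalized (cyclicWeights v₀ v)) {p : ℕ} (hp : p.Prime) (i : Fin m)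
    (h : ∀ j, p ∣ u₀ * v j) (h' : ∀ i' ≠ i, p ∣ v₀ * u i') : False := by
  obtain ⟨h0, h1⟩ := dvd_of_dvd_twistWeights (u := u) hgcd hN₂ hp h
  refine hp.one_lt.ne' (Nat.dvd_one.1 ?_)
  rw [← hN₁ i.succ, Finset.dvd_gcd_iff]
  intro k hk
  have hk' := Finset.ne_of_mem_erase hk
  revert hk'
  refine Fin.cases (fun _ => h0) (fun i' hi' => ?_) k
  exact h1 i' (h' i' fun h => hi' (by rw [h]))

theorem isNormalized_twistWeights (hgcd : Nat.Coprime u₀ v₀)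
    (hN₁ : IsNormalized (cyclicWeights u₀ u)) (hN₂ : IsNormalized (cyclicWeights v₀ v)) :
    IsNormalized (twistWeights u₀ v₀ u v) := by
  intro k
  refine Nat.eq_one_iff_not_exists_prime_dvd.2 fun p hp hdvd => ?_
  rw [Finset.dvd_gcd_iff] at hdvd
  rcases k with i | j
  · exact not_dvd_twistWeights hgcd hN₁ hN₂ hp i
      (fun j => hdvd (Sum.inr j) (by simp)) fun i' hi' => hdvd (Sum.inl i') (by simpa using hi')
  · exact not_dvd_twistWeights hgcd.symm hN₂ hN₁ hp j
      (fun i => hdvd (Sum.inl i) (by simp)) fun j' hj' => hdvd (Sum.inr j') (by simpa using hj')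

/-- If $f=x_ih$, then $x_i$ and $\partial_if$ have a nontrivial common zero in three variables, and
there the other derivatives vanish too, being multiples of $x_i$. The bound $u_i<d$ ensures that
$\partial_if$ has no constant term. -/
theorem exists_eval_ne_zero_of_three_le (hm : 3 ≤ m) {d : ℕ} (hf : IsWeightedHomogeneous u f d)
    (hud : ∀ i, u i < d)
    (hnd : ∀ x : Fin m → ℂ, x ≠ 0 → ∃ i, eval x (pderiv i f) ≠ 0) (i : Fin m) :
    ∃ x : Fin m → ℂ, x i = 0 ∧ eval x f ≠ 0 := by
  by_contra! hcon
  obtain ⟨h, hh⟩ := X_dvd_of_eval_eq_zero hcon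
  have hp : IsWeightedHomogeneous u (pderiv i f) (d - u i) :=
    hf.pderiv (Nat.sub_add_cancel (hud i).le)
  have hp0 := eval_zero_of_isWeightedHomogeneous hp (Nat.sub_pos_of_lt (hud i))
  obtain ⟨x, hx, h1, h2⟩ := exists_common_zero (σ := Fin m) (i := ⟨0, by omega⟩)
    (j := ⟨1, by omega⟩) (k := ⟨2, by omega⟩) (by simp) (by simp) (by simp)
    (p := X i) (q := pderiv i f) (by simp) hp0
  rw [eval_X] at h1
  obtain ⟨k, hk⟩ := hnd x hx
  by_cases hki : k = i
  · exact hk (hki ▸ h2)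
  · refine hk ?_
    rw [hh, pderiv_mul, pderiv_X_of_ne (Ne.symm hki)]
    simp [h1]

theorem exists_eval_ne_zero {σ : Type} {f : MvPolynomial σ ℂ} (hf : f ≠ 0) :
    ∃ x : σ → ℂ, eval x f ≠ 0 := by
  by_contra! h
  exact hf (MvPolynomial.funext fun x => by rw [h, map_zero])

/-- $X$ contains no stratum of codimension two. When both coordinates belong to one block, setting
that whole block to zero leaves the other polynomial, which is nonzero. For a mixed pair, $m+n\ge5$
gives a block of at least three variables, whose polynomial does not vanish identically on a
coordinate hyperplane. -/
theorem isWellFormed_twist (hmn : 5 ≤ m + n) {d₁ d₂ : ℕ}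
    (hgcd : Nat.Coprime u₀ v₀) (hN₁ : IsNormalized (cyclicWeights u₀ u))
    (hN₂ : IsNormalized (cyclicWeights v₀ v)) (hd₁ : 0 < d₁) (hd₂ : 0 < d₂)
    (hf : IsWeightedHomogeneous u f d₁) (hg : IsWeightedHomogeneous v g d₂)
    (hf0 : f ≠ 0) (hg0 : g ≠ 0) (hud : ∀ i, u i < d₁) (hvd : ∀ j, v j < d₂)
    (hfnd : ∀ x : Fin m → ℂ, x ≠ 0 → ∃ i, eval x (pderiv i f) ≠ 0)
    (hgnd : ∀ y : Fin n → ℂ, y ≠ 0 → ∃ j, eval y (pderiv j g) ≠ 0) :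
    IsWellFormed (twistWeights u₀ v₀ u v) (twistPoly f g) := by
  have hl : ∀ x : Fin m → ℂ, eval (Sum.elim x 0 : Fin m ⊕ Fin n → ℂ) (twistPoly f g) =
      eval x f := fun x => by
    rw [eval_twistPoly, Sum.elim_comp_inl, Sum.elim_comp_inr,
      eval_zero_of_isWeightedHomogeneous hg hd₂, sub_zero]
  have hr : ∀ y : Fin n → ℂ, eval (Sum.elim 0 y : Fin m ⊕ Fin n → ℂ) (twistPoly f g) =
      -eval y g := fun y => by
    rw [eval_twistPoly, Sum.elim_comp_inl, Sum.elim_comp_inr,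
      eval_zero_of_isWeightedHomogeneous hf hd₁, zero_sub]
  have hmix : ∀ i j, ∃ x : Fin m ⊕ Fin n → ℂ, x (Sum.inl i) = 0 ∧ x (Sum.inr j) = 0 ∧
      eval x (twistPoly f g) ≠ 0 := by
    intro i j
    rcases (by omega : 3 ≤ m ∨ 3 ≤ n) with h | h
    · obtain ⟨x, hx, hxf⟩ := exists_eval_ne_zero_of_three_le h hf hud hfnd i
      exact ⟨Sum.elim x 0, hx, rfl, by rwa [hl]⟩
    · obtain ⟨y, hy, hyg⟩ := exists_eval_ne_zero_of_three_le h hg hvd hgnd j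
      exact ⟨Sum.elim 0 y, rfl, hy, by rwa [hr, neg_ne_zero]⟩
  refine ⟨isNormalized_twistWeights hgcd hN₁ hN₂, ?_⟩
  rintro (i | i) (j | j) - -
  · obtain ⟨y, hy⟩ := exists_eval_ne_zero hg0
    exact ⟨Sum.elim 0 y, rfl, rfl, by rwa [hr, neg_ne_zero]⟩
  · exact hmix i j
  · obtain ⟨x, h1, h2, h3⟩ := hmix j i
    exact ⟨x, h2, h1, h3⟩
  · obtain ⟨x, hx⟩ := exists_eval_ne_zero hf0
    exact ⟨Sum.elim x 0, rfl, rfl, by rwa [hl]⟩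

theorem isWellFormedCone_twistPoly (hmn : 5 ≤ m + n) (hm : 2 ≤ m) (hn : 2 ≤ n)
    (hℓ : 0 < ℓ) (hu₀ : 0 < u₀) (hv₀ : 0 < v₀) (hu : ∀ i, 0 < u i) (hv : ∀ j, 0 < v j)
    (hgcd : Nat.Coprime u₀ v₀) (hN₁ : IsNormalized (cyclicWeights u₀ u))
    (hN₂ : IsNormalized (cyclicWeights v₀ v))
    (hf : IsWeightedHomogeneous u f (ℓ * u₀)) (hg : IsWeightedHomogeneous v g (ℓ * v₀))
    (hud : ∀ i, u i < ℓ * u₀) (hvd : ∀ j, v j < ℓ * v₀)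
    (hfnd : ∀ x : Fin m → ℂ, x ≠ 0 → ∃ i, eval x (pderiv i f) ≠ 0)
    (hgnd : ∀ y : Fin n → ℂ, y ≠ 0 → ∃ j, eval y (pderiv j g) ≠ 0) :
    IsWellFormedCone (twistWeights u₀ v₀ u v) (twistPoly f g) (u₀ * v₀ * ℓ) := by
  have hF := twistPoly_isWeightedHomogeneous hf hg
  have hd : 0 < u₀ * v₀ * ℓ := by positivity
  have hw := twistWeights_pos hu₀ hv₀ hu hv
  have hnd := isNondegenerate_twistPoly hfnd hgnd
  have hunit := not_isUnit_of_isWeightedHomogeneous hF hd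
  have hne : ∀ {k : ℕ} {p : MvPolynomial (Fin k) ℂ}, 2 ≤ k →
      (∀ x : Fin k → ℂ, x ≠ 0 → ∃ i, eval x (pderiv i p) ≠ 0) → p ≠ 0 := by
    rintro k p hk h rfl
    obtain ⟨i, hi⟩ := h (fun _ => 1) fun h => one_ne_zero (congrFun h ⟨0, by omega⟩)
    simp at hi
  have hF0 : twistPoly f g ≠ 0 := by
    intro h
    obtain ⟨i, hi⟩ := hnd (fun _ => 1)
      (fun h => one_ne_zero (congrFun h (Sum.inl ⟨0, by omega⟩))) (by rw [h, map_zero])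
    simp [h] at hi
  obtain ⟨a, ha⟩ := ne_zero_iff.1 hF0
  exact
    { pos := hw
      homogeneous := hF
      degree_pos := hd
      card := by simp; omega
      prime := prime_of_isNondegenerate (i := Sum.inl ⟨0, by omega⟩) (j := Sum.inl ⟨1, by omega⟩)
        (k := Sum.inr ⟨0, by omega⟩) hw hF hF0 hunit hnd (by simp) (by simp) (by simp)
      not_dvd_X := fun k => not_dvd_X_of_coeff_ne_zero hunit ha fun h => by
        have h1 := hF ha
        -- A monomial consisting of one variable would have the degree of `F`, but each weight is
        -- strictly smaller.
        rw [h, Finsupp.weight_single, one_smul] at h1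
        rcases k with i | j
        · have := Nat.mul_lt_mul_of_pos_left (hud i) hv₀
          change v₀ * u i = _ at h1
          rw [h1] at this
          linarith
        · have := Nat.mul_lt_mul_of_pos_left (hvd j) hu₀
          change u₀ * v j = _ at h1
          rw [h1] at this
          linarith
      nondegenerate := hnd
      wellFormed := isWellFormed_twist hmn hgcd hN₁ hN₂ (by positivity) (by positivity) hf hg
        (hne hm hfnd) (hne hn hgnd) hud hvd hfnd hgnd }

theorem lt_of_eq_add_sum (hu₀ : 0 < u₀) (h : ℓ * u₀ = u₀ + ∑ i, u i) (i : Fin m) :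
    u i < ℓ * u₀ := by
  have := Finset.single_le_sum (f := u) (fun _ _ => Nat.zero_le _) (Finset.mem_univ i)
  omega

/-- The two degree formulas give weight sum $2(\ell-1)u_0v_0$, to be compared with $\ell u_0v_0$;
the proof keeps the term $2u_0v_0$ on the left to avoid subtraction. -/
theorem degree_eq_sum_twistWeights_iff (hu₀ : 0 < u₀) (hv₀ : 0 < v₀)
    (h₁ : ℓ * u₀ = u₀ + ∑ i, u i) (h₂ : ℓ * v₀ = v₀ + ∑ j, v j) :
    u₀ * v₀ * ℓ = ∑ k, twistWeights u₀ v₀ u v k ↔ ℓ = 2 := by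
  rw [sum_twistWeights]
  have h : v₀ * ∑ i, u i + u₀ * ∑ j, v j + 2 * (u₀ * v₀) = 2 * (u₀ * v₀ * ℓ) := by
    linear_combination -(v₀ * h₁) - u₀ * h₂
  have hpos : 0 < u₀ * v₀ := Nat.mul_pos hu₀ hv₀
  constructor
  · intro h3
    refine Nat.eq_of_mul_eq_mul_left hpos ?_
    omega
  · rintro rfl
    omega

end Twist

end WeightedCY

end

theorem mainTheorem6 (m n ℓ u₀ v₀ : ℕ) (u : Fin m → ℕ) (v : Fin n → ℕ)
    (f : MvPolynomial (Fin m) ℂ) (g : MvPolynomial (Fin n) ℂ)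
    (hmn : 5 ≤ m + n) (hℓ : 2 ≤ ℓ)
    (hu₀ : 0 < u₀) (hv₀ : 0 < v₀) (hu : ∀ i, 0 < u i) (hv : ∀ j, 0 < v j)
    (hgcd : Nat.Coprime u₀ v₀)
    (hf : MvPolynomial.IsWeightedHomogeneous u f (ℓ * u₀))
    (hg : MvPolynomial.IsWeightedHomogeneous v g (ℓ * v₀))
    (hwf₁ : WeightedCY.IsWellFormed (WeightedCY.cyclicWeights u₀ u) (WeightedCY.cyclicPoly ℓ f))
    (hwf₂ : WeightedCY.IsWellFormed (WeightedCY.cyclicWeights v₀ v) (WeightedCY.cyclicPoly ℓ g))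
    (hnd₁ : WeightedCY.IsNondegenerate (WeightedCY.cyclicPoly ℓ f))
    (hnd₂ : WeightedCY.IsNondegenerate (WeightedCY.cyclicPoly ℓ g))
    (hcy₁ : WeightedCY.IsCalabiYau
      (WeightedCY.hypersurfaceToSpec (WeightedCY.cyclicWeights u₀ u) (WeightedCY.cyclicPoly ℓ f)
        (WeightedCY.cyclicPoly_isWeightedHomogeneous hf)))
    (hcy₂ : WeightedCY.IsCalabiYau
      (WeightedCY.hypersurfaceToSpec (WeightedCY.cyclicWeights v₀ v) (WeightedCY.cyclicPoly ℓ g)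
        (WeightedCY.cyclicPoly_isWeightedHomogeneous hg))) :
    WeightedCY.IsNondegenerate (WeightedCY.twistPoly f g) ∧
      (WeightedCY.IsCalabiYau
        (WeightedCY.hypersurfaceToSpec (WeightedCY.twistWeights u₀ v₀ u v)
          (WeightedCY.twistPoly f g)
          (WeightedCY.twistPoly_isWeightedHomogeneous hf hg)) ↔ ℓ = 2) := by
  obtain ⟨hm, hdeg₁⟩ :=
    WeightedCY.degree_cyclicPoly_of_isCalabiYau hℓ hu₀ hu hf hwf₁ hnd₁ hcy₁
  obtain ⟨hn, hdeg₂⟩ :=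
    WeightedCY.degree_cyclicPoly_of_isCalabiYau hℓ hv₀ hv hg hwf₂ hnd₂ hcy₂
  have hC := WeightedCY.isWellFormedCone_twistPoly hmn hm hn (by omega) hu₀ hv₀ hu hv hgcd
    hwf₁.1 hwf₂.1 hf hg (WeightedCY.lt_of_eq_add_sum hu₀ hdeg₁)
    (WeightedCY.lt_of_eq_add_sum hv₀ hdeg₂)
    (fun _ => WeightedCY.exists_eval_pderiv_ne_zero hℓ hu₀ hf hnd₁)
    (fun _ => WeightedCY.exists_eval_pderiv_ne_zero hℓ hv₀ hg hnd₂)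
  exact ⟨hC.nondegenerate, (WeightedCY.isCalabiYau_hypersurfaceToSpec_iff hC _).trans
    (WeightedCY.degree_eq_sum_twistWeights_iff hu₀ hv₀ hdeg₁ hdeg₂)⟩
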